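/- Let $0<\alpha<1$, $\varrho,L,T>0$, and let $u:[0,L]\times[0,T]\to\mathbb R$ solve $${}_CD_{0,t}^{\alpha}u(x,t)-\varrho\,\partial_x^2u(x,t)=f(x,t)\quad(0<x<L,\ 0<t\le T),$$ $u(0,t)=u(L,t)=0$ for $0<t\le T$ and $u(x,0)=\varphi(x)$ for $0\le x\le L$, where $f\in C([0,L]\times[0,T])$, $\varphi\in C[0,L]$ and ${}_CD_{0,t}^{\alpha}u(x,t)=\frac1{\Gamma(1-\alpha)}\int_0^t(t-s)^{-\alpha}\partial_su(x,s)\,ds$. Suppose there is a constant $M$ such that - for every $x\in(0,L)$: $u(x,\cdot)\in C[0,T]\cap C^4(0,T]$ and $|\partial_t^lu(x,t)|\le M(1+t^{\alpha-l})$ for $0<t\le T$, $l=0,\dots,4$; - for every $t\in(0,T]$: $u(\cdot,t)\in C[0,L]\cap C^4(0,L)$ and $|\partial_x^4u(x,t)|\le M$ for $0<x<L$. For positive integers $K_x,K_t$ let $h=L/K_x$, $\tau=T/K_t$, $x_i=ih$, $t_n=n\tau$ (the graded mesh $t_n=T(n/K_t)^r$ with $r=1$), and let $(u_i^n)$ satisfy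 $u_i^0=\varphi(x_i)$ for $0\le i\le K_x$, $u_0^n=u_{K_x}^n=0$ for $1\le n\le K_t$, and, for $1\le i\le K_x-1$, $1\le n\le K_t$, $$\frac1{\Gamma(2-\alpha)}\sum_{j=0}^np_j\,u_i^{n-j}=\varrho\,\frac{u_{i+1}^n-2u_i^n+u_{i-1}^n}{h^2}+f(x_i,t_n).$$ Here the coefficients $p_j=p_j^{(n)}$ are those obtained by replacing $\partial_su(x_i,s)$ in $\frac{1}{\Gamma(1-\alpha)}\int_0^{t_n}(t_n-s)^{-\alpha}\partial_su(x_i,s)\,ds$ by the derivative of the linear interpolant of $u(x_i,\cdot)$ at $t_0,t_1$ on $[t_0,t_1]$, of the quadratic interpolant at $t_0,t_1,t_2$ on $[t_1,t_2]$ (if $n\ge2$), and of the cubic interpolant at $t_{k-3},\dots,t_k$ on $[t_{k-1},t_k]$ for $3\le k\le n$; that is, the resulting expression equals $\frac{1}{\Gamma(2-\alpha)}\sum_{j=0}^np_j\,u(x_i,t_{n-j})$. Then there are constants $C,h_0,\tau_0>0$, independent of $K_x$, $K_t$ and $n$, such that whenever $h\le h_0$ and $\tau\le\tau_0$, $$\|e^n\|_\infty=\max_{0\le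 i\le K_x}|u(x_i,t_n)-u_i^n|\le C\,(h^2+\tau^\alpha),\qquad n=1,2,\dots,K_t .$$ -/

import Mathlib

open Set

noncomputable section

namespace TFDE

/-- The left Caputo derivative of order `α ∈ (0,1)` with base point `0`,
`(1/Γ(1-α)) ∫_0^t (t-s)^(-α) v'(s) ds`. -/
def caputo (α : ℝ) (v : ℝ → ℝ) (t : ℝ) : ℝ :=
  1 / Real.Gamma (1 - α) * ∫ s in (0 : ℝ)..t, (t - s) ^ (-α) * deriv v s

/-- `u` solves `D_t^α u - ϱ ∂_x² u = f` on `(0,L) × (0,T]` with homogeneous Dirichlet boundary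
conditions and initial value `φ`, where the data `f`, `φ` are continuous. -/
structure IsSolution (α ϱ L T : ℝ) (f : ℝ → ℝ → ℝ) (φ : ℝ → ℝ) (u : ℝ → ℝ → ℝ) : Prop where
  source_continuous : ContinuousOn (fun p : ℝ × ℝ => f p.1 p.2) (Icc 0 L ×ˢ Icc 0 T)
  initial_continuous : ContinuousOn φ (Icc 0 L)
  equation : ∀ x ∈ Ioo 0 L, ∀ t ∈ Ioc 0 T,
    caputo α (fun s => u x s) t - ϱ * iteratedDeriv 2 (fun y => u y t) x = f x t
  boundary : ∀ t ∈ Ioc 0 T, u 0 t = 0 ∧ u L t = 0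
  initial : ∀ x ∈ Icc 0 L, u x 0 = φ x

/-- Non-smooth regularity in time with constant `M`: `u(x,·) ∈ C[0,T] ∩ C⁴(0,T]` and
`|∂_t^l u(x,t)| ≤ M (1 + t^(α-l))` for `l = 0, …, 4`. -/
def TimeRegular (α L T M : ℝ) (u : ℝ → ℝ → ℝ) : Prop :=
  ∀ x ∈ Ioo 0 L,
    ContinuousOn (fun s => u x s) (Icc 0 T) ∧
    ContDiffOn ℝ 4 (fun s => u x s) (Ioc 0 T) ∧
    ∀ l : ℕ, l ≤ 4 → ∀ t ∈ Ioc 0 T,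
      |iteratedDerivWithin l (fun s => u x s) (Ioc 0 T) t| ≤ M * (1 + t ^ (α - (l : ℝ)))

/-- Regularity in space with constant `M`, which makes the central difference quotient
second order accurate: `u(·,t) ∈ C[0,L] ∩ C⁴(0,L)` and `|∂_x⁴ u(x,t)| ≤ M`. -/
def SpaceRegular (L T M : ℝ) (u : ℝ → ℝ → ℝ) : Prop :=
  ∀ t ∈ Ioc 0 T,
    ContinuousOn (fun y => u y t) (Icc 0 L) ∧
    ContDiffOn ℝ 4 (fun y => u y t) (Ioo 0 L) ∧
    ∀ x ∈ Ioo 0 L, |iteratedDeriv 4 (fun y => u y t) x| ≤ M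

/-- The graded temporal mesh `t_n = T (n / K)^r`. -/
def timeMesh (T r : ℝ) (K n : ℕ) : ℝ := T * ((n : ℝ) / (K : ℝ)) ^ r

/-- The uniform spatial mesh `x_i = i h`, `h = L / K`. -/
def spaceMesh (L : ℝ) (K i : ℕ) : ℝ := (i : ℝ) * (L / (K : ℝ))

/-! In the following `t : ℕ → ℝ` is the temporal mesh. -/

/-- The step size `τ_n = t_n - t_{n-1}` for `n ≥ 1`. -/
def step (t : ℕ → ℝ) (n : ℕ) : ℝ := t n - t (n - 1)

/-- Weight of the linear interpolant on `[t_0,t_1]`. -/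
def coefA (α : ℝ) (t : ℕ → ℝ) (n : ℕ) : ℝ :=
  1 / step t 1 * ((t n - t 0) ^ (1 - α) - (t n - t 1) ^ (1 - α))

/-- Weight `b_n`, multiplying the value at `t_0`, of the quadratic interpolant on `[t_1,t_2]`. -/
def coefB (α : ℝ) (t : ℕ → ℝ) (n : ℕ) : ℝ :=
  1 / (step t 1 * (step t 1 + step t 2)) *
    (2 / (2 - α) * ((t n - t 1) ^ (2 - α) - (t n - t 2) ^ (2 - α))
      - step t 2 * ((t n - t 1) ^ (1 - α) + (t n - t 2) ^ (1 - α)))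

/-- Weight `c_n`, multiplying the value at `t_1`, of the quadratic interpolant. -/
def coefC (α : ℝ) (t : ℕ → ℝ) (n : ℕ) : ℝ :=
  -(1 / (step t 1 * step t 2)) *
    (2 / (2 - α) * ((t n - t 1) ^ (2 - α) - (t n - t 2) ^ (2 - α))
      + (step t 1 - step t 2) * (t n - t 1) ^ (1 - α)
      - (step t 1 + step t 2) * (t n - t 2) ^ (1 - α))

/-- Weight `d_n`, multiplying the value at `t_2`, of the quadratic interpolant. -/
def coefD (α : ℝ) (t : ℕ → ℝ) (n : ℕ) : ℝ :=
  1 / (step t 2 * (step t 1 + step t 2)) *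
    (2 / (2 - α) * ((t n - t 1) ^ (2 - α) - (t n - t 2) ^ (2 - α))
      + step t 1 * (t n - t 1) ^ (1 - α)
      - (2 * step t 2 + step t 1) * (t n - t 2) ^ (1 - α))

/-- Weight `w_{1,k}^n`, multiplying the value at `t_k`, of the cubic interpolant on
`[t_{k-1},t_k]`, `k ≥ 3`, with nodes `t_{k-3}, …, t_k`. -/
def coefW1 (α : ℝ) (t : ℕ → ℝ) (n k : ℕ) : ℝ :=
  1 / (step t k * (step t k + step t (k - 1)) *
      (step t k + step t (k - 1) + step t (k - 2))) *
    (step t (k - 1) * (step t (k - 1) + step t (k - 2)) * (t n - t (k - 1)) ^ (1 - α)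
      - ((step t k + step t (k - 1)) * (2 * step t k + step t (k - 1) + step t (k - 2))
          + step t k * (step t k + step t (k - 1) + step t (k - 2))) * (t n - t k) ^ (1 - α)
      + 2 / (2 - α) *
        ((2 * step t (k - 1) + step t (k - 2)) * (t n - t (k - 1)) ^ (2 - α)
          - (3 * step t k + 2 * step t (k - 1) + step t (k - 2)) * (t n - t k) ^ (2 - α))
      + 6 / ((2 - α) * (3 - α)) * ((t n - t (k - 1)) ^ (3 - α) - (t n - t k) ^ (3 - α)))

/-- Weight `w_{2,k}^n`, multiplying the value at `t_{k-1}`, of the same interpolant. -/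
def coefW2 (α : ℝ) (t : ℕ → ℝ) (n k : ℕ) : ℝ :=
  1 / (step t k * step t (k - 1) * (step t (k - 1) + step t (k - 2))) *
    ((step t (k - 1) * (step t k - step t (k - 1) - step t (k - 2))
        + step t k * (step t (k - 1) + step t (k - 2))) * (t n - t (k - 1)) ^ (1 - α)
      + (step t k + step t (k - 1) + step t (k - 2)) * (step t k + step t (k - 1)) *
        (t n - t k) ^ (1 - α)
      + 2 / (2 - α) *
        ((step t k - 2 * step t (k - 1) - step t (k - 2)) * (t n - t (k - 1)) ^ (2 - α)
          + (2 * step t k + 2 * step t (k - 1) + step t (k - 2)) * (t n - t k) ^ (2 - α))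
      - 6 / ((2 - α) * (3 - α)) * ((t n - t (k - 1)) ^ (3 - α) - (t n - t k) ^ (3 - α)))

/-- Weight `w_{3,k}^n`, multiplying the value at `t_{k-2}`, of the same interpolant. -/
def coefW3 (α : ℝ) (t : ℕ → ℝ) (n k : ℕ) : ℝ :=
  1 / (step t (k - 1) * step t (k - 2) * (step t k + step t (k - 1))) *
    (-(step t k) * (step t (k - 1) + step t (k - 2)) * (t n - t (k - 1)) ^ (1 - α)
      - step t k * (step t k + step t (k - 1) + step t (k - 2)) * (t n - t k) ^ (1 - α)
      + 2 / (2 - α) *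
        ((step t (k - 1) + step t (k - 2) - step t k) * (t n - t (k - 1)) ^ (2 - α)
          - (2 * step t k + step t (k - 1) + step t (k - 2)) * (t n - t k) ^ (2 - α))
      + 6 / ((2 - α) * (3 - α)) * ((t n - t (k - 1)) ^ (3 - α) - (t n - t k) ^ (3 - α)))

/-- Weight `w_{4,k}^n`, multiplying the value at `t_{k-3}`, of the same interpolant. -/
def coefW4 (α : ℝ) (t : ℕ → ℝ) (n k : ℕ) : ℝ :=
  1 / (step t (k - 2) * (step t (k - 1) + step t (k - 2)) *
      (step t k + step t (k - 1) + step t (k - 2))) *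
    (step t (k - 1) * step t k * (t n - t (k - 1)) ^ (1 - α)
      + step t k * (step t k + step t (k - 1)) * (t n - t k) ^ (1 - α)
      + 2 / (2 - α) *
        ((step t k - step t (k - 1)) * (t n - t (k - 1)) ^ (2 - α)
          + (2 * step t k + step t (k - 1)) * (t n - t k) ^ (2 - α))
      - 6 / ((2 - α) * (3 - α)) * ((t n - t (k - 1)) ^ (3 - α) - (t n - t k) ^ (3 - α)))

/-- The coefficient `p_j` at time level `n` (`0 ≤ j ≤ n`, `1 ≤ n`): everything that multiplies
the value at `t_{n-j}` when the linear interpolant is used on `[t_0,t_1]`, the quadratic one on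
`[t_1,t_2]` (if `n ≥ 2`) and the cubic ones on `[t_{k-1},t_k]`, `3 ≤ k ≤ n`. -/
def coefP (α : ℝ) (t : ℕ → ℝ) (n j : ℕ) : ℝ :=
  (if 3 ≤ n - j then coefW1 α t n (n - j) else 0)
  + (if 1 ≤ j ∧ 3 ≤ n - j + 1 then coefW2 α t n (n - j + 1) else 0)
  + (if 2 ≤ j ∧ 3 ≤ n - j + 2 then coefW3 α t n (n - j + 2) else 0)
  + (if 3 ≤ j then coefW4 α t n (n - j + 3) else 0)
  + (if n - j = 0 then -coefA α t n + (if 2 ≤ n then coefB α t n else 0)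
     else if n - j = 1 then coefA α t n + (if 2 ≤ n then coefC α t n else 0)
     else if n - j = 2 then coefD α t n else 0)

/-- The discrete Caputo derivative `(1/Γ(2-α)) ∑_{j=0}^n p_j v^{n-j}` at time level `n`. -/
def discreteCaputo (α : ℝ) (t : ℕ → ℝ) (v : ℕ → ℝ) (n : ℕ) : ℝ :=
  1 / Real.Gamma (2 - α) * ∑ j ∈ Finset.range (n + 1), coefP α t n j * v (n - j)

/-- The mesh function `v`, with `v i n` the value at `(x_i,t_n)`, solves the difference scheme on
the graded mesh with grading parameter `r`. -/
structure IsSchemeSolution (α ϱ L T r : ℝ) (Kx Kt : ℕ) (f : ℝ → ℝ → ℝ) (φ : ℝ → ℝ)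
    (v : ℕ → ℕ → ℝ) : Prop where
  equation : ∀ n : ℕ, 1 ≤ n → n ≤ Kt → ∀ i : ℕ, 1 ≤ i → i + 1 ≤ Kx →
    discreteCaputo α (timeMesh T r Kt) (v i) n
      = ϱ * ((v (i + 1) n - 2 * v i n + v (i - 1) n) / (L / (Kx : ℝ)) ^ 2)
        + f (spaceMesh L Kx i) (timeMesh T r Kt n)
  boundary : ∀ n : ℕ, 1 ≤ n → n ≤ Kt → v 0 n = 0 ∧ v Kx n = 0
  initial : ∀ i : ℕ, i ≤ Kx → v i 0 = φ (spaceMesh L Kx i)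

/-- The maximum norm `max_{0 ≤ i ≤ K} |e_i|` of a spatial mesh function. -/
def maxNorm (K : ℕ) (e : ℕ → ℝ) : ℝ :=
  (Finset.range (K + 1)).sup' Finset.nonempty_range_add_one (fun i => |e i|)

end TFDE

end

noncomputable section
namespace TFDE
open MeasureTheory

/-! The proof is stability times consistency, both written in terms of the moments of
$(m+\sigma)^{-\alpha}$. On the uniform mesh, Newton's backward form of the interpolant on
$[t_{k-1},t_k]$ has at $t_k-\sigma\tau$ the derivative $\tau^{-1}(\nabla
v_k+(\tfrac12-\sigma)\nabla^2v_k+\tfrac16(3\sigma^2-6\sigma+2)\nabla^3v_k)$, with fewer terms for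
$k\le2$. The discrete Caputo derivative is therefore a convolution of backward differences with
moments (`discreteCaputo_eq`). For $v_0=0$ it differs only in the columns $k=1,2$ from the
translation invariant convolution whose generating function is `symb` (`sum_symbSeries_eq`).

Stability. The power $s^{-\alpha}$ is a Laplace transform of a positive density, so `symb` is an
explicit integral. The inequalities $0\le$ `lap ker₃` $\le$ `lap ker₂` show that on the closed disc
without $1$ its imaginary part has the sign opposite to that of $\operatorname{Im}z$, and that it is
positive for real $z$. Hence it avoids $(-\infty,0]$, and quantitatively
$|\mu|+\operatorname{Re}\mu\ge c|1-z|^\alpha$ for $\mu=$ `symb α z` (`exists_symb_lower`). Factoring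
the second difference operator as $(1-\zeta S)(1-\zeta S')$ up to a scalar bounds its resolvent in
the maximum norm by $2/(|\mu|+\operatorname{Re}\mu)$ (`exists_resolvent`). With $|\mu'|\le
C|1-z|^{\alpha-1}$ (`exists_deriv_symb_le`), the derivative of the resolvent is
$O(|1-z|^{-1-\alpha})$, and Cauchy's formula gives solution operators of norm $O((n+1)^{\alpha-1})$,
uniformly in the ratio of the mesh sizes (`exists_kernel`). Odd periodic extension carries this from
sequences on $\mathbb Z$ to the Dirichlet problem. The two exceptional columns involve only
$e^1,e^2$, which a discrete maximum principle bounds, with coefficients summable in $n$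
(`exists_scheme_stability`).

Consistency. The local error of the differentiated interpolant has mean zero on each subinterval and
size $k^{\alpha-2}$ relative to $\tau^\alpha$, so the truncation error in time at level $n$ is at
most a constant times `timeErr α n` $=\sum_k k^{\alpha-2}\,$`decr α (n-k)`. This does not tend to
zero with $\tau$ for fixed $n$, but its sum over $n$ is bounded. In the stability estimate the
residual carries a factor $\tau^\alpha$: the summable part contributes $\tau^\alpha$, while the
spatial error $h^2$ meets $\tau^\alpha\sum_{j<n}(j+1)^{\alpha-1}\le T^\alpha/\alpha$ and contributes
$h^2$. -/

/-! ### Laplace representation of the moments. -/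

/-- The moments `∫_0^1 (m+σ)^(-α) k(σ) dσ`. -/
def mom (α : ℝ) (k : ℝ → ℝ) (m : ℕ) : ℝ := ∫ σ in (0 : ℝ)..1, ((m : ℝ) + σ) ^ (-α) * k σ

/-- The Laplace transform of `k` over the unit interval. -/
def lap (k : ℝ → ℝ) (y : ℝ) : ℝ := ∫ σ in (0 : ℝ)..1, Real.exp (-(σ * y)) * k σ

/-- The density `y^(α-1)/Γ(α)`, whose Laplace transform is `t^(-α)`. -/
def dens (α y : ℝ) : ℝ := y ^ (α - 1) / Real.Gamma α

/-- Weight function of the second difference in the interpolation formulas. -/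
def ker₂ (σ : ℝ) : ℝ := 1 / 2 - σ

/-- Weight function of the third difference in the interpolation formulas. -/
def ker₃ (σ : ℝ) : ℝ := (3 * σ ^ 2 - 6 * σ + 2) / 6

/-- The constant weight function of the first difference. -/
def ker₁ (_ : ℝ) : ℝ := 1

lemma continuous_ker₁ : Continuous ker₁ := continuous_const
lemma continuous_ker₂ : Continuous ker₂ := by unfold ker₂; fun_prop
lemma continuous_ker₃ : Continuous ker₃ := by unfold ker₃; fun_prop

/-- Chebyshev's argument: since $k$ has mean zero, the constant $e^{-\sigma_0y}$ can be subtracted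
from the exponential. Both factors are then decreasing and change sign at $\sigma_0$, so their
product is nonnegative. -/
lemma lap_nonneg_of_antitone {k : ℝ → ℝ} (hk : Continuous k) (hanti : AntitoneOn k (Icc 0 1))
    (hint : ∫ σ in (0 : ℝ)..1, k σ = 0) {σ₀ : ℝ} (h₀ : σ₀ ∈ Icc (0 : ℝ) 1) (hz : k σ₀ = 0)
    {y : ℝ} (hy : 0 ≤ y) : 0 ≤ lap k y := by
  have h1 : lap k y = ∫ σ in (0 : ℝ)..1,
      (Real.exp (-(σ * y)) - Real.exp (-(σ₀ * y))) * k σ := by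
    have : ∫ σ in (0 : ℝ)..1, Real.exp (-(σ₀ * y)) * k σ = 0 := by
      rw [intervalIntegral.integral_const_mul, hint, mul_zero]
    unfold lap
    simp_rw [sub_mul]
    rw [intervalIntegral.integral_sub, this, sub_zero]
    · exact (by fun_prop : Continuous _).intervalIntegrable _ _
    · exact (by fun_prop : Continuous _).intervalIntegrable _ _
  rw [h1]
  apply intervalIntegral.integral_nonneg zero_le_one
  intro σ hσ
  rcases le_total σ σ₀ with h | h
  · apply mul_nonneg
    · rw [sub_nonneg]; apply Real.exp_le_exp.2; nlinarith
    · rw [← hz]; exact hanti hσ h₀ h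
  · apply mul_nonneg_of_nonpos_of_nonpos
    · rw [sub_nonpos]; apply Real.exp_le_exp.2; nlinarith
    · rw [← hz]; exact hanti h₀ hσ h

/-- `ker₃` is decreasing on $[0,1]$ with mean zero, and its zero there is $1-1/\sqrt3$. -/
lemma lap_ker₃_nonneg {y : ℝ} (hy : 0 ≤ y) : 0 ≤ lap ker₃ y := by
  have h3 : Real.sqrt 3 ^ 2 = 3 := Real.sq_sqrt (by norm_num)
  have h3p : 1 ≤ Real.sqrt 3 := by
    rw [Real.one_le_sqrt]; norm_num
  have hinv : Real.sqrt 3 / 3 ≤ 1 := by nlinarith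
  refine lap_nonneg_of_antitone continuous_ker₃ ?_ ?_ (σ₀ := 1 - Real.sqrt 3 / 3)
    ⟨by linarith, by linarith⟩ ?_ hy
  · intro a ha b hb hab
    unfold ker₃
    nlinarith [mul_nonneg (sub_nonneg.2 hab) (by linarith [ha.2, hb.2] : 0 ≤ 2 - a - b)]
  · unfold ker₃
    rw [intervalIntegral.integral_div, intervalIntegral.integral_add, intervalIntegral.integral_sub,
      intervalIntegral.integral_const_mul, intervalIntegral.integral_const_mul, integral_pow,
      integral_id]
    · norm_num
    all_goals exact (by fun_prop : Continuous _).intervalIntegrable _ _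
  · unfold ker₃; nlinarith

/-- The difference of the kernels is $1/6-\sigma^2/2$, which is again decreasing with mean zero and
vanishes at $1/\sqrt3$. This comparison lets the second difference absorb the third one in
`imFactor_ge`. -/
lemma lap_ker₃_le_lap_ker₂ {y : ℝ} (hy : 0 ≤ y) : lap ker₃ y ≤ lap ker₂ y := by
  have h3 : Real.sqrt 3 ^ 2 = 3 := Real.sq_sqrt (by norm_num)
  have h3p : 1 ≤ Real.sqrt 3 := by
    rw [Real.one_le_sqrt]; norm_num
  have hinv : Real.sqrt 3 / 3 ≤ 1 := by nlinarith
  have key : 0 ≤ lap (fun σ => ker₂ σ - ker₃ σ) y := by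
    refine lap_nonneg_of_antitone (k := fun σ => ker₂ σ - ker₃ σ)
      (continuous_ker₂.sub continuous_ker₃) ?_ ?_
      (σ₀ := Real.sqrt 3 / 3) ⟨by positivity, by linarith⟩ ?_ hy
    · intro a ha b hb hab
      unfold ker₃ ker₂
      nlinarith [mul_nonneg (sub_nonneg.2 hab) (by linarith [ha.1, hb.1] : 0 ≤ a + b)]
    · have : ∀ σ, ker₂ σ - ker₃ σ = 1 / 6 - σ ^ 2 / 2 := by
        intro σ; unfold ker₂ ker₃; ring
      simp_rw [this]
      rw [intervalIntegral.integral_sub, intervalIntegral.integral_div, intervalIntegral.integral_div,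
        integral_pow, intervalIntegral.integral_const]
      · norm_num
      all_goals exact (by fun_prop : Continuous _).intervalIntegrable _ _
    · unfold ker₃ ker₂; nlinarith
  have : lap (fun σ => ker₂ σ - ker₃ σ) y = lap ker₂ y - lap ker₃ y := by
    unfold lap
    rw [← intervalIntegral.integral_sub]
    · simp_rw [mul_sub]
    · exact (by have := continuous_ker₂; fun_prop : Continuous _).intervalIntegrable _ _
    · exact (by have := continuous_ker₃; fun_prop : Continuous _).intervalIntegrable _ _
  linarith

lemma lap_ker₁ {y : ℝ} (hy : 0 < y) : lap ker₁ y = (1 - Real.exp (-y)) / y := by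
  have h : ∀ σ ∈ uIcc (0 : ℝ) 1, HasDerivAt (fun σ => -Real.exp (-(σ * y)) / y)
      (Real.exp (-(σ * y)) * ker₁ σ) σ := by
    intro σ _
    have h1 : HasDerivAt (fun σ : ℝ => -(σ * y)) (-(1 * y)) σ :=
      ((hasDerivAt_id σ).mul_const y).neg
    refine (h1.exp.neg.div_const y).congr_deriv ?_
    unfold ker₁; field_simp
  unfold lap
  rw [intervalIntegral.integral_eq_sub_of_hasDerivAt h]
  · simp; ring
  · exact (by have := continuous_ker₁; fun_prop : Continuous _).intervalIntegrable _ _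

lemma lap_ker₁_pos {y : ℝ} (hy : 0 < y) : 0 < lap ker₁ y := by
  rw [lap_ker₁ hy]
  have : Real.exp (-y) < 1 := by rw [Real.exp_lt_one_iff]; linarith
  apply div_pos <;> linarith

lemma dens_pos {α y : ℝ} (hα : 0 < α) (hy : 0 < y) : 0 < dens α y :=
  div_pos (Real.rpow_pos_of_pos hy _) (Real.Gamma_pos_of_pos hα)

lemma integral_dens_mul_exp {α x : ℝ} (hα : 0 < α) (hx : 0 < x) :
    ∫ y in Ioi (0 : ℝ), dens α y * Real.exp (-(x * y)) = x ^ (-α) := by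
  have h := Real.integral_rpow_mul_exp_neg_mul_Ioi hα hx
  have hG := (Real.Gamma_pos_of_pos hα).ne'
  simp_rw [dens, div_mul_eq_mul_div]
  rw [integral_div, h, one_div, Real.inv_rpow hx.le, ← Real.rpow_neg hx.le]
  field_simp

/-- The integral of a non-integrable function is zero by convention, whereas the value $x^{-\alpha}$
is positive. -/
lemma integrableOn_dens_mul_exp {α x : ℝ} (hα : 0 < α) (hx : 0 < x) :
    IntegrableOn (fun y => dens α y * Real.exp (-(x * y))) (Ioi (0 : ℝ)) := by
  by_contra h
  have h1 := integral_dens_mul_exp hα hx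
  rw [integral_undef h] at h1
  exact absurd h1.symm (Real.rpow_pos_of_pos hx _).ne'

lemma measurable_dens (α : ℝ) : Measurable (dens α) := by unfold dens; fun_prop

/-- Integrability on `(0,1] × (0,∞)` behind the Laplace representation of the moments. -/
lemma integrable_dens_prod {α : ℝ} (hα₀ : 0 < α) (hα₁ : α < 1) {k : ℝ → ℝ} (hk : Continuous k)
    (m : ℕ) :
    Integrable (fun p : ℝ × ℝ => dens α p.2 * Real.exp (-(((m : ℝ) + p.1) * p.2)) * k p.1)
      ((volume.restrict (Ioc (0 : ℝ) 1)).prod (volume.restrict (Ioi (0 : ℝ)))) := by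
  have hmeas : Measurable
      (fun p : ℝ × ℝ => dens α p.2 * Real.exp (-(((m : ℝ) + p.1) * p.2)) * k p.1) := by
    have := measurable_dens α
    have := hk.measurable
    fun_prop
  rw [integrable_prod_iff hmeas.aestronglyMeasurable]
  have hpos : ∀ᵐ σ ∂(volume.restrict (Ioc (0 : ℝ) 1)), σ ∈ Ioc (0 : ℝ) 1 :=
    ae_restrict_mem measurableSet_Ioc
  constructor
  · filter_upwards [hpos] with σ hσ
    exact (integrableOn_dens_mul_exp hα₀ (by have := hσ.1; positivity)).mul_const _
  · have h2 : IntervalIntegrable (fun σ : ℝ => σ ^ (-α) * |k σ|) volume 0 1 := by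
      apply IntervalIntegrable.mul_continuousOn
      · exact intervalIntegral.intervalIntegrable_rpow' (by linarith)
      · exact hk.abs.continuousOn
    rw [intervalIntegrable_iff_integrableOn_Ioc_of_le zero_le_one] at h2
    refine Integrable.mono' h2 ?_ ?_
    · exact (hmeas.norm.stronglyMeasurable.integral_prod_right').aestronglyMeasurable
    · filter_upwards [hpos] with σ hσ
      have hs : 0 < (m : ℝ) + σ := by have := hσ.1; positivity
      have h3 : ∫ y in Ioi (0 : ℝ), ‖dens α y * Real.exp (-(((m : ℝ) + σ) * y)) * k σ‖
          = ((m : ℝ) + σ) ^ (-α) * |k σ| := by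
        rw [← integral_dens_mul_exp hα₀ hs, ← integral_mul_const]
        apply setIntegral_congr_fun measurableSet_Ioi
        intro y hy
        simp only [norm_mul, Real.norm_eq_abs, abs_of_pos (dens_pos hα₀ hy), Real.abs_exp]
      rw [h3, Real.norm_of_nonneg (by positivity)]
      refine mul_le_mul_of_nonneg_right ?_ (abs_nonneg _)
      refine Real.rpow_le_rpow_of_nonpos hσ.1 ?_ (by linarith)
      simp

lemma integral_exp_mul_ker (k : ℝ → ℝ) (α : ℝ) (m : ℕ) (y : ℝ) :
    ∫ σ in Ioc (0 : ℝ) 1, dens α y * Real.exp (-(((m : ℝ) + σ) * y)) * k σ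
      = dens α y * lap k y * Real.exp (-y) ^ m := by
  unfold lap
  rw [intervalIntegral.integral_of_le zero_le_one, ← integral_const_mul, ← integral_mul_const]
  congr 1
  funext σ
  rw [← Real.exp_nat_mul, show -(((m : ℝ) + σ) * y) = -(σ * y) + m * -y by ring, Real.exp_add]
  ring

/-- Laplace representation of the moments. -/
lemma mom_eq_integral {α : ℝ} (hα₀ : 0 < α) (hα₁ : α < 1) {k : ℝ → ℝ} (hk : Continuous k)
    (m : ℕ) : mom α k m = ∫ y in Ioi (0 : ℝ), dens α y * lap k y * Real.exp (-y) ^ m := by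
  have hsw := integral_integral_swap (f := fun σ y =>
    dens α y * Real.exp (-(((m : ℝ) + σ) * y)) * k σ) (integrable_dens_prod hα₀ hα₁ hk m)
  simp_rw [integral_exp_mul_ker] at hsw
  rw [← hsw]
  unfold mom
  rw [intervalIntegral.integral_of_le zero_le_one]
  apply setIntegral_congr_fun measurableSet_Ioc
  intro σ hσ
  have hs : 0 < (m : ℝ) + σ := by have := hσ.1; positivity
  simp only
  rw [integral_mul_const, integral_dens_mul_exp hα₀ hs]

lemma integrableOn_dens_mul_lap {α : ℝ} (hα₀ : 0 < α) (hα₁ : α < 1) {k : ℝ → ℝ}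
    (hk : Continuous k) : IntegrableOn (fun y => dens α y * lap k y) (Ioi (0 : ℝ)) := by
  have h := (integrable_dens_prod hα₀ hα₁ hk 0).integral_prod_right
  simp_rw [integral_exp_mul_ker, pow_zero, mul_one] at h
  exact h

/-! ### Generating functions of moments on the closed unit disc. -/

/-- The generating function of the moments `∫ w(y) e^(-my) dy`. -/
def genFun (w : ℝ → ℝ) (z : ℂ) : ℂ :=
  ∫ y in Ioi (0 : ℝ), (w y : ℂ) / (1 - (Real.exp (-y) : ℂ) * z)

lemma exp_neg_lt_one {y : ℝ} (hy : y ∈ Ioi (0 : ℝ)) : Real.exp (-y) < 1 := by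
  rw [Real.exp_lt_one_iff]; exact neg_lt_zero.2 hy

lemma one_sub_le_norm {q : ℝ} (hq : 0 ≤ q) {z : ℂ} (hz : ‖z‖ ≤ 1) : 1 - q ≤ ‖1 - (q : ℂ) * z‖ := by
  have h := norm_sub_norm_le (1 : ℂ) ((q : ℂ) * z)
  rw [norm_mul, norm_one, Complex.norm_real, Real.norm_of_nonneg hq] at h
  nlinarith

lemma one_sub_norm_le_norm {q : ℝ} (hq : 0 ≤ q) (hq1 : q ≤ 1) (z : ℂ) :
    1 - ‖z‖ ≤ ‖1 - (q : ℂ) * z‖ := by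
  have h := norm_sub_norm_le (1 : ℂ) ((q : ℂ) * z)
  rw [norm_mul, norm_one, Complex.norm_real, Real.norm_of_nonneg hq] at h
  nlinarith [norm_nonneg z]

/-- Write $1-z=(1-qz)-(1-q)z$ and use $1-q\le|1-qz|$. The bound is uniform in $q$ and holds up to
the unit circle, so it serves as the dominating estimate for all resolvent integrals. -/
lemma norm_one_sub_le {q : ℝ} (hq : 0 ≤ q) (hq1 : q ≤ 1) {z : ℂ} (hz : ‖z‖ ≤ 1) :
    ‖1 - z‖ ≤ 2 * ‖1 - (q : ℂ) * z‖ := by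
  have h1 := one_sub_le_norm hq hz
  have h2 : ‖1 - z‖ ≤ ‖1 - (q : ℂ) * z‖ + ‖((1 - q : ℝ) : ℂ) * z‖ := by
    rw [show (1 : ℂ) - z = (1 - (q : ℂ) * z) - ((1 - q : ℝ) : ℂ) * z by push_cast; ring]
    exact norm_sub_le _ _
  rw [norm_mul, Complex.norm_real, Real.norm_of_nonneg (by linarith)] at h2
  nlinarith [norm_nonneg z]

lemma aestronglyMeasurable_resolvent {w : ℝ → ℝ} (hw : IntegrableOn w (Ioi 0)) (z : ℂ) :
    AEStronglyMeasurable (fun y : ℝ => (w y : ℂ) / (1 - (Real.exp (-y) : ℂ) * z))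
      (volume.restrict (Ioi (0 : ℝ))) := by
  have h1 : AEStronglyMeasurable (fun y : ℝ => (w y : ℂ)) (volume.restrict (Ioi (0 : ℝ))) :=
    Complex.continuous_ofReal.comp_aestronglyMeasurable hw.aestronglyMeasurable
  have h2 : Measurable (fun y : ℝ => (1 - (Real.exp (-y) : ℂ) * z)⁻¹) := by fun_prop
  simp_rw [div_eq_mul_inv]
  exact h1.mul h2.aestronglyMeasurable

lemma integrableOn_resolvent {w : ℝ → ℝ} (hw : IntegrableOn w (Ioi 0)) {z : ℂ} (hz : ‖z‖ ≤ 1)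
    (hz1 : z ≠ 1) :
    IntegrableOn (fun y : ℝ => (w y : ℂ) / (1 - (Real.exp (-y) : ℂ) * z)) (Ioi (0 : ℝ)) := by
  have hd : 0 < ‖1 - z‖ := norm_pos_iff.2 (sub_ne_zero.2 hz1.symm)
  refine Integrable.mono' (hw.norm.mul_const (2 / ‖1 - z‖))
    (aestronglyMeasurable_resolvent hw z) ?_
  filter_upwards [ae_restrict_mem measurableSet_Ioi] with y hy
  have h := norm_one_sub_le (Real.exp_pos (-y)).le (exp_neg_lt_one hy).le hz
  rw [norm_div, Complex.norm_real, div_eq_mul_inv]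
  refine mul_le_mul_of_nonneg_left ?_ (norm_nonneg _)
  rw [inv_le_comm₀ (by linarith) (by positivity), inv_div]
  linarith

lemma hasSum_genFun {w : ℝ → ℝ} (hw : IntegrableOn w (Ioi 0)) {z : ℂ} (hz : ‖z‖ < 1) :
    HasSum (fun m : ℕ => ((∫ y in Ioi (0 : ℝ), w y * Real.exp (-y) ^ m : ℝ) : ℂ) * z ^ m)
      (genFun w z) := by
  have hint : ∀ m : ℕ, IntegrableOn (fun y : ℝ => w y * Real.exp (-y) ^ m) (Ioi 0) := by
    intro m
    refine Integrable.mono hw (hw.aestronglyMeasurable.mul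
      (by fun_prop : Continuous fun y : ℝ => Real.exp (-y) ^ m).aestronglyMeasurable) ?_
    filter_upwards [ae_restrict_mem measurableSet_Ioi] with y hy
    rw [norm_mul, norm_pow, Real.norm_of_nonneg (Real.exp_pos _).le]
    exact mul_le_of_le_one_right (norm_nonneg _)
      (pow_le_one₀ (Real.exp_pos _).le (exp_neg_lt_one hy).le)
  have hF : ∀ m : ℕ, IntegrableOn
      (fun y : ℝ => ((w y * Real.exp (-y) ^ m : ℝ) : ℂ) * z ^ m) (Ioi 0) :=
    fun m => (hint m).ofReal.mul_const _
  have hb : ∀ m : ℕ, ∫ y in Ioi (0 : ℝ), ‖((w y * Real.exp (-y) ^ m : ℝ) : ℂ) * z ^ m‖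
      ≤ (∫ y in Ioi (0 : ℝ), ‖w y‖) * ‖z‖ ^ m := by
    intro m
    rw [← integral_mul_const]
    refine setIntegral_mono_on (hF m).norm (hw.norm.mul_const _) measurableSet_Ioi ?_
    intro y hy
    rw [norm_mul, norm_pow, Complex.norm_real, norm_mul, norm_pow,
      Real.norm_of_nonneg (Real.exp_pos (-y)).le]
    refine mul_le_mul_of_nonneg_right ?_ (by positivity)
    exact mul_le_of_le_one_right (norm_nonneg _)
      (pow_le_one₀ (Real.exp_pos _).le (exp_neg_lt_one hy).le)
  have hs : Summable fun m : ℕ =>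
      ∫ y in Ioi (0 : ℝ), ‖((w y * Real.exp (-y) ^ m : ℝ) : ℂ) * z ^ m‖ :=
    Summable.of_nonneg_of_le (fun m => integral_nonneg fun _ => norm_nonneg _) hb
      ((summable_geometric_of_lt_one (norm_nonneg z) hz).mul_left _)
  have h := hasSum_integral_of_summable_integral_norm hF hs
  simp_rw [integral_mul_const, integral_complex_ofReal] at h
  have hg : genFun w z
      = ∫ y in Ioi (0 : ℝ), ∑' m : ℕ, ((w y * Real.exp (-y) ^ m : ℝ) : ℂ) * z ^ m := by
    unfold genFun
    apply setIntegral_congr_fun measurableSet_Ioi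
    intro y hy
    have hq : ‖(Real.exp (-y) : ℂ) * z‖ < 1 := by
      rw [norm_mul, Complex.norm_real, Real.norm_of_nonneg (Real.exp_pos _).le]
      nlinarith [exp_neg_lt_one hy, Real.exp_pos (-y), norm_nonneg z]
    have := (hasSum_geometric_of_norm_lt_one hq).mul_left (w y : ℂ)
    rw [← div_eq_mul_inv] at this
    simp only
    rw [← this.tsum_eq]
    congr 1
    funext m
    push_cast
    ring
  rw [hg]
  exact h

lemma continuousOn_genFun {w : ℝ → ℝ} (hw : IntegrableOn w (Ioi 0)) {ε : ℝ} (hε : 0 < ε) :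
    ContinuousOn (genFun w) {z : ℂ | ‖z‖ ≤ 1 ∧ ε ≤ ‖1 - z‖} := by
  refine continuousOn_of_dominated (bound := fun y => ‖w y‖ * (2 / ε)) ?_ ?_ ?_ ?_
  · intro z _; exact aestronglyMeasurable_resolvent hw z
  · intro z hz
    filter_upwards [ae_restrict_mem measurableSet_Ioi] with y hy
    have h := norm_one_sub_le (Real.exp_pos (-y)).le (exp_neg_lt_one hy).le hz.1
    have hz2 := hz.2
    rw [norm_div, Complex.norm_real, div_eq_mul_inv]
    refine mul_le_mul_of_nonneg_left ?_ (norm_nonneg _)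
    rw [inv_le_comm₀ (by linarith) (by positivity), inv_div]
    linarith
  · exact hw.norm.mul_const _
  · filter_upwards [ae_restrict_mem measurableSet_Ioi] with y hy
    intro z hz
    have h := norm_one_sub_le (Real.exp_pos (-y)).le (exp_neg_lt_one hy).le hz.1
    have hz2 := hz.2
    have hne : 1 - (Real.exp (-y) : ℂ) * z ≠ 0 := norm_pos_iff.1 (by linarith)
    apply ContinuousAt.continuousWithinAt
    exact ContinuousAt.div (by fun_prop) (by fun_prop) hne

lemma hasDerivAt_genFun {w : ℝ → ℝ} (hw : IntegrableOn w (Ioi 0)) {z : ℂ} (hz : ‖z‖ < 1) :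
    IntegrableOn (fun y : ℝ => (w y : ℂ) * Real.exp (-y) / (1 - (Real.exp (-y) : ℂ) * z) ^ 2)
      (Ioi (0 : ℝ)) ∧
    HasDerivAt (genFun w) (∫ y in Ioi (0 : ℝ),
      (w y : ℂ) * Real.exp (-y) / (1 - (Real.exp (-y) : ℂ) * z) ^ 2) z := by
  have hr : 0 < (1 - ‖z‖) / 2 := by linarith
  have hball : ∀ x ∈ Metric.ball z ((1 - ‖z‖) / 2), ‖x‖ ≤ 1 - (1 - ‖z‖) / 2 := by
    intro x hx
    rw [mem_ball_iff_norm] at hx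
    have := norm_le_norm_add_norm_sub' x z
    linarith
  refine hasDerivAt_integral_of_dominated_loc_of_deriv_le
    (F := fun (x : ℂ) (y : ℝ) => (w y : ℂ) / (1 - (Real.exp (-y) : ℂ) * x))
    (F' := fun (x : ℂ) (y : ℝ) => (w y : ℂ) * Real.exp (-y) / (1 - (Real.exp (-y) : ℂ) * x) ^ 2)
    (bound := fun y => ‖w y‖ * (1 / ((1 - ‖z‖) / 2) ^ 2))
    (Metric.ball_mem_nhds z hr) ?_ ?_ ?_ ?_ ?_ ?_
  · exact Filter.Eventually.of_forall fun x => aestronglyMeasurable_resolvent hw x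
  · exact integrableOn_resolvent hw hz.le (by rintro rfl; simp at hz)
  · have h1 : AEStronglyMeasurable (fun y : ℝ => (w y : ℂ)) (volume.restrict (Ioi (0 : ℝ))) :=
      Complex.continuous_ofReal.comp_aestronglyMeasurable hw.aestronglyMeasurable
    have h2 : Measurable
        (fun y : ℝ => (Real.exp (-y) : ℂ) / (1 - (Real.exp (-y) : ℂ) * z) ^ 2) := by fun_prop
    simp_rw [mul_div_assoc]
    exact h1.mul h2.aestronglyMeasurable
  · filter_upwards [ae_restrict_mem measurableSet_Ioi] with y hy
    intro x hx
    have h := one_sub_norm_le_norm (Real.exp_pos (-y)).le (exp_neg_lt_one hy).le x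
    have hx' := hball x hx
    rw [norm_div, norm_mul, norm_pow, Complex.norm_real, Complex.norm_real, mul_div_assoc,
      Real.norm_of_nonneg (Real.exp_pos (-y)).le]
    refine mul_le_mul_of_nonneg_left ?_ (norm_nonneg _)
    have := exp_neg_lt_one hy
    gcongr
    linarith
  · exact hw.norm.mul_const _
  · filter_upwards [ae_restrict_mem measurableSet_Ioi] with y hy
    intro x hx
    have h := one_sub_norm_le_norm (Real.exp_pos (-y)).le (exp_neg_lt_one hy).le x
    have hx' := hball x hx
    have hne : 1 - (Real.exp (-y) : ℂ) * x ≠ 0 := norm_pos_iff.1 (by linarith)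
    have h1 : HasDerivAt (fun x : ℂ => 1 - (Real.exp (-y) : ℂ) * x) (-(Real.exp (-y) : ℂ)) x := by
      simpa using ((hasDerivAt_id x).const_mul (Real.exp (-y) : ℂ)).const_sub 1
    refine ((hasDerivAt_const x (w y : ℂ)).div h1 hne).congr_deriv ?_
    ring

/-! ### The symbol and its sector condition. -/

/-- The densities representing the generating functions of the moments of `k`. -/
def wgt (α : ℝ) (k : ℝ → ℝ) (y : ℝ) : ℝ := dens α y * lap k y

/-- The symbol of the translation invariant part of the discrete Caputo derivative. -/
def symb (α : ℝ) (z : ℂ) : ℂ :=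
  (1 - z) * genFun (wgt α ker₁) z + (1 - z) ^ 2 * genFun (wgt α ker₂) z
    + (1 - z) ^ 3 * genFun (wgt α ker₃) z

lemma integrableOn_wgt₁ {α : ℝ} (hα₀ : 0 < α) (hα₁ : α < 1) :
    IntegrableOn (wgt α ker₁) (Ioi 0) := integrableOn_dens_mul_lap hα₀ hα₁ continuous_ker₁

lemma integrableOn_wgt₂ {α : ℝ} (hα₀ : 0 < α) (hα₁ : α < 1) :
    IntegrableOn (wgt α ker₂) (Ioi 0) := integrableOn_dens_mul_lap hα₀ hα₁ continuous_ker₂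

lemma integrableOn_wgt₃ {α : ℝ} (hα₀ : 0 < α) (hα₁ : α < 1) :
    IntegrableOn (wgt α ker₃) (Ioi 0) := integrableOn_dens_mul_lap hα₀ hα₁ continuous_ker₃

lemma wgt₁_pos {α y : ℝ} (hα₀ : 0 < α) (hy : 0 < y) : 0 < wgt α ker₁ y :=
  mul_pos (dens_pos hα₀ hy) (lap_ker₁_pos hy)

lemma wgt₃_nonneg {α y : ℝ} (hα₀ : 0 < α) (hy : 0 < y) : 0 ≤ wgt α ker₃ y :=
  mul_nonneg (dens_pos hα₀ hy).le (lap_ker₃_nonneg hy.le)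

lemma wgt₃_le_wgt₂ {α y : ℝ} (hα₀ : 0 < α) (hy : 0 < y) : wgt α ker₃ y ≤ wgt α ker₂ y :=
  mul_le_mul_of_nonneg_left (lap_ker₃_le_lap_ker₂ hy.le) (dens_pos hα₀ hy).le

/-- The integrand in the integral representation of the symbol. -/
def symbIntegrand (α : ℝ) (z : ℂ) (y : ℝ) : ℂ :=
  ((1 - z) * wgt α ker₁ y + (1 - z) ^ 2 * wgt α ker₂ y + (1 - z) ^ 3 * wgt α ker₃ y)
    / (1 - (Real.exp (-y) : ℂ) * z)

lemma integrableOn_symbIntegrand {α : ℝ} (hα₀ : 0 < α) (hα₁ : α < 1) {z : ℂ} (hz : ‖z‖ ≤ 1)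
    (hz1 : z ≠ 1) : IntegrableOn (symbIntegrand α z) (Ioi 0) ∧
      symb α z = ∫ y in Ioi (0 : ℝ), symbIntegrand α z y := by
  have h1 := (integrableOn_resolvent (integrableOn_wgt₁ hα₀ hα₁) hz hz1).const_mul (1 - z)
  have h2 := (integrableOn_resolvent (integrableOn_wgt₂ hα₀ hα₁) hz hz1).const_mul ((1 - z) ^ 2)
  have h3 := (integrableOn_resolvent (integrableOn_wgt₃ hα₀ hα₁) hz hz1).const_mul ((1 - z) ^ 3)
  have he : symbIntegrand α z = fun y => (1 - z) * (wgt α ker₁ y / (1 - (Real.exp (-y) : ℂ) * z))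
      + (1 - z) ^ 2 * (wgt α ker₂ y / (1 - (Real.exp (-y) : ℂ) * z))
      + (1 - z) ^ 3 * (wgt α ker₃ y / (1 - (Real.exp (-y) : ℂ) * z)) := by
    funext y; unfold symbIntegrand; ring
  rw [he]
  refine ⟨(h1.add h2).add h3, ?_⟩
  unfold symb genFun
  rw [← integral_const_mul, ← integral_const_mul, ← integral_const_mul, ← integral_add h1 h2]
  exact (integral_add (h1.add h2) h3).symm

/-- The quantity controlling the imaginary part of the symbol. -/
def imFactor (q : ℝ) (z : ℂ) (a b c : ℝ) : ℝ :=
  (1 - q) * a + (2 * (1 - z.re) - q * (1 - Complex.normSq z)) * b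
    + (3 - 6 * z.re + 4 * z.re ^ 2 - Complex.normSq z - q + 3 * q * Complex.normSq z
      - 2 * q * Complex.normSq z * z.re) * c

lemma im_symbIntegrand (α : ℝ) (z : ℂ) (y : ℝ) :
    (symbIntegrand α z y).im = -z.im *
      (imFactor (Real.exp (-y)) z (wgt α ker₁ y) (wgt α ker₂ y) (wgt α ker₃ y)
        / Complex.normSq (1 - (Real.exp (-y) : ℂ) * z)) := by
  unfold symbIntegrand imFactor
  generalize wgt α ker₁ y = a
  generalize wgt α ker₂ y = b
  generalize wgt α ker₃ y = c
  generalize Real.exp (-y) = q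
  rw [Complex.div_im, ← sub_div, ← mul_div_assoc]
  congr 1
  rw [Complex.normSq_apply]
  simp only [pow_succ, pow_zero, one_mul, Complex.add_im, Complex.mul_im, Complex.mul_re,
    Complex.add_re, Complex.sub_im, Complex.sub_re, Complex.one_re, Complex.one_im,
    Complex.ofReal_re, Complex.ofReal_im]
  ring

/-- If $\beta,\gamma$ are the coefficients of $b,c$, then $\beta b+\gamma
c=\beta(b-c)+(\beta+\gamma)c$, so it suffices that $\beta\ge0$ and $\beta+\gamma\ge0$. The sum is
affine in $q$, and its values at $q=0$ and $q=1$ (`e0`, `e1`) are nonnegative because $x^2\le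
N\le1$; the latter is at least $(1-x)^2(3-2x)$. -/
lemma imFactor_ge {q : ℝ} (hq : 0 ≤ q) (hq1 : q ≤ 1) {z : ℂ} (hz : ‖z‖ ≤ 1) {a b c : ℝ}
    (hc : 0 ≤ c) (hcb : c ≤ b) : (1 - q) * a ≤ imFactor q z a b c := by
  unfold imFactor
  have hN : Complex.normSq z ≤ 1 := by
    rw [Complex.normSq_eq_norm_sq]; exact pow_le_one₀ (norm_nonneg z) hz
  have hxN : z.re ^ 2 ≤ Complex.normSq z := by
    rw [Complex.normSq_apply]; nlinarith [mul_self_nonneg z.im]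
  generalize Complex.normSq z = N at *
  generalize z.re = x at *
  have hx1 : x ≤ 1 := by nlinarith
  have h2 : 0 ≤ 2 * (1 - x) - q * (1 - N) := by
    nlinarith [mul_le_mul_of_nonneg_right hq1 (sub_nonneg.2 hN), sq_nonneg (1 - x)]
  have hx : 0 ≤ (1 - x) ^ 2 * (3 - 2 * x) := mul_nonneg (sq_nonneg _) (by linarith)
  have e1 : 0 ≤ 3 - 8 * x + 4 * x ^ 2 + 3 * N - 2 * N * x := by
    nlinarith [mul_nonneg (sub_nonneg.2 hxN) (by linarith : 0 ≤ 3 - 2 * x)]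
  have e0 : 0 ≤ 5 - 8 * x + 4 * x ^ 2 - N := by nlinarith [sq_nonneg (1 - x)]
  have h23 : 0 ≤ (2 * (1 - x) - q * (1 - N)) + (3 - 6 * x + 4 * x ^ 2 - N - q + 3 * q * N
      - 2 * q * N * x) := by
    nlinarith [mul_nonneg hq e1, mul_nonneg (sub_nonneg.2 hq1) e0]
  nlinarith [mul_nonneg h23 hc, mul_nonneg h2 (sub_nonneg.2 hcb)]

lemma one_sub_exp_mul_ne_zero {y : ℝ} (hy : y ∈ Ioi (0 : ℝ)) {z : ℂ} (hz : ‖z‖ ≤ 1) :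
    1 - (Real.exp (-y) : ℂ) * z ≠ 0 := by
  have h := one_sub_le_norm (Real.exp_pos (-y)).le hz
  exact norm_pos_iff.1 (by linarith [exp_neg_lt_one hy])

lemma setIntegral_Ioi_pos {f : ℝ → ℝ} (hf : IntegrableOn f (Ioi 0))
    (hpos : ∀ y ∈ Ioi (0 : ℝ), 0 < f y) : 0 < ∫ y in Ioi (0 : ℝ), f y := by
  rw [setIntegral_pos_iff_support_of_nonneg_ae _ hf]
  · have : Function.support f ∩ Ioi 0 = Ioi 0 :=
      inter_eq_right.2 fun y hy => (hpos y hy).ne'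
    rw [this]; simp
  · filter_upwards [ae_restrict_mem measurableSet_Ioi] with y hy
    exact (hpos y hy).le

/-- The symbol avoids the closed negative real axis on the closed unit disc without `1`. -/
lemma norm_symb_add_re_pos {α : ℝ} (hα₀ : 0 < α) (hα₁ : α < 1) {z : ℂ} (hz : ‖z‖ ≤ 1)
    (hz1 : z ≠ 1) : 0 < ‖symb α z‖ + (symb α z).re := by
  obtain ⟨hint, heq⟩ := integrableOn_symbIntegrand hα₀ hα₁ hz hz1
  -- The quantity $|s|+\operatorname{Re}s$ vanishes only for $s\in(-\infty,0]$. For real $z$ the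
  -- symbol is positive; for non-real $z$ its imaginary part is nonzero.
  by_cases hs : z.im = 0
  · have hzx : z = (z.re : ℂ) := Complex.ext rfl (by simp [hs])
    have hx : z.re < 1 := by
      refine lt_of_le_of_ne ((Complex.re_le_norm z).trans hz) fun h => hz1 ?_
      rw [hzx, h]; simp
    have hre : (symb α z).re = ∫ y in Ioi (0 : ℝ), (symbIntegrand α z y).re := by
      rw [heq]; exact (integral_re hint).symm
    have hpos : 0 < (symb α z).re := by
      rw [hre]
      apply setIntegral_Ioi_pos hint.re
      intro y hy
      have h3 := wgt₃_nonneg hα₀ hy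
      have h2 := h3.trans (wgt₃_le_wgt₂ hα₀ hy)
      have h1 := wgt₁_pos hα₀ hy
      have hq := exp_neg_lt_one hy
      have hq0 := Real.exp_pos (-y)
      have : symbIntegrand α z y = ((((1 - z.re) * wgt α ker₁ y + (1 - z.re) ^ 2 * wgt α ker₂ y
          + (1 - z.re) ^ 3 * wgt α ker₃ y) / (1 - Real.exp (-y) * z.re) : ℝ) : ℂ) := by
        unfold symbIntegrand
        rw [hzx]
        push_cast
        rfl
      rw [this, RCLike.re_to_complex, Complex.ofReal_re]
      have hx' : 0 < 1 - z.re := by linarith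
      apply div_pos
      · have := mul_pos hx' h1
        positivity
      · nlinarith
    have := norm_nonneg (symb α z)
    linarith
  · have him : (symb α z).im = -z.im * ∫ y in Ioi (0 : ℝ),
        (imFactor (Real.exp (-y)) z (wgt α ker₁ y) (wgt α ker₂ y) (wgt α ker₃ y)
        / Complex.normSq (1 - (Real.exp (-y) : ℂ) * z)) := by
      rw [heq, ← integral_const_mul]
      simp_rw [← im_symbIntegrand]
      exact (integral_im hint).symm
    have hpos : 0 < ∫ y in Ioi (0 : ℝ),
        (imFactor (Real.exp (-y)) z (wgt α ker₁ y) (wgt α ker₂ y) (wgt α ker₃ y)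
        / Complex.normSq (1 - (Real.exp (-y) : ℂ) * z)) := by
      apply setIntegral_Ioi_pos
      · have h := (Integrable.im hint).const_mul (-z.im)⁻¹
        refine h.congr (Filter.Eventually.of_forall fun y => ?_)
        simp only [RCLike.im_to_complex]
        rw [im_symbIntegrand, inv_mul_cancel_left₀ (neg_ne_zero.2 hs)]
      · intro y hy
        have hge := imFactor_ge (Real.exp_pos (-y)).le (exp_neg_lt_one hy).le hz
          (a := wgt α ker₁ y) (wgt₃_nonneg hα₀ hy) (wgt₃_le_wgt₂ hα₀ hy)
        have := mul_pos (sub_pos.2 (exp_neg_lt_one hy)) (wgt₁_pos hα₀ hy)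
        exact div_pos (by linarith) (Complex.normSq_pos.2 (one_sub_exp_mul_ne_zero hy hz))
    have hne : (symb α z).im ≠ 0 := by
      rw [him]; exact mul_ne_zero (neg_ne_zero.2 hs) hpos.ne'
    have := Complex.abs_re_lt_norm.2 hne
    have := neg_abs_le (symb α z).re
    linarith

lemma norm_one_sub_mul_genFun_le {w : ℝ → ℝ} (hw : IntegrableOn w (Ioi 0)) {z : ℂ} (hz : ‖z‖ ≤ 1)
    : ‖(1 - z) * genFun w z‖ ≤ 2 * ∫ y in Ioi (0 : ℝ), |w y| := by
  unfold genFun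
  rw [← integral_const_mul, ← integral_const_mul]
  refine norm_integral_le_of_norm_le (hw.norm.const_mul 2) ?_
  filter_upwards [ae_restrict_mem measurableSet_Ioi] with y hy
  have h := norm_one_sub_le (Real.exp_pos (-y)).le (exp_neg_lt_one hy).le hz
  have h0 := norm_pos_iff.2 (one_sub_exp_mul_ne_zero hy hz)
  rw [norm_mul, norm_div, Complex.norm_real, mul_div_left_comm, mul_comm, Real.norm_eq_abs]
  refine mul_le_mul_of_nonneg_right ?_ (abs_nonneg _)
  rw [div_le_iff₀ h0]; exact h

lemma re_one_sub_div (q : ℝ) (z : ℂ) (w : ℝ) :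
    ((1 - z) * ((w : ℂ) / (1 - (q : ℂ) * z))).re
      = w * (((1 - q) * (1 - z.re) + q * ‖1 - z‖ ^ 2) / ‖1 - (q : ℂ) * z‖ ^ 2) := by
  rw [← Complex.normSq_eq_norm_sq, ← Complex.normSq_eq_norm_sq, ← mul_div_assoc, Complex.div_re,
    ← add_div, ← mul_div_assoc]
  congr 1
  rw [Complex.normSq_apply]
  simp only [Complex.mul_im, Complex.mul_re, Complex.sub_im, Complex.sub_re, Complex.one_re, Complex.one_im,
    Complex.ofReal_re, Complex.ofReal_im]
  ring

/-- Behaviour at `1` of the real part of the leading term of the symbol. -/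
lemma re_one_sub_mul_genFun_ge {α : ℝ} (hα₀ : 0 < α) (hα₁ : α < 1) {z : ℂ} (hz : ‖z‖ ≤ 1)
    (hz1 : z ≠ 1) (hd : ‖1 - z‖ ≤ 1 / 2) :
    Real.exp (-1) ^ 2 / (18 * Real.Gamma α) * ‖1 - z‖ ^ α
      ≤ ((1 - z) * genFun (wgt α ker₁) z).re := by
  set d := ‖1 - z‖ with hdd
  have hd0 : 0 < d := norm_pos_iff.2 (sub_ne_zero.2 hz1.symm)
  have hG := Real.Gamma_pos_of_pos hα₀
  have hint := (integrableOn_resolvent (integrableOn_wgt₁ hα₀ hα₁) hz hz1).const_mul (1 - z)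
  have hre : ((1 - z) * genFun (wgt α ker₁) z).re = ∫ y in Ioi (0 : ℝ),
      ((1 - z) * ((wgt α ker₁ y : ℂ) / (1 - (Real.exp (-y) : ℂ) * z))).re := by
    unfold genFun
    rw [← integral_const_mul]
    exact (integral_re hint).symm
  have hx : z.re ≤ 1 := (Complex.re_le_norm z).trans hz
  have hnn : ∀ y ∈ Ioi (0 : ℝ),
      0 ≤ ((1 - z) * ((wgt α ker₁ y : ℂ) / (1 - (Real.exp (-y) : ℂ) * z))).re := by
    intro y hy
    rw [re_one_sub_div]
    have := exp_neg_lt_one hy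
    have := Real.exp_pos (-y)
    have := wgt₁_pos hα₀ hy
    have : 0 ≤ (1 - Real.exp (-y)) * (1 - z.re) := mul_nonneg (by linarith) (by linarith)
    positivity
  have hintre : IntegrableOn (fun y : ℝ =>
      ((1 - z) * ((wgt α ker₁ y : ℂ) / (1 - (Real.exp (-y) : ℂ) * z))).re) (Ioi 0) := hint.re
  -- The integrand is nonnegative, so the integral may be restricted to the window $(d,2d]$, where
  -- $|1-e^{-y}z|\le3d$. There the density is at least $d^{\alpha-1}/(2\Gamma(\alpha))$, the
  -- transform at least $e^{-1}$ and the quotient at least $e^{-1}/9$; the window has length $d$.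
  have hsub : Ioc d (2 * d) ⊆ Ioi 0 := fun y hy => hd0.trans hy.1
  have hcst : ∫ y in Ioc d (2 * d), Real.exp (-1) ^ 2 / (18 * Real.Gamma α) * d ^ (α - 1)
      = Real.exp (-1) ^ 2 / (18 * Real.Gamma α) * d ^ α := by
    rw [setIntegral_const, Real.volume_real_Ioc_of_le (by linarith), smul_eq_mul,
      Real.rpow_sub_one hd0.ne']
    field_simp
    ring
  rw [hre, ← hcst]
  refine le_trans ?_ (setIntegral_mono_set hintre ?_ (Filter.Eventually.of_forall hsub))
  · refine setIntegral_mono_on (integrableOn_const (by simp)) (IntegrableOn.mono_set hintre hsub)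
      measurableSet_Ioc ?_
    intro y hy
    have hy0 : 0 < y := hsub hy
    have hy1 : y ≤ 1 := by have := hy.2; linarith
    have hq : Real.exp (-1) ≤ Real.exp (-y) := Real.exp_le_exp.2 (by linarith)
    have hq0 := Real.exp_pos (-y)
    have hq1 := exp_neg_lt_one hy0
    have hqy : 1 - y ≤ Real.exp (-y) := by have := Real.add_one_le_exp (-y); linarith
    have hlap : Real.exp (-1) ≤ lap ker₁ y := by
      rw [lap_ker₁ hy0, le_div_iff₀ hy0]
      have h1 := Real.add_one_le_exp y
      have h2 : Real.exp (-y) * Real.exp y = 1 := by rw [← Real.exp_add]; simp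
      nlinarith
    have hdens : d ^ (α - 1) / (2 * Real.Gamma α) ≤ dens α y := by
      unfold dens
      rw [div_le_div_iff₀ (by positivity) hG]
      have h1 : (2 * d) ^ (α - 1) ≤ y ^ (α - 1) :=
        Real.rpow_le_rpow_of_nonpos hy0 hy.2 (by linarith)
      rw [Real.mul_rpow (by norm_num) hd0.le] at h1
      have h2 : (1 : ℝ) / 2 ≤ 2 ^ (α - 1) := by
        have := Real.rpow_le_rpow_of_exponent_le (by norm_num : (1 : ℝ) ≤ 2)
          (by linarith : -1 ≤ α - 1)
        rw [Real.rpow_neg_one] at this; linarith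
      have h3 : 0 < d ^ (α - 1) := Real.rpow_pos_of_pos hd0 _
      have h4 := mul_le_mul_of_nonneg_right h2 h3.le
      nlinarith
    have hden : ‖1 - (Real.exp (-y) : ℂ) * z‖ ≤ 3 * d := by
      have h2 : ‖1 - (Real.exp (-y) : ℂ) * z‖ ≤ ‖1 - z‖ + ‖((1 - Real.exp (-y) : ℝ) : ℂ) * z‖ := by
        rw [show 1 - (Real.exp (-y) : ℂ) * z = (1 - z) + ((1 - Real.exp (-y) : ℝ) : ℂ) * z by
          push_cast; ring]
        exact norm_add_le _ _
      rw [norm_mul, Complex.norm_real, Real.norm_of_nonneg (by linarith)] at h2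
      have := hy.2
      nlinarith [norm_nonneg z]
    have hden0 := norm_pos_iff.2 (one_sub_exp_mul_ne_zero hy0 hz)
    have hfrac : Real.exp (-1) / 9 ≤ ((1 - Real.exp (-y)) * (1 - z.re) + Real.exp (-y) * ‖1 - z‖ ^ 2)
        / ‖1 - (Real.exp (-y) : ℂ) * z‖ ^ 2 := by
      rw [div_le_div_iff₀ (by norm_num) (by positivity)]
      have h1 : ‖1 - (Real.exp (-y) : ℂ) * z‖ ^ 2 ≤ 9 * d ^ 2 := by nlinarith
      have h2 : 0 ≤ (1 - Real.exp (-y)) * (1 - z.re) := mul_nonneg (by linarith) (by linarith)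
      have h3 := mul_le_mul_of_nonneg_left h1 (Real.exp_pos (-1)).le
      have h4 := mul_le_mul_of_nonneg_right hq (sq_nonneg d)
      rw [← hdd]
      nlinarith
    rw [re_one_sub_div]
    unfold wgt
    have hE := Real.exp_pos (-1)
    calc Real.exp (-1) ^ 2 / (18 * Real.Gamma α) * d ^ (α - 1)
        = d ^ (α - 1) / (2 * Real.Gamma α) * Real.exp (-1) * (Real.exp (-1) / 9) := by
          field_simp; ring
      _ ≤ _ := by
          have h0 : 0 < d ^ (α - 1) := Real.rpow_pos_of_pos hd0 _
          have h5 := dens_pos hα₀ hy0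
          have h6 := lap_ker₁_pos hy0
          gcongr
  · filter_upwards [ae_restrict_mem measurableSet_Ioi] with y hy
    exact hnn y hy

/-- Sector condition for the symbol, with the optimal order at `1`. -/
lemma exists_symb_lower {α : ℝ} (hα₀ : 0 < α) (hα₁ : α < 1) :
    ∃ c : ℝ, 0 < c ∧ ∀ z : ℂ, ‖z‖ ≤ 1 → z ≠ 1 →
      c * ‖1 - z‖ ^ α ≤ ‖symb α z‖ + (symb α z).re := by
  have hG := Real.Gamma_pos_of_pos hα₀
  set c₁ := Real.exp (-1) ^ 2 / (18 * Real.Gamma α) with hc₁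
  have hc₁0 : 0 < c₁ := by have := Real.exp_pos (-1); positivity
  set K := 2 * (∫ y in Ioi (0 : ℝ), |wgt α ker₂ y|) + 2 * ∫ y in Ioi (0 : ℝ), |wgt α ker₃ y|
    with hK
  have hI2 : 0 ≤ ∫ y in Ioi (0 : ℝ), |wgt α ker₂ y| := integral_nonneg fun _ => abs_nonneg _
  have hI3 : 0 ≤ ∫ y in Ioi (0 : ℝ), |wgt α ker₃ y| := integral_nonneg fun _ => abs_nonneg _
  have hK0 : 0 ≤ K := by positivity
  -- For $|1-z|\le d_0$ the second and third difference terms, of total size at most $K|1-z|$, are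
  -- at most half of the leading term, because $K|1-z|^{1-\alpha}\le c_1/2$.
  set d₀ := min (1 / 2) ((c₁ / (2 * (K + 1))) ^ (1 / (1 - α))) with hd₀
  have hd₀0 : 0 < d₀ := lt_min (by norm_num) (by positivity)
  have hnear : ∀ z : ℂ, ‖z‖ ≤ 1 → z ≠ 1 → ‖1 - z‖ ≤ d₀ →
      c₁ / 2 * ‖1 - z‖ ^ α ≤ ‖symb α z‖ + (symb α z).re := by
    intro z hz hz1 hd
    have hd0 : 0 < ‖1 - z‖ := norm_pos_iff.2 (sub_ne_zero.2 hz1.symm)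
    have h1 := re_one_sub_mul_genFun_ge hα₀ hα₁ hz hz1 (hd.trans (min_le_left _ _))
    have h2 := norm_one_sub_mul_genFun_le (integrableOn_wgt₂ hα₀ hα₁) hz
    have h3 := norm_one_sub_mul_genFun_le (integrableOn_wgt₃ hα₀ hα₁) hz
    have hre : (symb α z).re = ((1 - z) * genFun (wgt α ker₁) z).re
        + ((1 - z) * ((1 - z) * genFun (wgt α ker₂) z)).re
        + ((1 - z) ^ 2 * ((1 - z) * genFun (wgt α ker₃) z)).re := by
      rw [← Complex.add_re, ← Complex.add_re]; unfold symb; ring_nf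
    have e2 := (abs_le.1 (Complex.abs_re_le_norm
      ((1 - z) * ((1 - z) * genFun (wgt α ker₂) z)))).1
    have e3 := (abs_le.1 (Complex.abs_re_le_norm
      ((1 - z) ^ 2 * ((1 - z) * genFun (wgt α ker₃) z)))).1
    rw [norm_mul] at e2 e3
    rw [norm_pow] at e3
    have hdh : ‖1 - z‖ ≤ 1 / 2 := hd.trans (min_le_left _ _)
    have hsmall : K * ‖1 - z‖ ≤ c₁ / 2 * ‖1 - z‖ ^ α := by
      have hpow : ‖1 - z‖ ^ (1 - α) ≤ c₁ / (2 * (K + 1)) := by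
        have := Real.rpow_le_rpow hd0.le (hd.trans (min_le_right _ _))
          (by linarith : 0 ≤ 1 - α)
        rwa [← Real.rpow_mul (by positivity), one_div_mul_cancel (by linarith),
          Real.rpow_one] at this
      have hsplit : ‖1 - z‖ = ‖1 - z‖ ^ (1 - α) * ‖1 - z‖ ^ α := by
        rw [← Real.rpow_add hd0, sub_add_cancel, Real.rpow_one]
      have hp := Real.rpow_pos_of_pos hd0 α
      have hKm : K * ‖1 - z‖ ^ (1 - α) ≤ c₁ / 2 := by
        calc K * ‖1 - z‖ ^ (1 - α) ≤ (K + 1) * (c₁ / (2 * (K + 1))) := by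
              gcongr; linarith
          _ = c₁ / 2 := by field_simp
      calc K * ‖1 - z‖ = K * ‖1 - z‖ ^ (1 - α) * ‖1 - z‖ ^ α := by
            rw [mul_assoc, ← hsplit]
        _ ≤ _ := by gcongr
    have e2' : ‖1 - z‖ * ‖(1 - z) * genFun (wgt α ker₂) z‖
        ≤ ‖1 - z‖ * (2 * ∫ y in Ioi (0 : ℝ), |wgt α ker₂ y|) := by gcongr
    have e3' : ‖1 - z‖ ^ 2 * ‖(1 - z) * genFun (wgt α ker₃) z‖
        ≤ ‖1 - z‖ * (2 * ∫ y in Ioi (0 : ℝ), |wgt α ker₃ y|) := by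
      have : ‖1 - z‖ ^ 2 ≤ ‖1 - z‖ := by nlinarith
      gcongr
    have hn := norm_nonneg (symb α z)
    have hKd : K * ‖1 - z‖ = ‖1 - z‖ * (2 * ∫ y in Ioi (0 : ℝ), |wgt α ker₂ y|)
        + ‖1 - z‖ * (2 * ∫ y in Ioi (0 : ℝ), |wgt α ker₃ y|) := by rw [hK]; ring
    linarith
  -- Away from $1$ the closed disc is compact and the quantity is continuous and positive, hence
  -- bounded below by its minimum.
  set Kset : Set ℂ := {z : ℂ | ‖z‖ ≤ 1 ∧ d₀ ≤ ‖1 - z‖} with hKset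
  have hcomp : IsCompact Kset := by
    have : Kset = Metric.closedBall 0 1 ∩ {z : ℂ | d₀ ≤ ‖1 - z‖} := by
      ext z; simp [hKset]
    rw [this]
    exact (isCompact_closedBall _ _).inter_right
      (isClosed_le continuous_const (by fun_prop))
  have hcont : ContinuousOn (fun z => ‖symb α z‖ + (symb α z).re) Kset := by
    have h1 := continuousOn_genFun (integrableOn_wgt₁ hα₀ hα₁) hd₀0
    have h2 := continuousOn_genFun (integrableOn_wgt₂ hα₀ hα₁) hd₀0
    have h3 := continuousOn_genFun (integrableOn_wgt₃ hα₀ hα₁) hd₀0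
    have hs : ContinuousOn (symb α) Kset := by
      unfold symb
      fun_prop
    exact hs.norm.add (Complex.continuous_re.comp_continuousOn hs)
  have hne : Kset.Nonempty := ⟨-1, by
    simp only [hKset, mem_ofPred_eq, norm_neg, norm_one, le_refl, true_and]
    have : ‖(1 : ℂ) - -1‖ = 2 := by norm_num
    rw [this]
    exact (min_le_left _ _).trans (by norm_num)⟩
  obtain ⟨z₀, hz₀, hmin⟩ := hcomp.exists_isMinOn hne hcont
  set m := ‖symb α z₀‖ + (symb α z₀).re with hm
  have hm0 : 0 < m := norm_symb_add_re_pos hα₀ hα₁ hz₀.1 (by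
    rintro rfl
    have := hz₀.2
    simp at this; linarith)
  -- The minimum $m$ is halved because $|1-z|^\alpha\le2$ on the disc.
  refine ⟨min (c₁ / 2) (m / 2), by positivity, fun z hz hz1 => ?_⟩
  rcases le_total ‖1 - z‖ d₀ with h | h
  · refine le_trans ?_ (hnear z hz hz1 h)
    gcongr
    exact min_le_left _ _
  · refine le_trans ?_ (hmin ⟨hz, h⟩ : m ≤ _)
    have h2 : ‖1 - z‖ ^ α ≤ 2 := by
      have h3 : ‖1 - z‖ ≤ 2 := (norm_sub_le _ _).trans (by rw [norm_one]; linarith)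
      calc ‖1 - z‖ ^ α ≤ 2 ^ α := Real.rpow_le_rpow (norm_nonneg _) h3 hα₀.le
        _ ≤ 2 ^ (1 : ℝ) := Real.rpow_le_rpow_of_exponent_le (by norm_num) hα₁.le
        _ = 2 := Real.rpow_one _
    calc min (c₁ / 2) (m / 2) * ‖1 - z‖ ^ α ≤ m / 2 * 2 := by
          gcongr
          exact min_le_right _ _
      _ = m := by ring

/-! ### The derivative of the symbol. -/

/-- The modulus of the integrand is $y^{\alpha-2}(1-e^{-y})^2/(\Gamma(\alpha)|1-e^{-y}z|^2)$. Below
$y=d$ the denominator is bounded by $|1-e^{-y}z|\ge d/2$, which gives $4/(1+\alpha)$; above,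
$|1-e^{-y}z|\ge1-e^{-y}$ leaves the tail of $y^{\alpha-2}$, which gives $1/(1-\alpha)$. -/
lemma integral_wgt₁_kernel_le {α : ℝ} (hα₀ : 0 < α) (hα₁ : α < 1) {z : ℂ} (hz : ‖z‖ ≤ 1)
    (hz1 : z ≠ 1) (hint : IntegrableOn (fun y : ℝ => (wgt α ker₁ y : ℂ) * (1 - Real.exp (-y))
      / (1 - (Real.exp (-y) : ℂ) * z) ^ 2) (Ioi (0 : ℝ))) :
    ‖∫ y in Ioi (0 : ℝ), (wgt α ker₁ y : ℂ) * (1 - Real.exp (-y))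
      / (1 - (Real.exp (-y) : ℂ) * z) ^ 2‖
      ≤ (4 / (1 + α) + 1 / (1 - α)) / Real.Gamma α * ‖1 - z‖ ^ (α - 1) := by
  set d := ‖1 - z‖ with hd
  have hd0 : 0 < d := norm_pos_iff.2 (sub_ne_zero.2 hz1.symm)
  have hG := Real.Gamma_pos_of_pos hα₀
  have hpt : ∀ y ∈ Ioi (0 : ℝ), ‖(wgt α ker₁ y : ℂ) * (1 - Real.exp (-y))
      / (1 - (Real.exp (-y) : ℂ) * z) ^ 2‖
      = y ^ (α - 2) / Real.Gamma α * ((1 - Real.exp (-y)) ^ 2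
        / ‖1 - (Real.exp (-y) : ℂ) * z‖ ^ 2) := by
    intro y hy
    have h1 := exp_neg_lt_one hy
    rw [norm_div, norm_mul, norm_pow, ← Complex.ofReal_one, ← Complex.ofReal_sub,
      Complex.norm_real, Complex.norm_real, Real.norm_of_nonneg (wgt₁_pos hα₀ hy).le,
      Real.norm_of_nonneg (by linarith), wgt, lap_ker₁ hy, dens,
      show α - 2 = α - 1 - 1 by ring, Real.rpow_sub_one (ne_of_gt hy) (α - 1)]
    ring
  have hsplit : Ioi (0 : ℝ) = Ioc 0 d ∪ Ioi d := (Ioc_union_Ioi_eq_Ioi hd0.le).symm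
  have hs1 : Ioc (0 : ℝ) d ⊆ Ioi 0 := fun y hy => hy.1
  have hs2 : Ioi d ⊆ Ioi (0 : ℝ) := fun y hy => hd0.trans hy
  rw [hsplit, setIntegral_union (Ioc_disjoint_Ioi le_rfl)
    measurableSet_Ioi (hint.mono_set hs1) (hint.mono_set hs2)]
  refine (norm_add_le _ _).trans ?_
  have hA : ‖∫ y in Ioc (0 : ℝ) d, (wgt α ker₁ y : ℂ) * (1 - Real.exp (-y))
      / (1 - (Real.exp (-y) : ℂ) * z) ^ 2‖
      ≤ ∫ y in Ioc (0 : ℝ) d, 4 / (d ^ 2 * Real.Gamma α) * y ^ α := by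
    have hi : IntervalIntegrable (fun y : ℝ => y ^ α) volume 0 d :=
      intervalIntegral.intervalIntegrable_rpow' (by linarith)
    rw [intervalIntegrable_iff_integrableOn_Ioc_of_le hd0.le] at hi
    refine norm_integral_le_of_norm_le (hi.const_mul _) ?_
    filter_upwards [ae_restrict_mem measurableSet_Ioc] with y hy
    have hy0 : 0 < y := hy.1
    have h1 := exp_neg_lt_one hy0
    have h2 := norm_one_sub_le (Real.exp_pos (-y)).le h1.le hz
    have h3 : 1 - y ≤ Real.exp (-y) := by have := Real.add_one_le_exp (-y); linarith
    have hden : d / 2 ≤ ‖1 - (Real.exp (-y) : ℂ) * z‖ := by rw [hd]; linarith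
    rw [hpt y hy0]
    calc y ^ (α - 2) / Real.Gamma α * ((1 - Real.exp (-y)) ^ 2
        / ‖1 - (Real.exp (-y) : ℂ) * z‖ ^ 2)
        ≤ y ^ (α - 2) / Real.Gamma α * (y ^ 2 / (d / 2) ^ 2) := by
          have : 0 ≤ 1 - Real.exp (-y) := by linarith
          gcongr
          linarith
      _ = 4 / (d ^ 2 * Real.Gamma α) * (y ^ (α - 2) * y ^ (2 : ℝ)) := by
          rw [Real.rpow_two]; field_simp; ring
      _ = 4 / (d ^ 2 * Real.Gamma α) * y ^ α := by
          rw [← Real.rpow_add hy0, sub_add_cancel]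
  have hB : ‖∫ y in Ioi d, (wgt α ker₁ y : ℂ) * (1 - Real.exp (-y))
      / (1 - (Real.exp (-y) : ℂ) * z) ^ 2‖
      ≤ ∫ y in Ioi d, y ^ (α - 2) / Real.Gamma α := by
    refine norm_integral_le_of_norm_le
      ((integrableOn_Ioi_rpow_of_lt (by linarith) hd0).div_const _) ?_
    filter_upwards [ae_restrict_mem measurableSet_Ioi] with y hy
    have hy0 : 0 < y := hs2 hy
    have h1 := exp_neg_lt_one hy0
    have h2 := one_sub_le_norm (Real.exp_pos (-y)).le hz
    rw [hpt y hy0]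
    have hp := Real.rpow_pos_of_pos hy0 (α - 2)
    refine mul_le_of_le_one_right (by positivity) ?_
    refine div_le_one_of_le₀ ?_ (by positivity)
    have : 0 ≤ 1 - Real.exp (-y) := by linarith
    gcongr
  have hIoc : ∫ y in Ioc (0 : ℝ) d, y ^ α = d ^ (α + 1) / (α + 1) := by
    rw [← intervalIntegral.integral_of_le hd0.le,
      integral_rpow (Or.inl (by linarith)), Real.zero_rpow (by linarith), sub_zero]
  rw [integral_const_mul, hIoc] at hA
  rw [integral_div, integral_Ioi_rpow_of_lt (by linarith) hd0] at hB
  refine (add_le_add hA hB).trans (le_of_eq ?_)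
  rw [show α - 2 + 1 = α - 1 by ring, show α + 1 = (α - 1) + 2 by ring,
    Real.rpow_add hd0 (α - 1) 2, Real.rpow_two]
  have e1 : (α - 1) + 2 ≠ 0 := by linarith
  have e2 : α - 1 ≠ 0 := by linarith
  have e3 : 1 - α ≠ 0 := by linarith
  have e4 : 1 + α ≠ 0 := by linarith
  rw [show 1 - α = -(α - 1) by ring, show (α - 1) + 2 = 1 + α by ring]
  field_simp

lemma norm_sq_mul_deriv_genFun_le {w : ℝ → ℝ} (hw : IntegrableOn w (Ioi 0)) {z : ℂ}
    (hz : ‖z‖ ≤ 1) :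
    ‖(1 - z) ^ 2 * ∫ y in Ioi (0 : ℝ), (w y : ℂ) * Real.exp (-y)
      / (1 - (Real.exp (-y) : ℂ) * z) ^ 2‖ ≤ 4 * ∫ y in Ioi (0 : ℝ), |w y| := by
  rw [← integral_const_mul, ← integral_const_mul]
  refine norm_integral_le_of_norm_le (hw.norm.const_mul 4) ?_
  filter_upwards [ae_restrict_mem measurableSet_Ioi] with y hy
  have h := norm_one_sub_le (Real.exp_pos (-y)).le (exp_neg_lt_one hy).le hz
  have h0 := norm_pos_iff.2 (one_sub_exp_mul_ne_zero hy hz)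
  have hq := exp_neg_lt_one hy
  rw [norm_mul, norm_div, norm_mul, norm_pow, norm_pow, Complex.norm_real, Complex.norm_real,
    Real.norm_of_nonneg (Real.exp_pos (-y)).le, ← Real.norm_eq_abs,
    show ∀ a b c e : ℝ, a * (b * c / e) = c * (a / e) * b from fun a b c e => by ring]
  refine mul_le_mul_of_nonneg_right ?_ (norm_nonneg _)
  have h4 : ‖1 - z‖ ^ 2 / ‖1 - (Real.exp (-y) : ℂ) * z‖ ^ 2 ≤ 4 := by
    rw [div_le_iff₀ (by positivity)]
    nlinarith [norm_nonneg (1 - z)]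
  have h5 : 0 ≤ ‖1 - z‖ ^ 2 / ‖1 - (Real.exp (-y) : ℂ) * z‖ ^ 2 := by positivity
  nlinarith [Real.exp_pos (-y)]

lemma differentiableAt_symb {α : ℝ} (hα₀ : 0 < α) (hα₁ : α < 1) {z : ℂ} (hz : ‖z‖ < 1) :
    DifferentiableAt ℂ (symb α) z := by
  have h1 := (hasDerivAt_genFun (integrableOn_wgt₁ hα₀ hα₁) hz).2.differentiableAt
  have h2 := (hasDerivAt_genFun (integrableOn_wgt₂ hα₀ hα₁) hz).2.differentiableAt
  have h3 := (hasDerivAt_genFun (integrableOn_wgt₃ hα₀ hα₁) hz).2.differentiableAt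
  unfold symb
  fun_prop

/-- The derivative of the symbol has the order of `(1-z)^(α-1)`. -/
lemma exists_deriv_symb_le {α : ℝ} (hα₀ : 0 < α) (hα₁ : α < 1) :
    ∃ C : ℝ, 0 < C ∧ ∀ z : ℂ, ‖z‖ < 1 → ‖deriv (symb α) z‖ ≤ C * ‖1 - z‖ ^ (α - 1) := by
  have hG := Real.Gamma_pos_of_pos hα₀
  set I₂ := ∫ y in Ioi (0 : ℝ), |wgt α ker₂ y| with hI₂
  set I₃ := ∫ y in Ioi (0 : ℝ), |wgt α ker₃ y| with hI₃
  have hI2 : 0 ≤ I₂ := integral_nonneg fun _ => abs_nonneg _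
  have hI3 : 0 ≤ I₃ := integral_nonneg fun _ => abs_nonneg _
  have h1α : 0 < 1 - α := by linarith
  refine ⟨(4 / (1 + α) + 1 / (1 - α)) / Real.Gamma α + (8 * I₂ + 20 * I₃) * 2, by positivity, ?_⟩
  intro z hz
  have hz1 : z ≠ 1 := by rintro rfl; simp at hz
  set d := ‖1 - z‖ with hd
  have hd0 : 0 < d := norm_pos_iff.2 (sub_ne_zero.2 hz1.symm)
  have hd2 : d ≤ 2 := (norm_sub_le _ _).trans (by rw [norm_one]; linarith)
  obtain ⟨i1, h1⟩ := hasDerivAt_genFun (integrableOn_wgt₁ hα₀ hα₁) hz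
  obtain ⟨-, h2⟩ := hasDerivAt_genFun (integrableOn_wgt₂ hα₀ hα₁) hz
  obtain ⟨-, h3⟩ := hasDerivAt_genFun (integrableOn_wgt₃ hα₀ hα₁) hz
  have hl : HasDerivAt (fun z : ℂ => 1 - z) (-1) z := by
    simpa using (hasDerivAt_id z).const_sub 1
  have r1 := integrableOn_resolvent (integrableOn_wgt₁ hα₀ hα₁) hz.le hz1
  -- The derivative of $(1-z)/(1-qz)$ is $-(1-q)/(1-qz)^2$. The two terms are combined before taking
  -- norms, since the factor $1-q$ tames the singularity of the density at $y=0$.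
  have hmain : -genFun (wgt α ker₁) z + (1 - z) * (∫ y in Ioi (0 : ℝ),
      (wgt α ker₁ y : ℂ) * Real.exp (-y) / (1 - (Real.exp (-y) : ℂ) * z) ^ 2)
      = -∫ y in Ioi (0 : ℝ), (wgt α ker₁ y : ℂ) * (1 - Real.exp (-y))
      / (1 - (Real.exp (-y) : ℂ) * z) ^ 2 := by
    unfold genFun
    rw [← integral_const_mul, ← integral_neg, ← integral_neg]
    refine (integral_add r1.neg (i1.const_mul (1 - z))).symm.trans ?_
    apply setIntegral_congr_fun measurableSet_Ioi
    intro y hy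
    have := one_sub_exp_mul_ne_zero hy hz.le
    simp only [Pi.neg_apply]
    field_simp
    ring
  have hmint : IntegrableOn (fun y : ℝ => (wgt α ker₁ y : ℂ) * (1 - Real.exp (-y))
      / (1 - (Real.exp (-y) : ℂ) * z) ^ 2) (Ioi (0 : ℝ)) := by
    refine (r1.sub (i1.const_mul (1 - z))).congr_fun ?_ measurableSet_Ioi
    intro y hy
    have := one_sub_exp_mul_ne_zero hy hz.le
    simp only [Pi.sub_apply]
    field_simp
    ring
  have hD : deriv (symb α) z = (-genFun (wgt α ker₁) z + (1 - z) * (∫ y in Ioi (0 : ℝ),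
      (wgt α ker₁ y : ℂ) * Real.exp (-y) / (1 - (Real.exp (-y) : ℂ) * z) ^ 2))
      + (-2 * ((1 - z) * genFun (wgt α ker₂) z) + (1 - z) ^ 2 * (∫ y in Ioi (0 : ℝ),
      (wgt α ker₂ y : ℂ) * Real.exp (-y) / (1 - (Real.exp (-y) : ℂ) * z) ^ 2))
      + (1 - z) * (-3 * ((1 - z) * genFun (wgt α ker₃) z) + (1 - z) ^ 2 * (∫ y in Ioi (0 : ℝ),
      (wgt α ker₃ y : ℂ) * Real.exp (-y) / (1 - (Real.exp (-y) : ℂ) * z) ^ 2)) := by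
    have := ((hl.mul h1).add ((hl.pow 2).mul h2)).add ((hl.pow 3).mul h3)
    refine (HasDerivAt.deriv this).trans ?_
    simp only [Pi.pow_apply]
    push_cast
    ring
  rw [hD, hmain]
  have n1 := integral_wgt₁_kernel_le hα₀ hα₁ hz.le hz1 hmint
  have n2 := norm_one_sub_mul_genFun_le (integrableOn_wgt₂ hα₀ hα₁) hz.le
  have n3 := norm_one_sub_mul_genFun_le (integrableOn_wgt₃ hα₀ hα₁) hz.le
  have m2 := norm_sq_mul_deriv_genFun_le (integrableOn_wgt₂ hα₀ hα₁) hz.le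
  have m3 := norm_sq_mul_deriv_genFun_le (integrableOn_wgt₃ hα₀ hα₁) hz.le
  -- Since $d\le2$, the power $d^{\alpha-1}$ is bounded below, so the bounded contributions of
  -- `ker₂` and `ker₃` are absorbed at the cost of a factor $2$.
  have hdp : 1 / 2 ≤ d ^ (α - 1) := by
    have h3 := Real.rpow_le_rpow_of_nonpos hd0 hd2 (by linarith : α - 1 ≤ 0)
    have h4 := Real.rpow_le_rpow_of_exponent_le (by norm_num : (1 : ℝ) ≤ 2)
      (by linarith : -1 ≤ α - 1)
    rw [Real.rpow_neg_one] at h4; linarith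
  refine (norm_add_le _ _).trans ((add_le_add (norm_add_le _ _) le_rfl).trans ?_)
  rw [norm_neg]
  have b2 : ∀ a b : ℂ, ‖a‖ ≤ 2 * I₂ → ‖b‖ ≤ 4 * I₂ → ‖-2 * a + b‖ ≤ 8 * I₂ := by
    intro a b ha hb
    refine (norm_add_le _ _).trans ?_
    rw [norm_mul, norm_neg, Complex.norm_ofNat]
    linarith
  have b3 : ∀ a b : ℂ, ‖a‖ ≤ 2 * I₃ → ‖b‖ ≤ 4 * I₃ →
      ‖(1 - z) * (-3 * a + b)‖ ≤ 20 * I₃ := by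
    intro a b ha hb
    have : ‖-3 * a + b‖ ≤ 10 * I₃ := by
      refine (norm_add_le _ _).trans ?_
      rw [norm_mul, norm_neg, Complex.norm_ofNat]
      linarith
    rw [norm_mul]
    nlinarith [norm_nonneg (-3 * a + b)]
  have c2 := b2 _ _ n2 m2
  have c3 := b3 _ _ n3 m3
  have : 8 * I₂ + 20 * I₃ ≤ (8 * I₂ + 20 * I₃) * 2 * d ^ (α - 1) := by
    nlinarith [mul_nonneg (by positivity : 0 ≤ 8 * I₂ + 20 * I₃) (sub_nonneg.2 hdp)]
  rw [add_mul]
  linarith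

/-! ### The symbol as a power series. -/

/-- The power series of the symbol. -/
def symbSeries (α : ℝ) : PowerSeries ℝ :=
  (1 - PowerSeries.X) * PowerSeries.mk (mom α ker₁)
    + (1 - PowerSeries.X) ^ 2 * PowerSeries.mk (mom α ker₂)
    + (1 - PowerSeries.X) ^ 3 * PowerSeries.mk (mom α ker₃)

/-- Convergence of a real power series at a complex point. -/
def SumsTo (p : PowerSeries ℝ) (z s : ℂ) : Prop :=
  HasSum (fun n : ℕ => ((PowerSeries.coeff n p : ℝ) : ℂ) * z ^ n) s

lemma SumsTo.add {p p' : PowerSeries ℝ} {z s s' : ℂ} (h : SumsTo p z s) (h' : SumsTo p' z s') :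
    SumsTo (p + p') z (s + s') := by
  have := HasSum.add h h'
  unfold SumsTo
  refine this.congr_fun fun n => ?_
  simp only [map_add]; push_cast; ring

lemma SumsTo.one_sub_X_mul {p : PowerSeries ℝ} {z s : ℂ} (h : SumsTo p z s) :
    SumsTo ((1 - PowerSeries.X) * p) z ((1 - z) * s) := by
  have hX : HasSum (fun n : ℕ => ((PowerSeries.coeff n (PowerSeries.X * p) : ℝ) : ℂ) * z ^ n)
      (z * s) := by
    rw [← hasSum_nat_add_iff' 1]
    simp only [Finset.sum_range_one, PowerSeries.coeff_zero_X_mul, Complex.ofReal_zero, zero_mul,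
      sub_zero, PowerSeries.coeff_succ_X_mul]
    refine (HasSum.mul_left z h).congr_fun fun n => ?_
    ring
  have := HasSum.sub h hX
  unfold SumsTo
  rw [show (1 - z) * s = s - z * s by ring]
  refine this.congr_fun fun n => ?_
  rw [sub_mul, one_mul, map_sub]; push_cast; ring

lemma sumsTo_mk_mom {α : ℝ} (hα₀ : 0 < α) (hα₁ : α < 1) {k : ℝ → ℝ} (hk : Continuous k) {z : ℂ}
    (hz : ‖z‖ < 1) : SumsTo (PowerSeries.mk (mom α k)) z (genFun (wgt α k) z) := by
  have h := hasSum_genFun (integrableOn_dens_mul_lap hα₀ hα₁ hk) hz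
  simp_rw [← mom_eq_integral hα₀ hα₁ hk] at h
  unfold SumsTo
  simp_rw [PowerSeries.coeff_mk]
  exact h

lemma sumsTo_symbSeries {α : ℝ} (hα₀ : 0 < α) (hα₁ : α < 1) {z : ℂ} (hz : ‖z‖ < 1) :
    SumsTo (symbSeries α) z (symb α z) := by
  have h1 := (sumsTo_mk_mom hα₀ hα₁ continuous_ker₁ hz).one_sub_X_mul
  have h2 := (sumsTo_mk_mom hα₀ hα₁ continuous_ker₂ hz).one_sub_X_mul.one_sub_X_mul
  have h3 := (sumsTo_mk_mom hα₀ hα₁ continuous_ker₃ hz).one_sub_X_mul.one_sub_X_mul.one_sub_X_mul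
  have h := (h1.add h2).add h3
  unfold symbSeries symb
  convert h using 1 <;> ring

lemma iteratedDeriv_eq_of_hasSum {f : ℂ → ℂ} {c : ℕ → ℂ}
    (h : ∀ z : ℂ, ‖z‖ < 1 → HasSum (fun n => c n * z ^ n) (f z)) (n : ℕ) :
    iteratedDeriv n f 0 = n.factorial * c n := by
  have h1 : HasFPowerSeriesAt f (FormalMultilinearSeries.ofScalars ℂ c) 0 := by
    rw [hasFPowerSeriesAt_iff]
    filter_upwards [Metric.ball_mem_nhds (0 : ℂ) one_pos] with z hz
    rw [zero_add]
    refine (h z (by simpa using hz)).congr_fun fun n => ?_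
    rw [FormalMultilinearSeries.coeff_ofScalars, smul_eq_mul, mul_comm]
  obtain ⟨r, hr⟩ := h1
  have := hr.factorial_smul 1 n
  rw [iteratedFDeriv_apply_eq_iteratedDeriv_mul_prod] at this
  simp at this
  exact this.symm

/-! ### Integrals over circles of radius close to one. -/

/-- Lower bound for the distance from `1` to a circle of radius close to `1`. -/
lemma norm_one_sub_circleMap_ge {ρ : ℝ} (hρ : 1 / 2 ≤ ρ) {θ : ℝ}
    (hθ : |θ| ≤ Real.pi) : (1 - ρ + |θ|) / 4 ≤ ‖1 - circleMap 0 ρ θ‖ := by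
  have hsq : ‖1 - circleMap 0 ρ θ‖ ^ 2 = (1 - ρ) ^ 2 + 2 * ρ * (1 - Real.cos θ) := by
    rw [← Complex.normSq_eq_norm_sq, Complex.normSq_apply, circleMap, zero_add,
      Complex.sub_re, Complex.sub_im, Complex.re_ofReal_mul, Complex.im_ofReal_mul,
      Complex.exp_ofReal_mul_I_re, Complex.exp_ofReal_mul_I_im, Complex.one_re, Complex.one_im]
    nlinarith [Real.sin_sq_add_cos_sq θ]
  have hcos : Real.cos θ ≤ 1 - 2 / Real.pi ^ 2 * θ ^ 2 := Real.cos_le_one_sub_mul_cos_sq hθ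
  have hpi : Real.pi ^ 2 ≤ 10 := by nlinarith [Real.pi_lt_d2, Real.pi_pos]
  have h5 : 1 / 5 ≤ 2 / Real.pi ^ 2 := by
    rw [div_le_div_iff₀ (by norm_num) (by positivity)]; linarith
  have h6 : θ ^ 2 / 5 ≤ 1 - Real.cos θ := by nlinarith [sq_nonneg θ]
  have h7 : (1 - ρ) ^ 2 + θ ^ 2 / 5 ≤ ‖1 - circleMap 0 ρ θ‖ ^ 2 := by
    rw [hsq]; nlinarith [sq_nonneg θ]
  refine le_of_sq_le_sq ?_ (norm_nonneg _)
  refine le_trans ?_ h7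
  rw [← sq_abs θ]
  nlinarith [sq_nonneg (1 - ρ - |θ|), sq_nonneg |θ|, sq_nonneg (1 - ρ)]

lemma integral_add_rpow_le {α δ : ℝ} (hα₀ : 0 < α) (hδ : 0 < δ) :
    ∫ θ in (0 : ℝ)..2 * Real.pi, (δ + θ) ^ (-1 - α) ≤ δ ^ (-α) / α := by
  have hpi := Real.pi_pos
  rw [intervalIntegral.integral_comp_add_left (fun x => x ^ (-1 - α)), add_zero,
    integral_rpow]
  · rw [show -1 - α + 1 = -α by ring, div_neg, ← neg_div, neg_sub]
    have : 0 < (δ + 2 * Real.pi) ^ (-α) := by positivity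
    gcongr
    linarith
  · right
    refine ⟨by linarith, fun h => ?_⟩
    rw [uIcc_of_le (by linarith)] at h
    linarith [h.1]

/-- The circle integrals controlling the coefficients of functions of order `(1-z)^(-1-α)`. -/
lemma integral_norm_one_sub_circleMap_le {α ρ : ℝ} (hα₀ : 0 < α) (hρ : 1 / 2 ≤ ρ) (hρ1 : ρ < 1) :
    ∫ θ in (0 : ℝ)..2 * Real.pi, ‖1 - circleMap 0 ρ θ‖ ^ (-1 - α)
      ≤ 4 ^ (1 + α) * (2 / α) * (1 - ρ) ^ (-α) := by
  have hpi := Real.pi_pos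
  have hδ : 0 < 1 - ρ := by linarith
  have hne : ∀ θ, 0 < ‖1 - circleMap 0 ρ θ‖ := by
    intro θ
    have h1 := norm_sub_norm_le (1 : ℂ) (circleMap 0 ρ θ)
    rw [norm_one, norm_circleMap_zero, abs_of_nonneg (by linarith)] at h1
    linarith
  have hc1 : ContinuousOn (fun θ : ℝ => (1 - ρ + θ) ^ (-1 - α)) (uIcc 0 (2 * Real.pi)) := by
    rw [uIcc_of_le (by linarith)]
    refine ContinuousOn.rpow_const (by fun_prop) fun θ hθ => Or.inl ?_
    have := hθ.1; linarith
  have hc2 : ContinuousOn (fun θ : ℝ => (1 - ρ + (2 * Real.pi - θ)) ^ (-1 - α))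
      (uIcc 0 (2 * Real.pi)) := by
    rw [uIcc_of_le (by linarith)]
    refine ContinuousOn.rpow_const (by fun_prop) fun θ hθ => Or.inl ?_
    have := hθ.2; linarith
  have hcn : Continuous fun θ : ℝ => ‖1 - circleMap 0 ρ θ‖ ^ (-1 - α) :=
    Continuous.rpow_const (by fun_prop) fun θ => Or.inl (hne θ).ne'
  have key : ∀ θ φ : ℝ, 0 ≤ φ → (1 - ρ + φ) / 4 ≤ ‖1 - circleMap 0 ρ θ‖ →
      ‖1 - circleMap 0 ρ θ‖ ^ (-1 - α) ≤ 4 ^ (1 + α) * (1 - ρ + φ) ^ (-1 - α) := by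
    intro θ φ hφ h
    have h0 : 0 < 1 - ρ + φ := by linarith
    refine (Real.rpow_le_rpow_of_nonpos (by positivity) h (by linarith)).trans (le_of_eq ?_)
    rw [Real.div_rpow h0.le (by norm_num), show (1 : ℝ) + α = -(-1 - α) by ring,
      Real.rpow_neg (by norm_num) (-1 - α)]
    field_simp
  have hle : ∫ θ in (0 : ℝ)..2 * Real.pi, ‖1 - circleMap 0 ρ θ‖ ^ (-1 - α)
      ≤ ∫ θ in (0 : ℝ)..2 * Real.pi, (4 ^ (1 + α) * (1 - ρ + θ) ^ (-1 - α)
        + 4 ^ (1 + α) * (1 - ρ + (2 * Real.pi - θ)) ^ (-1 - α)) := by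
    refine intervalIntegral.integral_mono_on (by linarith) (hcn.intervalIntegrable _ _)
      ((hc1.intervalIntegrable.const_mul _).add (hc2.intervalIntegrable.const_mul _)) ?_
    intro θ hθ
    have p1 : 0 ≤ 4 ^ (1 + α) * (1 - ρ + θ) ^ (-1 - α) := by
      have := hθ.1
      have : 0 ≤ 1 - ρ + θ := by linarith
      positivity
    have p2 : 0 ≤ 4 ^ (1 + α) * (1 - ρ + (2 * Real.pi - θ)) ^ (-1 - α) := by
      have := hθ.2
      have : 0 ≤ 1 - ρ + (2 * Real.pi - θ) := by linarith
      positivity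
    -- On $[0,2\pi]$ the circle is close to $1$ at both ends. The majorant is a sum of two powers,
    -- one in $\theta$ and one in $2\pi-\theta$, and one of them suffices on each half.
    rcases le_total θ Real.pi with h | h
    · have h1 := norm_one_sub_circleMap_ge hρ (θ := θ)
        (by rw [abs_of_nonneg hθ.1]; exact h)
      rw [abs_of_nonneg hθ.1] at h1
      have := key θ θ hθ.1 h1
      linarith
    · have hab : |θ - 2 * Real.pi| = 2 * Real.pi - θ := by
        rw [abs_sub_comm, abs_of_nonneg]; have := hθ.2; linarith
      have h1 := norm_one_sub_circleMap_ge hρ (θ := θ - 2 * Real.pi)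
        (by rw [hab]; linarith)
      rw [hab, (periodic_circleMap 0 ρ).sub_eq] at h1
      have := key θ (2 * Real.pi - θ) (by have := hθ.2; linarith) h1
      linarith
  refine hle.trans ?_
  rw [intervalIntegral.integral_add (hc1.intervalIntegrable.const_mul _)
    (hc2.intervalIntegrable.const_mul _), intervalIntegral.integral_const_mul,
    intervalIntegral.integral_const_mul,
    intervalIntegral.integral_comp_sub_left (fun x => (1 - ρ + x) ^ (-1 - α)), sub_self, sub_zero]
  have := integral_add_rpow_le hα₀ hδ
  have h4 : (0 : ℝ) < 4 ^ (1 + α) := by positivity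
  calc _ ≤ 4 ^ (1 + α) * ((1 - ρ) ^ (-α) / α) + 4 ^ (1 + α) * ((1 - ρ) ^ (-α) / α) := by gcongr
    _ = _ := by ring

/-! ### Resolvent of the second difference operator. -/

/-- Moduli give $|\nu||\zeta|=|1-\zeta|^2$, and the real part of $\nu\zeta\bar\zeta$ gives
$\operatorname{Re}\nu\,|\zeta|^2=\operatorname{Re}\zeta\,(1+|\zeta|^2)-2|\zeta|^2$. Together,
$(|\nu|+\operatorname{Re}\nu)|\zeta|^2=(1-|\zeta|)^2(|\zeta|+\operatorname{Re}\zeta)$, and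
$\operatorname{Re}\zeta\le|\zeta|$. -/
lemma quadratic_root_bound {ν ζ : ℂ} (h : ν * ζ = (1 - ζ) ^ 2) :
    (‖ν‖ + ν.re) * ‖ζ‖ ≤ 2 * (1 - ‖ζ‖) ^ 2 := by
  rcases eq_or_ne ζ 0 with rfl | hζ
  · simp at h
  have hr : 0 < ‖ζ‖ := norm_pos_iff.2 hζ
  have hN : ‖ζ‖ ^ 2 = ζ.re ^ 2 + ζ.im ^ 2 := by
    rw [← Complex.normSq_eq_norm_sq, Complex.normSq_apply]; ring
  have h1 : ‖ν‖ * ‖ζ‖ = 1 - 2 * ζ.re + ‖ζ‖ ^ 2 := by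
    rw [← norm_mul, h, norm_pow, ← Complex.normSq_eq_norm_sq, Complex.normSq_apply, hN]
    simp only [Complex.sub_re, Complex.sub_im, Complex.one_re, Complex.one_im]
    ring
  have hre := congrArg Complex.re h
  have him := congrArg Complex.im h
  simp only [pow_two, Complex.mul_re, Complex.mul_im, Complex.sub_re, Complex.sub_im,
    Complex.one_re, Complex.one_im] at hre him
  have h2 : ν.re * ‖ζ‖ ^ 2 = ζ.re * (1 + ‖ζ‖ ^ 2) - 2 * ‖ζ‖ ^ 2 := by
    rw [hN]
    linear_combination ζ.re * hre + ζ.im * him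
  have hx : ζ.re ≤ ‖ζ‖ := Complex.re_le_norm ζ
  have h3 : (‖ν‖ + ν.re) * ‖ζ‖ * ‖ζ‖ = (1 - ‖ζ‖) ^ 2 * (‖ζ‖ + ζ.re) := by
    linear_combination ‖ζ‖ * h1 + h2
  have h4 : (‖ν‖ + ν.re) * ‖ζ‖ * ‖ζ‖ ≤ 2 * (1 - ‖ζ‖) ^ 2 * ‖ζ‖ := by
    rw [h3]; nlinarith [sq_nonneg (1 - ‖ζ‖)]
  exact le_of_mul_le_mul_right h4 hr

/-- The two roots of the quadratic have product $1$. By `quadratic_root_bound` neither lies on the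
unit circle, so one of them lies strictly inside. -/
lemma exists_quadratic_root {ν : ℂ} (hν : 0 < ‖ν‖ + ν.re) :
    ∃ ζ : ℂ, ζ ≠ 0 ∧ ‖ζ‖ < 1 ∧ ν * ζ = (1 - ζ) ^ 2 := by
  obtain ⟨s, hs⟩ := IsAlgClosed.exists_eq_mul_self ((2 + ν) ^ 2 - 4)
  have key : ∀ ζ : ℂ, ζ ≠ 0 → ν * ζ = (1 - ζ) ^ 2 → ‖ζ‖ ≠ 1 := by
    intro ζ h0 h h1
    have := quadratic_root_bound h
    rw [h1] at this
    linarith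
  have hp : ((2 + ν - s) / 2) * ((2 + ν + s) / 2) = 1 := by linear_combination hs / 4
  have e1 : ν * ((2 + ν - s) / 2) = (1 - (2 + ν - s) / 2) ^ 2 := by linear_combination hs / 4
  have e2 : ν * ((2 + ν + s) / 2) = (1 - (2 + ν + s) / 2) ^ 2 := by linear_combination hs / 4
  have n1 : (2 + ν - s) / 2 ≠ 0 := left_ne_zero_of_mul_eq_one hp
  have n2 : (2 + ν + s) / 2 ≠ 0 := right_ne_zero_of_mul_eq_one hp
  have hpn := congrArg norm hp
  rw [norm_mul, norm_one] at hpn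
  rcases lt_or_ge ‖(2 + ν - s) / 2‖ 1 with h | h
  · exact ⟨_, n1, h, e1⟩
  · refine ⟨_, n2, ?_, e2⟩
    have h' := lt_of_le_of_ne h (key _ n1 e1).symm
    nlinarith [norm_pos_iff.2 n2]

lemma exists_inverse_one_sub {𝔸 : Type} [NormedRing 𝔸] [CompleteSpace 𝔸] [NormOneClass 𝔸]
    {x : 𝔸} {r : ℝ} (hx : ‖x‖ ≤ r) (hr : r < 1) :
    ∃ y : 𝔸, (1 - x) * y = 1 ∧ y * (1 - x) = 1 ∧ ‖y‖ ≤ (1 - r)⁻¹ := by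
  have hx1 := hx.trans_lt hr
  refine ⟨∑' n : ℕ, x ^ n, mul_neg_geom_series x hx1, geom_series_mul_neg x hx1, ?_⟩
  refine (tsum_geometric_le_of_norm_lt_one x hx1).trans ?_
  rw [norm_one, sub_self, zero_add]
  gcongr

/-- Sectorial resolvent bound for the second difference operator. -/
lemma exists_resolvent {𝔸 : Type} [NormedRing 𝔸] [NormedAlgebra ℂ 𝔸] [CompleteSpace 𝔸]
    [NormOneClass 𝔸] {S S' : 𝔸} (h₁ : S * S' = 1) (hS : ‖S‖ ≤ 1)
    (hS' : ‖S'‖ ≤ 1) {a : ℝ} (ha : 0 < a) {μ : ℂ} (hμ : 0 < ‖μ‖ + μ.re) :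
    ∃ Y : 𝔸, (μ • (1 : 𝔸) + (a : ℂ) • (2 - S - S')) * Y = 1 ∧
      Y * (μ • (1 : 𝔸) + (a : ℂ) • (2 - S - S')) = 1 ∧ ‖Y‖ ≤ 2 / (‖μ‖ + μ.re) := by
  have haC : (a : ℂ) ≠ 0 := by exact_mod_cast ha.ne'
  have hnorm : ‖μ / a‖ = ‖μ‖ / a := by
    rw [norm_div, Complex.norm_real, Real.norm_of_nonneg ha.le]
  have hre : (μ / a).re = μ.re / a := Complex.div_ofReal_re _ _
  have hν : 0 < ‖μ / a‖ + (μ / a).re := by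
    rw [hnorm, hre, ← add_div]; positivity
  obtain ⟨ζ, hζ0, hζ1, hζ⟩ := exists_quadratic_root hν
  have hb := quadratic_root_bound hζ
  have hr0 : 0 < ‖ζ‖ := norm_pos_iff.2 hζ0
  have n1 : ‖ζ • S‖ ≤ ‖ζ‖ := (norm_smul_le _ _).trans (mul_le_of_le_one_right hr0.le hS)
  have n2 : ‖ζ • S'‖ ≤ ‖ζ‖ := (norm_smul_le _ _).trans (mul_le_of_le_one_right hr0.le hS')
  obtain ⟨y, y1, y2, yn⟩ := exists_inverse_one_sub n1 hζ1
  obtain ⟨y', y1', y2', yn'⟩ := exists_inverse_one_sub n2 hζ1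
  -- With $\mu/a=(1-\zeta)^2/\zeta$ and $SS'=1$ the operator factors into two Neumann-invertible
  -- pieces. The inverse has norm at most $|\zeta|/(a(1-|\zeta|)^2)$, which `quadratic_root_bound`
  -- turns into the sectorial bound.
  have hfac : μ • (1 : 𝔸) + (a : ℂ) • (2 - S - S')
      = ((a : ℂ) / ζ) • ((1 - ζ • S) * (1 - ζ • S')) := by
    have e : (1 - ζ • S) * (1 - ζ • S') = (1 + ζ ^ 2) • (1 : 𝔸) - ζ • S - ζ • S' := by
      rw [sub_mul, mul_sub, mul_sub, smul_mul_smul_comm, h₁]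
      simp only [one_mul, mul_one, add_smul, one_smul, pow_two]
      abel
    have hμe : μ = (a : ℂ) / ζ * (1 + ζ ^ 2) - 2 * a := by
      field_simp
      field_simp at hζ
      linear_combination hζ
    have h2 : (2 : 𝔸) = (2 : ℂ) • (1 : 𝔸) := by
      rw [two_smul]; norm_num
    rw [e, h2]
    conv_lhs => rw [hμe]
    simp only [smul_sub, smul_smul, sub_smul]
    rw [div_mul_cancel₀ _ hζ0, mul_comm (a : ℂ) 2]
    abel
  refine ⟨(ζ / a) • (y' * y), ?_, ?_, ?_⟩
  · rw [hfac, smul_mul_smul_comm, div_mul_div_cancel₀ hζ0, div_self haC, one_smul, mul_assoc,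
      ← mul_assoc _ y' y, y1', one_mul, y1]
  · rw [hfac, smul_mul_smul_comm, div_mul_div_cancel₀ haC, div_self hζ0, one_smul, mul_assoc,
      ← mul_assoc y _ _, y2, one_mul, y2']
  · have h1r : 0 < 1 - ‖ζ‖ := by linarith
    calc ‖(ζ / a) • (y' * y)‖ ≤ ‖ζ / a‖ * (‖y'‖ * ‖y‖) :=
          (norm_smul_le _ _).trans (by gcongr; exact norm_mul_le _ _)
      _ ≤ ‖ζ‖ / a * ((1 - ‖ζ‖)⁻¹ * (1 - ‖ζ‖)⁻¹) := by
          rw [norm_div, Complex.norm_real, Real.norm_of_nonneg ha.le]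
          gcongr
      _ ≤ 2 / (‖μ‖ + μ.re) := by
          rw [hnorm, hre, ← add_div] at hb
          rw [← mul_inv, ← div_eq_mul_inv, div_div, div_le_div_iff₀ (by positivity) hμ]
          have := mul_le_mul_of_nonneg_left hb ha.le
          have e : a * ((‖μ‖ + μ.re) / a * ‖ζ‖) = ‖ζ‖ * (‖μ‖ + μ.re) := by field_simp
          rw [e] at this
          linarith

/-! ### Solution operators with decay $n^{\alpha-1}$. -/

/-- Taylor coefficients of functions of order `(1-z)^(-1-α)` in the unit disc. -/
lemma norm_taylor_coeff_le {𝔸 : Type} [NormedRing 𝔸] [NormedAlgebra ℂ 𝔸] [CompleteSpace 𝔸]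
    {α B : ℝ} (hα₀ : 0 < α) {f : ℂ → 𝔸}
    (hf : DifferentiableOn ℂ f (Metric.ball 0 1))
    (hB : ∀ z : ℂ, ‖z‖ < 1 → ‖f z‖ ≤ B * ‖1 - z‖ ^ (-1 - α)) (n : ℕ) :
    ‖((n.factorial : ℂ))⁻¹ • iteratedDeriv n f 0‖
      ≤ B * (4 ^ (1 + α) * (2 / α)) * ((n : ℝ) + 2) ^ α := by
  have hB0 : 0 ≤ B := by
    have := (norm_nonneg _).trans (hB 0 (by simp))
    simpa using this
  -- Cauchy's formula on this radius has $1-\rho=1/(n+2)$, which produces the factor $(n+2)^\alpha$,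
  -- while $\rho^{-n}\le e\le3$. The $3$ is absorbed by $2\pi\ge6$.
  set ρ : ℝ := ((n : ℝ) + 1) / ((n : ℝ) + 2) with hρ
  have hn : (0 : ℝ) ≤ n := Nat.cast_nonneg n
  have hρ0 : 0 < ρ := by positivity
  have hρ2 : 1 / 2 ≤ ρ := by
    rw [hρ, div_le_div_iff₀ (by norm_num) (by positivity)]; linarith
  have hρ1 : ρ < 1 := by rw [hρ, div_lt_one (by positivity)]; linarith
  have h1ρ : 1 - ρ = ((n : ℝ) + 2)⁻¹ := by rw [hρ]; field_simp; ring
  have hcb : Metric.closedBall (0 : ℂ) ρ ⊆ Metric.ball 0 1 := Metric.closedBall_subset_ball hρ1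
  have hC := (hf.mono hcb).circleIntegral_one_div_sub_center_pow_smul hρ0 n
  have hpi := Real.pi_pos
  have hI : ‖∮ z in C(0, ρ), (1 / (z - 0) ^ (n + 1)) • f z‖
      ≤ (ρ ^ n)⁻¹ * B * (4 ^ (1 + α) * (2 / α) * (1 - ρ) ^ (-α)) := by
    have hci := integral_norm_one_sub_circleMap_le hα₀ hρ2 hρ1
    refine le_trans ?_ (mul_le_mul_of_nonneg_left hci (by positivity))
    rw [circleIntegral, ← intervalIntegral.integral_const_mul]
    have hne : ∀ θ, 0 < ‖1 - circleMap 0 ρ θ‖ := by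
      intro θ
      have h1 := norm_sub_norm_le (1 : ℂ) (circleMap 0 ρ θ)
      rw [norm_one, norm_circleMap_zero, abs_of_nonneg (by linarith)] at h1
      linarith
    refine intervalIntegral.norm_integral_le_of_norm_le (by linarith) ?_
      ((Continuous.intervalIntegrable (Continuous.rpow_const (by fun_prop)
        fun θ => Or.inl (hne θ).ne') _ _).const_mul _)
    refine Filter.Eventually.of_forall fun θ _ => ?_
    have h2 := hB (circleMap 0 ρ θ) (by rw [norm_circleMap_zero, abs_of_pos hρ0]; exact hρ1)
    rw [norm_smul, norm_smul, deriv_circleMap, norm_mul, Complex.norm_I, sub_zero, norm_div,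
      norm_pow, norm_circleMap_zero, abs_of_pos hρ0, norm_one, mul_one]
    calc ρ * (1 / ρ ^ (n + 1) * ‖f (circleMap 0 ρ θ)‖)
        = (ρ ^ n)⁻¹ * ‖f (circleMap 0 ρ θ)‖ := by rw [pow_succ]; field_simp
      _ ≤ (ρ ^ n)⁻¹ * (B * ‖1 - circleMap 0 ρ θ‖ ^ (-1 - α)) := by gcongr
      _ = _ := by ring
  rw [hC, norm_smul, norm_div, Complex.norm_natCast] at hI
  have h2pi : ‖(2 * Real.pi * Complex.I : ℂ)‖ = 2 * Real.pi := by
    simp [abs_of_pos hpi]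
  rw [h2pi] at hI
  have hpow : (ρ ^ n)⁻¹ ≤ 3 := by
    have h1 : ρ⁻¹ ≤ Real.exp (1 / ((n : ℝ) + 1)) := by
      have := Real.add_one_le_exp (1 / ((n : ℝ) + 1))
      refine le_trans (le_of_eq ?_) this
      rw [hρ]; field_simp; ring
    rw [← inv_pow]
    calc ρ⁻¹ ^ n ≤ Real.exp (1 / ((n : ℝ) + 1)) ^ n := by gcongr
      _ = Real.exp (n * (1 / ((n : ℝ) + 1))) := by rw [Real.exp_nat_mul]
      _ ≤ Real.exp 1 := by
          apply Real.exp_le_exp.2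
          rw [mul_one_div, div_le_one (by positivity)]; linarith
      _ ≤ 3 := by have := Real.exp_one_lt_d9; linarith
  have hpa : (1 - ρ) ^ (-α) = ((n : ℝ) + 2) ^ α := by
    rw [h1ρ, Real.inv_rpow (by positivity), Real.rpow_neg (by positivity), inv_inv]
  rw [hpa] at hI
  rw [norm_smul, norm_inv, Complex.norm_natCast]
  have h6 : (6 : ℝ) ≤ 2 * Real.pi := by have := Real.pi_gt_three; linarith
  set D := (n.factorial : ℝ)⁻¹ * ‖iteratedDeriv n f 0‖ with hD
  have hD0 : 0 ≤ D := by positivity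
  have hI' : 2 * Real.pi * D ≤ (ρ ^ n)⁻¹ * B * (4 ^ (1 + α) * (2 / α) * ((n : ℝ) + 2) ^ α) := by
    refine le_trans (le_of_eq ?_) hI
    rw [hD]; ring
  have h7 : (ρ ^ n)⁻¹ * B * (4 ^ (1 + α) * (2 / α) * ((n : ℝ) + 2) ^ α)
      ≤ 3 * (B * (4 ^ (1 + α) * (2 / α)) * ((n : ℝ) + 2) ^ α) := by
    calc _ = (ρ ^ n)⁻¹ * (B * (4 ^ (1 + α) * (2 / α)) * ((n : ℝ) + 2) ^ α) := by ring
      _ ≤ _ := by gcongr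
  nlinarith

/-- Solution operators of the time stepping scheme whose symbol is `symb α`, for an abstract second
difference operator `a (2 - S - S')`. -/
theorem exists_kernel {α : ℝ} (hα₀ : 0 < α) (hα₁ : α < 1) :
    ∃ C : ℝ, 0 < C ∧ ∀ (𝔸 : Type) [NormedRing 𝔸] [NormedAlgebra ℂ 𝔸] [CompleteSpace 𝔸]
      [NormOneClass 𝔸] (S S' : 𝔸) (a : ℝ), S * S' = 1 → ‖S‖ ≤ 1 → ‖S'‖ ≤ 1 → 0 < a →
      ∃ K : ℕ → 𝔸, (∀ n, ‖K n‖ ≤ C * ((n : ℝ) + 1) ^ (α - 1)) ∧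
        ∀ n, ∑ i ∈ Finset.range (n + 1),
          ((PowerSeries.coeff (n - i) (symbSeries α) : ℝ) : ℂ) • K i
            + K n * ((a : ℂ) • (2 - S - S')) = if n = 0 then 1 else 0 := by
  obtain ⟨c, hc0, hc⟩ := exists_symb_lower hα₀ hα₁
  obtain ⟨D, hD0, hD⟩ := exists_deriv_symb_le hα₀ hα₁
  set M := D * (2 / c) ^ 2 * (4 ^ (1 + α) * (2 / α)) with hM
  have hM0 : 0 < M := by positivity
  refine ⟨2 * M + 2 / c, by positivity, ?_⟩
  intro 𝔸 _ _ _ _ S S' a h₁ hS hS' ha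
  set A : 𝔸 := (a : ℂ) • (2 - S - S') with hA
  have hne1 : ∀ z : ℂ, ‖z‖ < 1 → z ≠ 1 := by rintro z hz rfl; simp at hz
  have hex : ∀ z : ℂ, ‖z‖ < 1 → ∃ Y : 𝔸, (symb α z • (1 : 𝔸) + A) * Y = 1 ∧
      Y * (symb α z • (1 : 𝔸) + A) = 1 ∧ ‖Y‖ ≤ 2 / c * ‖1 - z‖ ^ (-α) := by
    intro z hz
    have hd0 : 0 < ‖1 - z‖ := norm_pos_iff.2 (sub_ne_zero.2 (hne1 z hz).symm)
    have hlow := hc z hz.le (hne1 z hz)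
    have hp := Real.rpow_pos_of_pos hd0 α
    obtain ⟨Y, y1, y2, y3⟩ := exists_resolvent h₁ hS hS' ha
      (norm_symb_add_re_pos hα₀ hα₁ hz.le (hne1 z hz))
    refine ⟨Y, y1, y2, y3.trans ?_⟩
    calc 2 / (‖symb α z‖ + (symb α z).re) ≤ 2 / (c * ‖1 - z‖ ^ α) := by gcongr
      _ = _ := by rw [Real.rpow_neg hd0.le]; field_simp
  set F : ℂ → 𝔸 := fun z => Ring.inverse (symb α z • (1 : 𝔸) + A) with hF
  have hFY : ∀ z : ℂ, ‖z‖ < 1 → ∃ u : 𝔸ˣ, (u : 𝔸) = symb α z • (1 : 𝔸) + A ∧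
      F z = (↑u⁻¹ : 𝔸) ∧ ‖F z‖ ≤ 2 / c * ‖1 - z‖ ^ (-α) := by
    intro z hz
    obtain ⟨Y, y1, y2, y3⟩ := hex z hz
    have hFz : F z = Y := Ring.inverse_unit (⟨_, Y, y1, y2⟩ : 𝔸ˣ)
    exact ⟨⟨_, Y, y1, y2⟩, rfl, hFz, hFz ▸ y3⟩
  have hFder : ∀ z : ℂ, ‖z‖ < 1 → HasDerivAt F (-(F z * (deriv (symb α) z • (1 : 𝔸)) * F z)) z := by
    intro z hz
    obtain ⟨u, hu, hFu, -⟩ := hFY z hz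
    have h1 : HasDerivAt (fun z => symb α z • (1 : 𝔸) + A) (deriv (symb α) z • (1 : 𝔸)) z :=
      ((differentiableAt_symb hα₀ hα₁ hz).hasDerivAt.smul_const 1).add_const A
    have h2 := hasFDerivAt_ringInverse (𝕜 := ℂ) u
    rw [hu] at h2
    have h3 := h2.comp_hasDerivAt z h1
    refine h3.congr_deriv ?_
    rw [hFu]
    simp
  have hFdiff : DifferentiableOn ℂ F (Metric.ball 0 1) := fun z hz =>
    (hFder z (by simpa using hz)).differentiableAt.differentiableWithinAt
  have hF'diff : DifferentiableOn ℂ (deriv F) (Metric.ball 0 1) :=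
    hFdiff.deriv Metric.isOpen_ball
  -- The derivative is estimated instead of $F$: the bound $|1-z|^{-\alpha}$ for $F$ is integrable
  -- on the circle and would only give bounded coefficients. The order $-1-\alpha$ for $F'=-F\mu'F$,
  -- with $\mu$ the symbol, gives $n^\alpha$ for its coefficients, hence $n^{\alpha-1}$ for those of
  -- $F$.
  have hF'b : ∀ z : ℂ, ‖z‖ < 1 → ‖deriv F z‖ ≤ D * (2 / c) ^ 2 * ‖1 - z‖ ^ (-1 - α) := by
    intro z hz
    have hd0 : 0 < ‖1 - z‖ := norm_pos_iff.2 (sub_ne_zero.2 (hne1 z hz).symm)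
    obtain ⟨-, -, -, hn⟩ := hFY z hz
    rw [(hFder z hz).deriv, norm_neg]
    have hq := hD z hz
    have e : ‖1 - z‖ ^ (-1 - α) = ‖1 - z‖ ^ (-α) * ‖1 - z‖ ^ (α - 1) * ‖1 - z‖ ^ (-α) := by
      rw [← Real.rpow_add hd0, ← Real.rpow_add hd0]; congr 1; ring
    calc ‖F z * (deriv (symb α) z • (1 : 𝔸)) * F z‖
        ≤ ‖F z‖ * ‖deriv (symb α) z‖ * ‖F z‖ := by
          refine (norm_mul_le _ _).trans ?_
          gcongr
          refine (norm_mul_le _ _).trans ?_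
          gcongr
          rw [norm_smul, norm_one, mul_one]
      _ ≤ (2 / c * ‖1 - z‖ ^ (-α)) * (D * ‖1 - z‖ ^ (α - 1)) * (2 / c * ‖1 - z‖ ^ (-α)) := by
          gcongr
      _ = _ := by rw [e]; ring
  refine ⟨fun n => ((n.factorial : ℂ))⁻¹ • iteratedDeriv n F 0, ?_, ?_⟩
  · intro n
    cases n with
    | zero =>
      simp only [Nat.factorial_zero, Nat.cast_one, inv_one, iteratedDeriv_zero, one_smul,
        Nat.cast_zero, zero_add, Real.one_rpow, mul_one]
      obtain ⟨-, -, -, hn⟩ := hFY 0 (by simp)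
      simp only [sub_zero, norm_one, Real.one_rpow, mul_one] at hn
      linarith
    | succ n =>
      have h := norm_taylor_coeff_le hα₀ hF'diff hF'b n
      have e : (((n + 1).factorial : ℂ))⁻¹ • iteratedDeriv (n + 1) F 0
          = ((n : ℂ) + 1)⁻¹ • (((n.factorial : ℂ))⁻¹ • iteratedDeriv n (deriv F) 0) := by
        rw [iteratedDeriv_succ', Nat.factorial_succ, smul_smul]
        push_cast
        rw [mul_inv]
      have hn1 : ‖((n : ℂ) + 1)⁻¹‖ = ((n : ℝ) + 1)⁻¹ := by
        rw [norm_inv]; norm_cast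
      have hn2 : (0 : ℝ) < (n : ℝ) + 2 := by positivity
      have hp : 0 < ((n : ℝ) + 2) ^ (α - 1) := by positivity
      simp only
      rw [e, norm_smul, hn1]
      calc ((n : ℝ) + 1)⁻¹ * ‖((n.factorial : ℂ))⁻¹ • iteratedDeriv n (deriv F) 0‖
          ≤ ((n : ℝ) + 1)⁻¹ * (M * ((n : ℝ) + 2) ^ α) := by
            gcongr
        _ = M * (((n : ℝ) + 2) / ((n : ℝ) + 1)) * ((n : ℝ) + 2) ^ (α - 1) := by
            rw [Real.rpow_sub_one hn2.ne']; field_simp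
        _ ≤ M * 2 * ((n : ℝ) + 2) ^ (α - 1) := by
            have : ((n : ℝ) + 2) / ((n : ℝ) + 1) ≤ 2 := by
              rw [div_le_iff₀ (by positivity)]
              have : (0 : ℝ) ≤ n := Nat.cast_nonneg n
              linarith
            gcongr
        _ ≤ (2 * M + 2 / c) * (((n + 1 : ℕ) : ℝ) + 1) ^ (α - 1) := by
            push_cast
            rw [show (n : ℝ) + 1 + 1 = n + 2 by ring]
            have : 0 < 2 / c := by positivity
            gcongr
            linarith
  · intro n
    have h0 : (0 : ℂ) ∈ Metric.ball (0 : ℂ) 1 := by simp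
    have hcF : ContDiffAt ℂ n F 0 :=
      (hFdiff.contDiffOn Metric.isOpen_ball).contDiffAt (Metric.ball_mem_nhds 0 one_pos)
    have hsd : DifferentiableOn ℂ (symb α) (Metric.ball 0 1) := fun z hz =>
      (differentiableAt_symb hα₀ hα₁ (by simpa using hz)).differentiableWithinAt
    have hcs : ∀ m : ℕ, ContDiffAt ℂ m (symb α) 0 := fun m =>
      (hsd.contDiffOn Metric.isOpen_ball).contDiffAt (Metric.ball_mem_nhds 0 one_pos)
    have hcs1 : ContDiffAt ℂ n (fun z => symb α z • (1 : 𝔸)) 0 :=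
      (hcs n).smul contDiffAt_const
    -- The convolution identity is the $n$-th Taylor coefficient at $0$ of $F(z)(\mu(z)+A)=1$, with
    -- $\mu$ the symbol, expanded by Leibniz' rule.
    have hid : (fun z => F z * (symb α z • (1 : 𝔸)) + F z * A) =ᶠ[nhds 0] fun _ => 1 := by
      filter_upwards [Metric.ball_mem_nhds (0 : ℂ) one_pos] with z hz
      obtain ⟨u, hu, hFu, -⟩ := hFY z (by simpa using hz)
      rw [← mul_add, ← hu, hFu, Units.inv_mul]
    have hder := hid.iteratedDeriv_eq n
    have hmul : iteratedDeriv n (fun z => F z * (symb α z • (1 : 𝔸))) 0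
        = ∑ i ∈ Finset.range (n + 1), (n.choose i : 𝔸) * iteratedDeriv i F 0
          * iteratedDeriv (n - i) (fun z => symb α z • (1 : 𝔸)) 0 :=
      iteratedDeriv_mul hcF hcs1
    have hmulA : iteratedDeriv n (fun z => F z * A) 0 = iteratedDeriv n F 0 * A :=
      iteratedDeriv_smul_const hcF A
    have hs : ∀ m, iteratedDeriv m (fun z => symb α z • (1 : 𝔸)) 0
        = ((m.factorial : ℂ) * ((PowerSeries.coeff m (symbSeries α) : ℝ) : ℂ)) • (1 : 𝔸) := by
      intro m
      rw [iteratedDeriv_smul_const (hcs m),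
        iteratedDeriv_eq_of_hasSum (fun z hz => sumsTo_symbSeries hα₀ hα₁ hz) m]
    have hadd : iteratedDeriv n (fun z => F z * (symb α z • (1 : 𝔸)) + F z * A) 0
        = iteratedDeriv n (fun z => F z * (symb α z • (1 : 𝔸))) 0
          + iteratedDeriv n (fun z => F z * A) 0 :=
      iteratedDeriv_fun_add (hcF.mul hcs1) (hcF.mul contDiffAt_const)
    rw [hadd, hmul, hmulA, iteratedDeriv_const] at hder
    have hn0 : (n.factorial : ℂ) ≠ 0 := Nat.cast_ne_zero.2 (Nat.factorial_ne_zero n)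
    have hder' := congrArg (fun x => ((n.factorial : ℂ))⁻¹ • x) hder
    simp only [smul_add, Finset.smul_sum] at hder'
    rw [show ((n.factorial : ℂ))⁻¹ • (if n = 0 then (1 : 𝔸) else 0) = if n = 0 then 1 else 0 by
      split_ifs with h
      · subst h; simp
      · simp] at hder'
    rw [← hder']
    congr 1
    · apply Finset.sum_congr rfl
      intro i hi
      have hin : i ≤ n := Nat.lt_succ_iff.1 (Finset.mem_range.1 hi)
      have hi0 : (i.factorial : ℂ) ≠ 0 := Nat.cast_ne_zero.2 (Nat.factorial_ne_zero i)
      have hch : (n.choose i : ℂ) * i.factorial * (n - i).factorial = n.factorial := by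
        exact_mod_cast Nat.choose_mul_factorial_mul_factorial hin
      have hnc : ∀ x : 𝔸, (n.choose i : 𝔸) * x = (n.choose i : ℂ) • x := fun x => by
        rw [Nat.cast_smul_eq_nsmul ℂ, nsmul_eq_mul]
      rw [hs, mul_smul_comm, mul_one, hnc, smul_smul, smul_smul, smul_smul]
      congr 1
      rw [← hch] at hn0 ⊢
      have h1 := left_ne_zero_of_mul hn0
      have h2 := right_ne_zero_of_mul hn0
      have h3 := left_ne_zero_of_mul h1
      field_simp
    · rw [smul_mul_assoc]

/-! ### Stability on bounded sequences over the integers. -/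

open BoundedContinuousFunction

/-- The translation `f ↦ f (· + k)` on bounded complex sequences. -/
def shiftCLM (k : ℤ) : (ℤ →ᵇ ℂ) →L[ℂ] (ℤ →ᵇ ℂ) :=
  LinearMap.mkContinuous
    { toFun := fun f => f.compContinuous ⟨fun i => i + k, continuous_of_discreteTopology⟩
      map_add' := fun _ _ => rfl
      map_smul' := fun _ _ => rfl } 1 (fun f => by
        rw [one_mul]
        exact (BoundedContinuousFunction.norm_le (norm_nonneg f)).2
          fun i => f.norm_coe_le_norm (i + k))

lemma shiftCLM_apply (k : ℤ) (f : ℤ →ᵇ ℂ) (i : ℤ) : shiftCLM k f i = f (i + k) := rfl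

lemma norm_shiftCLM_le (k : ℤ) : ‖shiftCLM k‖ ≤ 1 := LinearMap.mkContinuous_norm_le _ zero_le_one _

lemma shiftCLM_mul : shiftCLM 1 * shiftCLM (-1) = 1 := by
  ext f i
  change f (i + 1 + -1) = f i
  rw [add_neg_cancel_right]

lemma sum_range_sum_range_swap {M : Type*} [AddCommMonoid M] (f : ℕ → ℕ → M) (n : ℕ) :
    ∑ m ∈ Finset.range (n + 1), ∑ l ∈ Finset.range (m + 1), f m l
      = ∑ l ∈ Finset.range (n + 1), ∑ i ∈ Finset.range (n - l + 1), f (n - i) l := by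
  rw [Finset.sum_sigma', Finset.sum_sigma']
  refine Finset.sum_bij' (fun p _ => ⟨p.2, n - p.1⟩) (fun p _ => ⟨n - p.2, p.1⟩) ?_ ?_ ?_ ?_ ?_
  · rintro ⟨m, l⟩ h
    simp only [Finset.mem_sigma, Finset.mem_range] at h ⊢
    omega
  · rintro ⟨l, i⟩ h
    simp only [Finset.mem_sigma, Finset.mem_range] at h ⊢
    omega
  · rintro ⟨m, l⟩ h
    simp only [Finset.mem_sigma, Finset.mem_range] at h
    simp only [Sigma.mk.injEq, heq_eq_eq, and_true]
    omega
  · rintro ⟨l, i⟩ h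
    simp only [Finset.mem_sigma, Finset.mem_range] at h
    simp only [Sigma.mk.injEq, heq_eq_eq, true_and]
    omega
  · rintro ⟨m, l⟩ h
    simp only [Finset.mem_sigma, Finset.mem_range] at h
    simp only
    congr 1
    omega

/-- Maximum norm stability of the time stepping scheme on bounded sequences. -/
theorem exists_stability {α : ℝ} (hα₀ : 0 < α) (hα₁ : α < 1) :
    ∃ C : ℝ, 0 < C ∧ ∀ (a : ℝ), 0 < a → ∀ (E : ℕ → (ℤ →ᵇ ℂ)) (ρ : ℕ → ℝ) (n : ℕ),
      (∀ m ≤ n, ‖∑ l ∈ Finset.range (m + 1),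
          ((PowerSeries.coeff (m - l) (symbSeries α) : ℝ) : ℂ) • E l
          + (a : ℂ) • (2 * E m - shiftCLM 1 (E m) - shiftCLM (-1) (E m))‖ ≤ ρ m) →
      ‖E n‖ ≤ ∑ m ∈ Finset.range (n + 1), C * (((n - m : ℕ) : ℝ) + 1) ^ (α - 1) * ρ m := by
  obtain ⟨C, hC0, hC⟩ := exists_kernel hα₀ hα₁
  refine ⟨C, hC0, fun a ha E ρ n hρ => ?_⟩
  -- The identity operator has norm one only on a nontrivial space.
  have : Nontrivial (ℤ →ᵇ ℂ) := ⟨0, 1, fun h => by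
    have := congrArg (fun f : ℤ →ᵇ ℂ => f 0) h
    simp at this⟩
  obtain ⟨K, hK, hKid⟩ := hC ((ℤ →ᵇ ℂ) →L[ℂ] (ℤ →ᵇ ℂ)) (shiftCLM 1) (shiftCLM (-1)) a
    shiftCLM_mul (norm_shiftCLM_le _) (norm_shiftCLM_le _) ha
  set A : (ℤ →ᵇ ℂ) →L[ℂ] (ℤ →ᵇ ℂ) := (a : ℂ) • (2 - shiftCLM 1 - shiftCLM (-1)) with hA
  set q : ℕ → ℂ := fun m => ((PowerSeries.coeff m (symbSeries α) : ℝ) : ℂ) with hq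
  have hAE : ∀ m, A (E m) = (a : ℂ) • (2 * E m - shiftCLM 1 (E m) - shiftCLM (-1) (E m)) := by
    intro m
    rw [hA]
    ext i
    simp [ContinuousLinearMap.ofNat_apply]
  set R : ℕ → (ℤ →ᵇ ℂ) := fun m => ∑ l ∈ Finset.range (m + 1), q (m - l) • E l + A (E m) with hR
  -- Discrete variation of constants: convolving the residuals with the solution operators and
  -- exchanging the sums leaves only $l=n$, by the identity satisfied by $K$.
  have hrep : E n = ∑ m ∈ Finset.range (n + 1), K (n - m) (R m) := by
    have h1 : ∑ m ∈ Finset.range (n + 1), K (n - m) (R m)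
        = ∑ l ∈ Finset.range (n + 1), (∑ i ∈ Finset.range (n - l + 1), q (n - l - i) • K i
          + K (n - l) * A) (E l) := by
      simp only [hR, map_add, map_sum, map_smul, Finset.sum_add_distrib]
      rw [sum_range_sum_range_swap (fun m l => q (m - l) • K (n - m) (E l))]
      simp only [_root_.add_apply, Finset.sum_add_distrib]
      congr 1
      apply Finset.sum_congr rfl
      intro l hl
      rw [_root_.sum_apply]
      apply Finset.sum_congr rfl
      intro i hi
      rw [Finset.mem_range] at hl hi
      rw [_root_.smul_apply, show n - i - l = n - l - i by omega,
        show n - (n - i) = i by omega]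
    rw [h1, Finset.sum_eq_single_of_mem n (by simp)]
    · rw [hKid, if_pos (Nat.sub_self n)]; rfl
    · intro l hl hln
      rw [Finset.mem_range] at hl
      rw [hKid, if_neg (by omega)]; rfl
  rw [hrep]
  refine (norm_sum_le _ _).trans (Finset.sum_le_sum fun m hm => ?_)
  have hmn : m ≤ n := Nat.lt_succ_iff.1 (Finset.mem_range.1 hm)
  have hRm : ‖R m‖ ≤ ρ m := by
    have := hρ m hmn
    rw [← hAE] at this
    exact this
  refine ((K (n - m)).le_opNorm (R m)).trans ?_
  have := (norm_nonneg _).trans (hK (n - m))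
  exact mul_le_mul (hK _) hRm (norm_nonneg _) this

/-! ### Reduction of the Dirichlet problem to the integers. -/

/-- The odd extension of a mesh function on `0, …, K`, periodic with period `2K`. -/
def oddExt (K : ℕ) (w : ℕ → ℝ) (i : ℤ) : ℝ :=
  if (i % (2 * K)).toNat ≤ K then w (i % (2 * K)).toNat else -w (2 * K - (i % (2 * K)).toNat)

lemma abs_oddExt_le {K : ℕ} {w : ℕ → ℝ} {B : ℝ} (hw : ∀ j ≤ K, |w j| ≤ B) (i : ℤ) :
    |oddExt K w i| ≤ B := by
  unfold oddExt
  split_ifs with h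
  · exact hw _ h
  · rw [abs_neg]; exact hw _ (by omega)

lemma oddExt_natCast {K : ℕ} (hK : 1 ≤ K) (w : ℕ → ℝ) {j : ℕ} (hj : j ≤ K) :
    oddExt K w j = w j := by
  have h : ((j : ℤ) % (2 * K)) = j := Int.emod_eq_of_lt (by omega) (by omega)
  unfold oddExt
  rw [h, Int.toNat_natCast, if_pos hj]

/-- Negative second difference, vanishing at the end points. -/
def negDiff (K : ℕ) (w : ℕ → ℝ) (j : ℕ) : ℝ :=
  if 1 ≤ j ∧ j + 1 ≤ K then 2 * w j - w (j + 1) - w (j - 1) else 0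

/-- Checked by cases on the residue $r$ of $i$ modulo $2K$. At $r=0$ and $r=K$ the extension is odd
about the node, so its second difference vanishes, in agreement with the value zero of `negDiff` at
the end points. On $K<r<2K$ the reflection exchanges the two neighbours. For $K=1$ every value is
zero. -/
lemma oddExt_negDiff {K : ℕ} (hK : 1 ≤ K) {w : ℕ → ℝ} (h0 : w 0 = 0) (hw : w K = 0) (i : ℤ) :
    2 * oddExt K w i - oddExt K w (i + 1) - oddExt K w (i + -1) = oddExt K (negDiff K w) i := by
  obtain ⟨r, hr⟩ : ∃ r : ℕ, i % (2 * K) = r := ⟨(i % (2 * K)).toNat,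
    (Int.toNat_of_nonneg (Int.emod_nonneg _ (by omega))).symm⟩
  have hr2 : r < 2 * K := by
    have := Int.emod_lt_of_pos i (by omega : (0 : ℤ) < 2 * K)
    omega
  have hi : i = r + 2 * K * (i / (2 * K)) := by
    have := Int.emod_add_mul_ediv i (2 * K)
    rw [hr] at this
    exact this.symm
  have hmod : ∀ (s : ℕ) (k q : ℤ), s < 2 * K → k = s + 2 * K * q → k % (2 * K) = s := by
    intro s k q hs hk
    rw [hk, Int.add_mul_emod_self_left]
    exact Int.emod_eq_of_lt (by omega) (by omega)
  unfold oddExt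
  rw [hr]
  rcases Nat.eq_zero_or_pos r with h | h
  · rw [hmod (2 * K - 1) (i + -1) (i / (2 * K) - 1) (by omega) (by
        conv_lhs => rw [hi]
        rw [h, mul_sub]; push_cast [show 1 ≤ 2 * K by omega]; ring)]
    rcases Nat.lt_or_ge 1 (2 * K) with h2 | h2
    · rw [hmod 1 (i + 1) (i / (2 * K)) h2 (by conv_lhs => rw [hi]
                                              rw [h]; push_cast; ring)]
      simp only [Int.toNat_natCast, h, negDiff]
      rcases Nat.lt_or_ge 1 K with h3 | h3
      · rw [if_pos (by omega), if_pos (by omega), if_neg (by omega), if_pos (by omega),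
          if_neg (by omega), show 2 * K - (2 * K - 1) = 1 by omega, h0]
        ring
      · have hK1 : K = 1 := by omega
        subst hK1
        simp [h0, hw]
    · omega
  · rw [hmod (r - 1) (i + -1) (i / (2 * K)) (by omega) (by
        conv_lhs => rw [hi]
        push_cast [h]; ring)]
    rcases Nat.lt_or_ge (r + 1) (2 * K) with h2 | h2
    · rw [hmod (r + 1) (i + 1) (i / (2 * K)) h2 (by conv_lhs => rw [hi]
                                                    push_cast; ring)]
      simp only [Int.toNat_natCast, negDiff]
      rcases lt_trichotomy r K with h3 | h3 | h3
      · rw [if_pos (by omega), if_pos (by omega), if_pos (by omega), if_pos (by omega),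
          if_pos (by omega)]
      · rw [if_pos (by omega), if_neg (by omega), if_pos (by omega), if_pos (by omega),
          if_neg (by omega), h3, show 2 * K - (K + 1) = K - 1 by omega, hw]
        ring
      · rcases Nat.lt_or_ge (K + 1) r with h4 | h4
        · rw [if_neg (by omega), if_neg (by omega), if_neg (by omega), if_neg (by omega),
            if_pos (by omega),
            show 2 * K - (r + 1) = 2 * K - r - 1 by omega,
            show 2 * K - (r - 1) = 2 * K - r + 1 by omega]
          ring
        · rw [if_neg (by omega), if_neg (by omega), if_pos (by omega), if_neg (by omega),
            if_pos (by omega), show 2 * K - (r + 1) = 2 * K - r - 1 by omega, show r - 1 = K by omega,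
            show 2 * K - r + 1 = K by omega, hw]
          ring
    · have hrK : r = 2 * K - 1 := by omega
      rw [hmod 0 (i + 1) (i / (2 * K) + 1) (by omega) (by
        conv_lhs => rw [hi]
        rw [hrK, mul_add]; push_cast [show 1 ≤ 2 * K by omega]; ring)]
      simp only [Int.toNat_natCast, negDiff]
      rcases Nat.lt_or_ge 1 K with h3 | h3
      · rcases Nat.lt_or_ge (K + 1) r with h4 | h4
        · rw [if_neg (by omega), if_pos (by omega), if_neg (by omega), if_neg (by omega),
            if_pos (by omega), h0, show 2 * K - r - 1 = 0 by omega, h0, show 2 * K - (r - 1) = 2 * K - r + 1 by omega]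
          ring
        · rw [if_neg (by omega), if_pos (by omega), if_pos (by omega), if_neg (by omega),
            if_pos (by omega), h0, show 2 * K - r - 1 = 0 by omega, h0, show r - 1 = K by omega,
            show 2 * K - r + 1 = K by omega, hw]
          ring
      · have hK1 : K = 1 := by omega
        subst hK1
        have hr1 : r = 1 := by omega
        subst hr1
        simp [h0, hw]

lemma oddExt_add (K : ℕ) (w w' : ℕ → ℝ) (i : ℤ) :
    oddExt K (fun j => w j + w' j) i = oddExt K w i + oddExt K w' i := by
  unfold oddExt; split_ifs <;> ring

lemma oddExt_const_mul (K : ℕ) (c : ℝ) (w : ℕ → ℝ) (i : ℤ) :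
    oddExt K (fun j => c * w j) i = c * oddExt K w i := by
  unfold oddExt; split_ifs <;> ring

lemma oddExt_sum (K : ℕ) (s : Finset ℕ) (w : ℕ → ℕ → ℝ) (i : ℤ) :
    oddExt K (fun j => ∑ l ∈ s, w l j) i = ∑ l ∈ s, oddExt K (w l) i := by
  unfold oddExt; split_ifs <;> simp

/-- Maximum norm stability of the fully discrete scheme with homogeneous boundary values. -/
theorem exists_mesh_stability {α : ℝ} (hα₀ : 0 < α) (hα₁ : α < 1) :
    ∃ C : ℝ, 0 < C ∧ ∀ (a : ℝ) (K : ℕ), 0 < a → 1 ≤ K → ∀ (e : ℕ → ℕ → ℝ) (ρ : ℕ → ℝ) (n : ℕ),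
      (∀ m ≤ n, e m 0 = 0 ∧ e m K = 0) → (∀ m ≤ n, 0 ≤ ρ m) →
      (∀ m ≤ n, ∀ i, 1 ≤ i → i + 1 ≤ K →
        |∑ l ∈ Finset.range (m + 1), PowerSeries.coeff (m - l) (symbSeries α) * e l i
          + a * (2 * e m i - e m (i + 1) - e m (i - 1))| ≤ ρ m) →
      ∀ i ≤ K, |e n i|
        ≤ ∑ m ∈ Finset.range (n + 1), C * (((n - m : ℕ) : ℝ) + 1) ^ (α - 1) * ρ m := by
  obtain ⟨C, hC0, hC⟩ := exists_stability hα₀ hα₁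
  refine ⟨C, hC0, fun a K ha hK e ρ n hbd hρ0 hρ i hi => ?_⟩
  have hbound : ∀ m, ∀ j ≤ K, |e m j| ≤ ∑ k ∈ Finset.range (K + 1), |e m k| := fun m j hj =>
    Finset.single_le_sum (f := fun k => |e m k|) (fun _ _ => abs_nonneg _)
      (Finset.mem_range.2 (by omega))
  set E : ℕ → (ℤ →ᵇ ℂ) := fun m => BoundedContinuousFunction.ofNormedAddCommGroupDiscrete
    (fun i => (oddExt K (e m) i : ℂ)) (∑ k ∈ Finset.range (K + 1), |e m k|) (fun i => by
      rw [Complex.norm_real]; exact abs_oddExt_le (hbound m) i) with hE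
  have hEi : ∀ m (i : ℤ), E m i = (oddExt K (e m) i : ℂ) := fun _ _ => rfl
  have h := hC a ha E ρ n (fun m hm => by
    rw [BoundedContinuousFunction.norm_le (hρ0 m hm)]
    intro k
    have hval : (∑ l ∈ Finset.range (m + 1),
          ((PowerSeries.coeff (m - l) (symbSeries α) : ℝ) : ℂ) • E l
          + (a : ℂ) • (2 * E m - shiftCLM 1 (E m) - shiftCLM (-1) (E m))) k
        = ((oddExt K (fun j => ∑ l ∈ Finset.range (m + 1),
          PowerSeries.coeff (m - l) (symbSeries α) * e l j + a * negDiff K (e m) j) k : ℝ) : ℂ) := by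
      rw [oddExt_add, oddExt_sum, oddExt_const_mul, ← oddExt_negDiff hK (hbd m hm).1 (hbd m hm).2]
      simp only [oddExt_const_mul]
      rw [BoundedContinuousFunction.add_apply, BoundedContinuousFunction.sum_apply]
      simp only [BoundedContinuousFunction.smul_apply, BoundedContinuousFunction.sub_apply,
        BoundedContinuousFunction.mul_apply, shiftCLM_apply, hEi, smul_eq_mul]
      push_cast
      rfl
    rw [hval, Complex.norm_real]
    refine abs_oddExt_le (fun j hj => ?_) k
    by_cases hj2 : 1 ≤ j ∧ j + 1 ≤ K
    · rw [negDiff, if_pos hj2]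
      exact hρ m hm j hj2.1 hj2.2
    -- At an end point the residual vanishes identically, so the bound assumed only at interior
    -- nodes extends to all nodes.
    · have hz : ∀ l ≤ n, e l j = 0 := by
        intro l hl
        rcases Nat.eq_zero_or_pos j with h | h
        · rw [h]; exact (hbd l hl).1
        · rw [show j = K by omega]; exact (hbd l hl).2
      rw [negDiff, if_neg hj2, Finset.sum_eq_zero]
      · simpa using hρ0 m hm
      · intro l hl
        rw [hz l (by have := Finset.mem_range.1 hl; omega), mul_zero])
  refine le_trans ?_ h
  have h2 := (E n).norm_coe_le_norm i
  rwa [hEi, Complex.norm_real, oddExt_natCast hK _ hi] at h2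

/-! ### Closed form of the moments and of the weights of the scheme. -/

lemma integral_rpow_mul_pow {α : ℝ} (hα₁ : α < 1) (m j : ℕ) :
    ∫ σ in (0 : ℝ)..1, ((m : ℝ) + σ) ^ (-α) * ((m : ℝ) + σ) ^ j
      = (((m : ℝ) + 1) ^ j * ((m : ℝ) + 1) ^ (1 - α) - (m : ℝ) ^ j * (m : ℝ) ^ (1 - α))
        / (j + 1 - α) := by
  have hm : (0 : ℝ) ≤ m := Nat.cast_nonneg m
  have hj : (0 : ℝ) ≤ j := Nat.cast_nonneg j
  have hpow : ∀ x : ℝ, 0 ≤ x → x ^ ((j : ℝ) - α + 1) = x ^ j * x ^ (1 - α) := by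
    intro x hx
    rcases hx.eq_or_lt with rfl | hx
    · rw [Real.zero_rpow (by linarith), Real.zero_rpow (by linarith), mul_zero]
    · rw [← Real.rpow_natCast, ← Real.rpow_add hx]; congr 1; ring
  rw [intervalIntegral.integral_comp_add_left (fun x : ℝ => x ^ (-α) * x ^ j), add_zero]
  have h : ∫ x in (m : ℝ)..m + 1, x ^ (-α) * x ^ j = ∫ x in (m : ℝ)..m + 1, x ^ ((j : ℝ) - α) := by
    rw [intervalIntegral.integral_of_le (by linarith), intervalIntegral.integral_of_le (by linarith)]
    apply setIntegral_congr_fun measurableSet_Ioc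
    intro x hx
    have hx0 : 0 < x := hm.trans_lt hx.1
    simp only
    rw [← Real.rpow_natCast, ← Real.rpow_add hx0]
    congr 1; ring
  rw [h, integral_rpow (Or.inl (by linarith)), hpow _ (by linarith), hpow _ hm]
  congr 1; ring

lemma intervalIntegrable_rpow_add_mul {α : ℝ} (hα₁ : α < 1) (m : ℕ) {g : ℝ → ℝ}
    (hg : Continuous g) :
    IntervalIntegrable (fun σ : ℝ => ((m : ℝ) + σ) ^ (-α) * g σ) volume 0 1 := by
  apply IntervalIntegrable.mul_continuousOn _ hg.continuousOn
  have h : IntervalIntegrable (fun x : ℝ => x ^ (-α)) volume m (m + 1) :=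
    intervalIntegral.intervalIntegrable_rpow' (by linarith)
  simpa using h.comp_add_left (m : ℝ)

/-- Closed form of the moments of a quadratic polynomial written in powers of `m + σ`. -/
lemma mom_eq {α : ℝ} (hα₁ : α < 1) (m : ℕ) (k : ℝ → ℝ) (c₀ c₁ c₂ : ℝ)
    (hk : ∀ σ, k σ = c₀ + c₁ * (m + σ) + c₂ * (m + σ) ^ 2) :
    mom α k m = c₀ * ((((m : ℝ) + 1) ^ (1 - α) - (m : ℝ) ^ (1 - α)) / (1 - α))
      + c₁ * ((((m : ℝ) + 1) * ((m : ℝ) + 1) ^ (1 - α) - m * (m : ℝ) ^ (1 - α)) / (2 - α))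
      + c₂ * ((((m : ℝ) + 1) ^ 2 * ((m : ℝ) + 1) ^ (1 - α) - (m : ℝ) ^ 2 * (m : ℝ) ^ (1 - α))
        / (3 - α)) := by
  have h0 := integral_rpow_mul_pow hα₁ m 0
  have h1 := integral_rpow_mul_pow hα₁ m 1
  have h2 := integral_rpow_mul_pow hα₁ m 2
  have e : ∀ σ, ((m : ℝ) + σ) ^ (-α) * k σ = c₀ * (((m : ℝ) + σ) ^ (-α) * ((m : ℝ) + σ) ^ 0)
      + c₁ * (((m : ℝ) + σ) ^ (-α) * ((m : ℝ) + σ) ^ 1)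
      + c₂ * (((m : ℝ) + σ) ^ (-α) * ((m : ℝ) + σ) ^ 2) := by
    intro σ; rw [hk]; ring
  unfold mom
  simp_rw [e]
  rw [intervalIntegral.integral_add, intervalIntegral.integral_add,
    intervalIntegral.integral_const_mul, intervalIntegral.integral_const_mul,
    intervalIntegral.integral_const_mul, h0, h1, h2]
  · push_cast; ring_nf
  · exact (intervalIntegrable_rpow_add_mul hα₁ m (by fun_prop)).const_mul _
  · exact (intervalIntegrable_rpow_add_mul hα₁ m (by fun_prop)).const_mul _
  · exact ((intervalIntegrable_rpow_add_mul hα₁ m (by fun_prop)).const_mul _).add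
      ((intervalIntegrable_rpow_add_mul hα₁ m (by fun_prop)).const_mul _)
  · exact (intervalIntegrable_rpow_add_mul hα₁ m (by fun_prop)).const_mul _

lemma mom_ker₁_eq {α : ℝ} (hα₁ : α < 1) (m : ℕ) :
    mom α ker₁ m = (((m : ℝ) + 1) ^ (1 - α) - (m : ℝ) ^ (1 - α)) / (1 - α) := by
  rw [mom_eq hα₁ m ker₁ 1 0 0 (by intro σ; unfold ker₁; ring)]; ring

lemma mom_ker₂_eq {α : ℝ} (hα₁ : α < 1) (m : ℕ) :
    mom α ker₂ m = (1 / 2 + m) * ((((m : ℝ) + 1) ^ (1 - α) - (m : ℝ) ^ (1 - α)) / (1 - α))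
      - (((m : ℝ) + 1) * ((m : ℝ) + 1) ^ (1 - α) - m * (m : ℝ) ^ (1 - α)) / (2 - α) := by
  rw [mom_eq hα₁ m ker₂ (1 / 2 + m) (-1) 0 (by intro σ; unfold ker₂; ring)]; ring

lemma mom_ker₃_eq {α : ℝ} (hα₁ : α < 1) (m : ℕ) :
    mom α ker₃ m = (3 * m ^ 2 + 6 * m + 2) / 6
        * ((((m : ℝ) + 1) ^ (1 - α) - (m : ℝ) ^ (1 - α)) / (1 - α))
      - (m + 1) * ((((m : ℝ) + 1) * ((m : ℝ) + 1) ^ (1 - α) - m * (m : ℝ) ^ (1 - α)) / (2 - α))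
      + 1 / 2 * ((((m : ℝ) + 1) ^ 2 * ((m : ℝ) + 1) ^ (1 - α)
        - (m : ℝ) ^ 2 * (m : ℝ) ^ (1 - α)) / (3 - α)) := by
  rw [mom_eq hα₁ m ker₃ ((3 * m ^ 2 + 6 * m + 2) / 6) (-(m + 1)) (1 / 2)
    (by intro σ; unfold ker₃; ring)]
  ring

/-- The contribution of the interval `[t_{k-1},t_k]` to the discrete Caputo derivative. -/
def capTerm (α : ℝ) (v : ℕ → ℝ) (n k : ℕ) : ℝ :=
  mom α ker₁ (n - k) * (v k - v (k - 1))
  + (if 2 ≤ k then mom α ker₂ (n - k) * (v k - 2 * v (k - 1) + v (k - 2)) else 0)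
  + (if 3 ≤ k then mom α ker₃ (n - k) * (v k - 3 * v (k - 1) + 3 * v (k - 2) - v (k - 3)) else 0)

lemma rpow_natCast_mul {τ : ℝ} (hτ : 0 < τ) (m : ℕ) {α : ℝ} (hα₁ : α < 1) (j : ℕ) :
    ((m : ℝ) * τ) ^ ((j : ℝ) + 1 - α) = (m : ℝ) ^ j * (m : ℝ) ^ (1 - α) * (τ ^ j * τ * τ ^ (-α)) := by
  have hj : (0 : ℝ) ≤ j := Nat.cast_nonneg j
  rw [Real.mul_rpow (Nat.cast_nonneg m) hτ.le]
  congr 1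
  · rcases Nat.eq_zero_or_pos m with rfl | h
    · rw [Nat.cast_zero, Real.zero_rpow (by linarith), Real.zero_rpow (by linarith), mul_zero]
    · have : (0 : ℝ) < m := by exact_mod_cast h
      rw [← Real.rpow_natCast, ← Real.rpow_add this]; congr 1; ring
  · rw [← Real.rpow_natCast, ← Real.rpow_add_one hτ.ne', ← Real.rpow_add hτ]; congr 1

lemma step_uniform {t : ℕ → ℝ} {τ : ℝ} (ht : ∀ n, t n = n * τ) {k : ℕ} (hk : 1 ≤ k) :
    step t k = τ := by
  unfold step; rw [ht, ht, Nat.cast_sub hk]; push_cast; ring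

/-- The three powers of `t_n - t_k` occurring in the weights, for `k = n - m`. -/
lemma rpow_mesh {t : ℕ → ℝ} {τ : ℝ} (ht : ∀ n, t n = n * τ) (hτ : 0 < τ) {α : ℝ} (hα₁ : α < 1)
    (k m : ℕ) :
    (t (m + k) - t k) ^ (1 - α) = (m : ℝ) ^ (1 - α) * (τ * τ ^ (-α)) ∧
    (t (m + k) - t k) ^ (2 - α) = m * (m : ℝ) ^ (1 - α) * (τ ^ 2 * τ ^ (-α)) ∧
    (t (m + k) - t k) ^ (3 - α) = (m : ℝ) ^ 2 * (m : ℝ) ^ (1 - α) * (τ ^ 3 * τ ^ (-α)) := by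
  have e : t (m + k) - t k = m * τ := by rw [ht, ht]; push_cast; ring
  rw [e]
  have h0 := rpow_natCast_mul hτ m hα₁ 0
  have h1 := rpow_natCast_mul hτ m hα₁ 1
  have h2 := rpow_natCast_mul hτ m hα₁ 2
  refine ⟨?_, ?_, ?_⟩
  · convert h0 using 1
    · push_cast; ring_nf
    · ring
  · convert h1 using 1
    · push_cast; ring_nf
    · ring
  · convert h2 using 1
    · push_cast; ring_nf
    · ring

lemma coefA_eq {t : ℕ → ℝ} {τ : ℝ} (ht : ∀ n, t n = n * τ) (hτ : 0 < τ) {α : ℝ} (hα₁ : α < 1)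
    (m : ℕ) (v : ℕ → ℝ) :
    coefA α t (m + 1) * (v 1 - v 0) = (1 - α) * τ ^ (-α) * capTerm α v (m + 1) 1 := by
  have h1 := (rpow_mesh ht hτ hα₁ 1 m).1
  have h0 := (rpow_mesh ht hτ hα₁ 0 (m + 1)).1
  rw [add_zero] at h0
  have e1 : 1 - α ≠ 0 := by linarith
  unfold coefA capTerm
  rw [step_uniform ht le_rfl, h0, h1, if_neg (by norm_num), if_neg (by norm_num),
    Nat.add_sub_cancel, mom_ker₁_eq hα₁]
  push_cast
  field_simp
  ring

lemma coefBCD_eq {t : ℕ → ℝ} {τ : ℝ} (ht : ∀ n, t n = n * τ) (hτ : 0 < τ) {α : ℝ} (hα₁ : α < 1)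
    (m : ℕ) (v : ℕ → ℝ) :
    coefB α t (m + 2) * v 0 + coefC α t (m + 2) * v 1 + coefD α t (m + 2) * v 2
      = (1 - α) * τ ^ (-α) * capTerm α v (m + 2) 2 := by
  obtain ⟨h1, h2, -⟩ := rpow_mesh ht hτ hα₁ 2 m
  obtain ⟨g1, g2, -⟩ := rpow_mesh ht hτ hα₁ 1 (m + 1)
  rw [show m + 1 + 1 = m + 2 by ring] at g1 g2
  have e1 : 1 - α ≠ 0 := by linarith
  have e2 : 2 - α ≠ 0 := by linarith
  unfold coefB coefC coefD capTerm
  rw [step_uniform ht le_rfl, step_uniform ht one_le_two, h1, h2, g1, g2, if_pos le_rfl,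
    if_neg (by norm_num), Nat.add_sub_cancel, mom_ker₁_eq hα₁, mom_ker₂_eq hα₁]
  push_cast
  generalize (m : ℝ) ^ (1 - α) = U
  generalize ((m : ℝ) + 1) ^ (1 - α) = W
  generalize τ ^ (-α) = Θ
  field_simp
  ring

/-- On the uniform mesh the four Lagrange weights regroup into the first three backward differences
at $t_k$, as in Newton's form of the cubic interpolant. The factor $1-\alpha$ comes from the
normalisation by $\Gamma(2-\alpha)$ instead of $\Gamma(1-\alpha)$. -/
lemma coefW_eq {t : ℕ → ℝ} {τ : ℝ} (ht : ∀ n, t n = n * τ) (hτ : 0 < τ) {α : ℝ} (hα₁ : α < 1)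
    (m : ℕ) {k : ℕ} (hk : 3 ≤ k) (v : ℕ → ℝ) :
    coefW1 α t (m + k) k * v k + coefW2 α t (m + k) k * v (k - 1)
      + coefW3 α t (m + k) k * v (k - 2) + coefW4 α t (m + k) k * v (k - 3)
      = (1 - α) * τ ^ (-α) * capTerm α v (m + k) k := by
  obtain ⟨h1, h2, h3⟩ := rpow_mesh ht hτ hα₁ k m
  obtain ⟨g1, g2, g3⟩ := rpow_mesh ht hτ hα₁ (k - 1) (m + 1)
  rw [show m + 1 + (k - 1) = m + k by omega] at g1 g2 g3
  have e1 : 1 - α ≠ 0 := by linarith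
  have e2 : 2 - α ≠ 0 := by linarith
  have e3 : 3 - α ≠ 0 := by linarith
  unfold coefW1 coefW2 coefW3 coefW4 capTerm
  rw [step_uniform ht (by omega), step_uniform ht (by omega), step_uniform ht (by omega), h1, h2,
    h3, g1, g2, g3, if_pos (by omega), if_pos hk, Nat.add_sub_cancel, mom_ker₁_eq hα₁,
    mom_ker₂_eq hα₁, mom_ker₃_eq hα₁]
  push_cast
  -- With the powers replaced by independent variables, the identity is rational in $\alpha,\tau,m$
  -- and linear in the nodal values.
  generalize (m : ℝ) ^ (1 - α) = U
  generalize ((m : ℝ) + 1) ^ (1 - α) = W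
  generalize τ ^ (-α) = Θ
  generalize v k = a
  generalize v (k - 1) = b
  generalize v (k - 2) = c
  generalize v (k - 3) = d
  field_simp
  ring

lemma sum_range_shift (W v : ℕ → ℝ) (n d : ℕ) (hd : d ≤ 3) :
    ∑ i ∈ Finset.range (n + 1), (if i + d ≤ n ∧ 3 ≤ i + d then W (i + d) else 0) * v i
      = ∑ k ∈ Finset.Icc 3 n, W k * v (k - d) := by
  simp_rw [ite_mul, zero_mul]
  rw [← Finset.sum_filter]
  refine Finset.sum_bij' (fun i _ => i + d) (fun k _ => k - d) ?_ ?_ ?_ ?_ ?_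
  · intro i hi
    simp only [Finset.mem_filter, Finset.mem_range, Finset.mem_Icc] at hi ⊢
    omega
  · intro k hk
    simp only [Finset.mem_filter, Finset.mem_range, Finset.mem_Icc] at hk ⊢
    omega
  · intro i _
    exact Nat.add_sub_cancel i d
  · intro k hk
    have := (Finset.mem_Icc.1 hk).1
    exact Nat.sub_add_cancel (by omega)
  · intro i _
    simp only [Nat.add_sub_cancel]

/-- The weights are collected by node in `coefP`; here they are regrouped by the interval from which
they come. The substitution $i=n-j$ turns the guards with truncated subtraction into conditions on
the node $i$. -/
lemma sum_coefP_eq (α : ℝ) (t v : ℕ → ℝ) {n : ℕ} (hn : 1 ≤ n) :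
    ∑ j ∈ Finset.range (n + 1), coefP α t n j * v (n - j)
      = coefA α t n * (v 1 - v 0)
        + (if 2 ≤ n then coefB α t n * v 0 + coefC α t n * v 1 + coefD α t n * v 2 else 0)
        + ∑ k ∈ Finset.Icc 3 n, (coefW1 α t n k * v k + coefW2 α t n k * v (k - 1)
          + coefW3 α t n k * v (k - 2) + coefW4 α t n k * v (k - 3)) := by
  rw [← Finset.sum_range_reflect]
  have h : ∀ i ∈ Finset.range (n + 1),
      coefP α t n (n + 1 - 1 - i) * v (n - (n + 1 - 1 - i))
      = (if i + 0 ≤ n ∧ 3 ≤ i + 0 then coefW1 α t n (i + 0) else 0) * v i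
        + (if i + 1 ≤ n ∧ 3 ≤ i + 1 then coefW2 α t n (i + 1) else 0) * v i
        + (if i + 2 ≤ n ∧ 3 ≤ i + 2 then coefW3 α t n (i + 2) else 0) * v i
        + (if i + 3 ≤ n ∧ 3 ≤ i + 3 then coefW4 α t n (i + 3) else 0) * v i
        + ((if i = 0 then -coefA α t n * v 0 + (if 2 ≤ n then coefB α t n else 0) * v 0 else 0)
          + (if i = 1 then coefA α t n * v 1 + (if 2 ≤ n then coefC α t n else 0) * v 1 else 0)
          + (if i = 2 then coefD α t n * v 2 else 0)) := by
    intro i hi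
    have hin : i ≤ n := Nat.lt_succ_iff.1 (Finset.mem_range.1 hi)
    rw [Nat.add_sub_cancel, Nat.sub_sub_self hin]
    unfold coefP
    rw [Nat.sub_sub_self hin]
    have c1 : (3 ≤ i) ↔ (i + 0 ≤ n ∧ 3 ≤ i + 0) := by omega
    have c2 : (1 ≤ n - i ∧ 3 ≤ i + 1) ↔ (i + 1 ≤ n ∧ 3 ≤ i + 1) := by omega
    have c3 : (2 ≤ n - i ∧ 3 ≤ i + 2) ↔ (i + 2 ≤ n ∧ 3 ≤ i + 2) := by omega
    have c4 : (3 ≤ n - i) ↔ (i + 3 ≤ n ∧ 3 ≤ i + 3) := by omega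
    simp only [c1, c2, c3, c4]
    rw [add_mul, add_mul, add_mul, add_mul]
    congr 1
    by_cases h0 : i = 0
    · subst h0; simp; split_ifs <;> ring
    by_cases h1 : i = 1
    · subst h1; simp; split_ifs <;> ring
    by_cases h2 : i = 2
    · subst h2; simp
    · simp [h0, h1, h2]
  rw [Finset.sum_congr rfl h]
  simp only [Finset.sum_add_distrib]
  rw [sum_range_shift (coefW1 α t n) v n 0 (by norm_num), sum_range_shift (coefW2 α t n) v n 1
    (by norm_num), sum_range_shift (coefW3 α t n) v n 2 (by norm_num),
    sum_range_shift (coefW4 α t n) v n 3 le_rfl]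
  simp only [Finset.sum_ite_eq', Finset.mem_range, Nat.sub_zero]
  rw [if_pos (show 0 < n + 1 by omega), if_pos (show 1 < n + 1 by omega)]
  by_cases h2 : 2 ≤ n
  · simp only [if_pos h2, if_pos (show 2 < n + 1 by omega)]; ring
  · simp only [if_neg h2, if_neg (show ¬2 < n + 1 by omega)]; ring

lemma capTerm_zero (α : ℝ) (v : ℕ → ℝ) (n : ℕ) : capTerm α v n 0 = 0 := by
  simp [capTerm]

/-- The discrete Caputo derivative on a uniform mesh in terms of backward differences. -/
theorem discreteCaputo_eq {t : ℕ → ℝ} {τ : ℝ} (ht : ∀ n, t n = n * τ) (hτ : 0 < τ) {α : ℝ}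
    (hα₁ : α < 1) (v : ℕ → ℝ) {n : ℕ} (hn : 1 ≤ n) :
    discreteCaputo α t v n
      = τ ^ (-α) / Real.Gamma (1 - α) * ∑ k ∈ Finset.range (n + 1), capTerm α v n k := by
  have hG : Real.Gamma (2 - α) = (1 - α) * Real.Gamma (1 - α) := by
    rw [← Real.Gamma_add_one (by linarith)]; congr 1; ring
  have hG0 : Real.Gamma (1 - α) ≠ 0 := (Real.Gamma_pos_of_pos (by linarith)).ne'
  have e1 : 1 - α ≠ 0 := by linarith
  have hA := coefA_eq ht hτ hα₁ (n - 1) v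
  rw [Nat.sub_add_cancel hn] at hA
  have hsum : ∑ k ∈ Finset.range (n + 1), capTerm α v n k
      = capTerm α v n 1 + (if 2 ≤ n then capTerm α v n 2 else 0)
        + ∑ k ∈ Finset.Icc 3 n, capTerm α v n k := by
    rw [Finset.range_eq_Ico]
    have : ∀ k ∈ Finset.Ico 0 (n + 1), capTerm α v n k
        = (if k = 1 then capTerm α v n 1 else 0) + (if k = 2 then capTerm α v n 2 else 0)
          + (if 3 ≤ k then capTerm α v n k else 0) := by
      intro k _
      by_cases h0 : k = 0
      · subst h0; simp [capTerm_zero]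
      by_cases h1 : k = 1
      · subst h1; simp
      by_cases h2 : k = 2
      · subst h2; simp
      · rw [if_neg h1, if_neg h2, if_pos (by omega)]; ring
    rw [Finset.sum_congr rfl this, Finset.sum_add_distrib, Finset.sum_add_distrib,
      Finset.sum_ite_eq', Finset.sum_ite_eq', if_pos (Finset.mem_Ico.2 (by omega))]
    congr 1
    · congr 1
      exact if_congr (by rw [Finset.mem_Ico]; omega) rfl rfl
    · rw [← Finset.sum_filter]
      apply Finset.sum_congr _ fun _ _ => rfl
      ext k
      simp only [Finset.mem_filter, Finset.mem_Ico, Finset.mem_Icc]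
      omega
  unfold discreteCaputo
  rw [sum_coefP_eq α t v hn, hsum, hA, mul_add, mul_add, mul_add, mul_add]
  congr 1
  · congr 1
    · rw [hG]; field_simp
    · split_ifs with h2
      · have hB := coefBCD_eq ht hτ hα₁ (n - 2) v
        rw [Nat.sub_add_cancel h2] at hB
        rw [hB, hG]; field_simp
      · simp
  · rw [Finset.mul_sum, Finset.mul_sum]
    apply Finset.sum_congr rfl
    intro k hk
    obtain ⟨hk3, hkn⟩ := Finset.mem_Icc.1 hk
    have hW := coefW_eq ht hτ hα₁ (n - k) hk3 v
    rw [Nat.sub_add_cancel hkn] at hW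
    rw [hW, hG]; field_simp

/-! ### Comparison with the translation invariant scheme. -/

lemma coeff_one_sub_X_mul (v : PowerSeries ℝ) (k : ℕ) :
    PowerSeries.coeff k ((1 - PowerSeries.X) * v)
      = PowerSeries.coeff k v - if 1 ≤ k then PowerSeries.coeff (k - 1) v else 0 := by
  rw [sub_mul, one_mul, map_sub]
  congr 1
  cases k with
  | zero => simp
  | succ k => simp [PowerSeries.coeff_succ_X_mul]

/-- Comparison with the translation invariant scheme: only the first two columns differ. -/
lemma sum_symbSeries_eq (α : ℝ) (v : ℕ → ℝ) (h0 : v 0 = 0) {n : ℕ} (hn : 1 ≤ n) :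
    ∑ l ∈ Finset.range (n + 1), PowerSeries.coeff (n - l) (symbSeries α) * v l
      = ∑ k ∈ Finset.range (n + 1), capTerm α v n k
        + ((mom α ker₂ (n - 1) + mom α ker₃ (n - 1)) * v 1
          + if 2 ≤ n then mom α ker₃ (n - 2) * (v 2 - 3 * v 1) else 0) := by
  set V : PowerSeries ℝ := PowerSeries.mk v with hV
  have hL : ∑ l ∈ Finset.range (n + 1), PowerSeries.coeff (n - l) (symbSeries α) * v l
      = PowerSeries.coeff n (V * symbSeries α) := by
    rw [PowerSeries.coeff_mul, Finset.Nat.sum_antidiagonal_eq_sum_range_succ_mk]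
    apply Finset.sum_congr rfl
    intro l _
    rw [hV, PowerSeries.coeff_mk, mul_comm]
  have hsplit : V * symbSeries α = ((1 - PowerSeries.X) * V) * PowerSeries.mk (mom α ker₁)
      + ((1 - PowerSeries.X) * ((1 - PowerSeries.X) * V)) * PowerSeries.mk (mom α ker₂)
      + ((1 - PowerSeries.X) * ((1 - PowerSeries.X) * ((1 - PowerSeries.X) * V)))
        * PowerSeries.mk (mom α ker₃) := by
    unfold symbSeries; ring
  -- Multiplication by $1-X$ is the backward difference of the sequence continued by zero to
  -- negative indices. The series therefore uses second and third differences already at $k=1$ and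
  -- third ones at $k=2$, where the scheme does not; from $k=3$ on both agree.
  have hcol : ∀ k ∈ Finset.range (n + 1),
      PowerSeries.coeff k ((1 - PowerSeries.X) * V) * mom α ker₁ (n - k)
      + PowerSeries.coeff k ((1 - PowerSeries.X) * ((1 - PowerSeries.X) * V)) * mom α ker₂ (n - k)
      + PowerSeries.coeff k ((1 - PowerSeries.X) * ((1 - PowerSeries.X) * ((1 - PowerSeries.X) * V)))
        * mom α ker₃ (n - k)
      = capTerm α v n k
        + ((if k = 1 then (mom α ker₂ (n - 1) + mom α ker₃ (n - 1)) * v 1 else 0)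
          + if k = 2 then mom α ker₃ (n - 2) * (v 2 - 3 * v 1) else 0) := by
    intro k _
    simp only [coeff_one_sub_X_mul, hV, PowerSeries.coeff_mk, capTerm]
    match k with
    | 0 => simp [h0]
    | 1 => simp [h0]; ring
    | 2 => simp [h0]; ring
    | k + 3 =>
      simp
      ring
  rw [hL, hsplit, map_add, map_add, PowerSeries.coeff_mul, PowerSeries.coeff_mul,
    PowerSeries.coeff_mul, Finset.Nat.sum_antidiagonal_eq_sum_range_succ_mk,
    Finset.Nat.sum_antidiagonal_eq_sum_range_succ_mk,
    Finset.Nat.sum_antidiagonal_eq_sum_range_succ_mk]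
  simp only [PowerSeries.coeff_mk]
  rw [← Finset.sum_add_distrib, ← Finset.sum_add_distrib, Finset.sum_congr rfl hcol,
    Finset.sum_add_distrib, Finset.sum_add_distrib]
  simp only [Finset.sum_ite_eq', Finset.mem_range]
  rw [if_pos (by omega)]
  congr 2
  exact if_congr (by omega) rfl rfl

/-! ### Weakly singular functions and beta integrals. -/

/-- Functions on `[0,T]` whose first two derivatives have a weak singularity at `0`. -/
structure WeakSing (α B T : ℝ) (v : ℝ → ℝ) : Prop where
  cont : ContinuousOn v (Icc 0 T)
  diff : ∀ t ∈ Ioo 0 T, DifferentiableAt ℝ v t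
  diff₂ : ∀ t ∈ Ioo 0 T, DifferentiableAt ℝ (deriv v) t
  bound : ∀ t ∈ Ioo 0 T, |deriv v t| ≤ B * t ^ (α - 1)
  bound₂ : ∀ t ∈ Ioo 0 T, |deriv (deriv v) t| ≤ B * t ^ (α - 2)

/-- On each side of $c/2$ one of the two factors is away from its singularity and is bounded by its
value at $c/2$. -/
lemma beta_dominated {α c s : ℝ} (hα₀ : 0 < α) (hα₁ : α < 1) (hs : s ∈ Ioo 0 c) :
    (c - s) ^ (-α) * s ^ (α - 1)
      ≤ (c / 2) ^ (-α) * s ^ (α - 1) + (c / 2) ^ (α - 1) * (c - s) ^ (-α) := by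
  have hc : 0 < c := hs.1.trans hs.2
  have hs0 : 0 < s := hs.1
  have hcs : 0 < c - s := sub_pos.2 hs.2
  have p1 := Real.rpow_pos_of_pos hs0 (α - 1)
  have p2 := Real.rpow_pos_of_pos hcs (-α)
  have p3 := Real.rpow_pos_of_pos (half_pos hc) (α - 1)
  have p4 := Real.rpow_pos_of_pos (half_pos hc) (-α)
  rcases le_total s (c / 2) with h | h
  · have := Real.rpow_le_rpow_of_nonpos (half_pos hc) (by linarith : c / 2 ≤ c - s)
      (by linarith : -α ≤ 0)
    nlinarith [mul_le_mul_of_nonneg_right this p1.le, mul_pos p3 p2]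
  · have := Real.rpow_le_rpow_of_nonpos (half_pos hc) h (by linarith : α - 1 ≤ 0)
    nlinarith [mul_le_mul_of_nonneg_left this p2.le, mul_pos p4 p1]

lemma intervalIntegrable_sub_rpow {r c : ℝ} (hr : -1 < r) :
    IntervalIntegrable (fun s : ℝ => (c - s) ^ r) volume 0 c := by
  have h : IntervalIntegrable (fun x : ℝ => x ^ r) volume 0 c :=
    intervalIntegral.intervalIntegrable_rpow' hr
  simpa using (h.comp_sub_left c).symm

lemma intervalIntegrable_beta {α c : ℝ} (hα₀ : 0 < α) (hα₁ : α < 1) :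
    IntervalIntegrable (fun s : ℝ =>
      (c / 2) ^ (-α) * s ^ (α - 1) + (c / 2) ^ (α - 1) * (c - s) ^ (-α)) volume 0 c :=
  ((intervalIntegral.intervalIntegrable_rpow' (by linarith)).const_mul _).add
    ((intervalIntegrable_sub_rpow (by linarith)).const_mul _)

lemma intervalIntegrable_of_bound_Ioo {f g : ℝ → ℝ} {a b : ℝ} (hab : a ≤ b) (hf : Measurable f)
    (hg : IntervalIntegrable g volume a b) (h : ∀ s ∈ Ioo a b, |f s| ≤ g s) :
    IntervalIntegrable f volume a b := by
  rw [intervalIntegrable_iff_integrableOn_Ioo_of_le hab] at hg ⊢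
  refine Integrable.mono' hg hf.aestronglyMeasurable ?_
  filter_upwards [ae_restrict_mem measurableSet_Ioo] with s hs
  exact h s hs

lemma abs_integral_le_of_bound_Ioo {f g : ℝ → ℝ} {a b : ℝ} (hab : a ≤ b)
    (hg : IntervalIntegrable g volume a b) (h : ∀ s ∈ Ioo a b, |f s| ≤ g s) :
    |∫ s in a..b, f s| ≤ ∫ s in a..b, g s := by
  rw [intervalIntegrable_iff_integrableOn_Ioo_of_le hab] at hg
  rw [intervalIntegral.integral_of_le hab, intervalIntegral.integral_of_le hab,
    integral_Ioc_eq_integral_Ioo, integral_Ioc_eq_integral_Ioo, ← Real.norm_eq_abs]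
  refine norm_integral_le_of_norm_le hg ?_
  filter_upwards [ae_restrict_mem measurableSet_Ioo] with s hs
  exact h s hs

/-! ### Local interpolation error. -/

/-- The error of the differentiated interpolant on `[t_{k-1},t_k]`, at `t_k - στ`, times `τ`. -/
def locErr (v : ℝ → ℝ) (τ : ℝ) (k : ℕ) (σ : ℝ) : ℝ :=
  τ * deriv v (k * τ - τ * σ)
    - ((v (k * τ) - v ((k - 1 : ℕ) * τ)) * ker₁ σ
      + (if 2 ≤ k then (v (k * τ) - 2 * v ((k - 1 : ℕ) * τ) + v ((k - 2 : ℕ) * τ)) * ker₂ σ else 0)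
      + (if 3 ≤ k then (v (k * τ) - 3 * v ((k - 1 : ℕ) * τ) + 3 * v ((k - 2 : ℕ) * τ)
          - v ((k - 3 : ℕ) * τ)) * ker₃ σ else 0))

lemma measurable_locErr (v : ℝ → ℝ) (τ : ℝ) (k : ℕ) : Measurable (locErr v τ k) := by
  have h1 := measurable_deriv v
  have h2 := continuous_ker₁.measurable
  have h3 := continuous_ker₂.measurable
  have h4 := continuous_ker₃.measurable
  unfold locErr
  split_ifs <;> fun_prop

lemma abs_ker₂_le {σ : ℝ} (h : σ ∈ Ioo (0 : ℝ) 1) : |ker₂ σ| ≤ 1 := by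
  unfold ker₂; rw [abs_le]; constructor <;> linarith [h.1, h.2]

lemma abs_ker₃_le {σ : ℝ} (h : σ ∈ Ioo (0 : ℝ) 1) : |ker₃ σ| ≤ 1 := by
  unfold ker₃; rw [abs_le]; constructor <;> nlinarith [h.1, h.2]

section Local

variable {α B τ : ℝ} {N : ℕ} {v : ℝ → ℝ}

lemma WeakSing.nonneg {T : ℝ} (hv : WeakSing α B T v) (hT : 0 < T) : 0 ≤ B := by
  have h := (abs_nonneg _).trans (hv.bound (T / 2) ⟨by linarith, by linarith⟩)
  have := Real.rpow_pos_of_pos (half_pos hT) (α - 1)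
  exact nonneg_of_mul_nonneg_left h this

/-- The bound $Bs^{\alpha-1}$ is integrable even at $0$, so the fundamental theorem of calculus
holds on the first interval as well. The integral is controlled by subadditivity,
$k^\alpha-(k-1)^\alpha\le1$. -/
lemma WeakSing.abs_diff_le (hα₀ : 0 < α) (hα₁ : α < 1) (hτ : 0 < τ)
    (hv : WeakSing α B (N * τ) v) {k : ℕ} (hk : 1 ≤ k) (hkN : k ≤ N) :
    IntervalIntegrable (deriv v) volume ((k - 1 : ℕ) * τ) (k * τ) ∧
    ∫ s in ((k - 1 : ℕ) * τ)..(k * τ), deriv v s = v (k * τ) - v ((k - 1 : ℕ) * τ) ∧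
    |v (k * τ) - v ((k - 1 : ℕ) * τ)| ≤ B * τ ^ α / α := by
  have hkN' : (k : ℝ) * τ ≤ N * τ := by gcongr
  have h0 : (0 : ℝ) ≤ (k - 1 : ℕ) * τ := by positivity
  have hle : ((k - 1 : ℕ) : ℝ) * τ ≤ k * τ := by gcongr; omega
  have hB := hv.nonneg (by have : (1 : ℝ) ≤ N := by exact_mod_cast hk.trans hkN
                           nlinarith)
  have hsub : Ioo (((k - 1 : ℕ) : ℝ) * τ) (k * τ) ⊆ Ioo 0 (N * τ) :=
    fun s hs => ⟨h0.trans_lt hs.1, hs.2.trans_le hkN'⟩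
  have hb : IntervalIntegrable (fun s : ℝ => B * s ^ (α - 1)) volume ((k - 1 : ℕ) * τ) (k * τ) :=
    (intervalIntegral.intervalIntegrable_rpow' (by linarith)).const_mul _
  have hbd : ∀ s ∈ Ioo (((k - 1 : ℕ) : ℝ) * τ) (k * τ), |deriv v s| ≤ B * s ^ (α - 1) :=
    fun s hs => hv.bound s (hsub hs)
  have hi := intervalIntegrable_of_bound_Ioo hle (measurable_deriv v) hb hbd
  have hint : ∫ s in ((k - 1 : ℕ) * τ)..(k * τ), deriv v s = v (k * τ) - v ((k - 1 : ℕ) * τ) :=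
    intervalIntegral.integral_eq_sub_of_hasDerivAt_of_le hle
      (hv.cont.mono fun s hs => ⟨h0.trans hs.1, hs.2.trans hkN'⟩)
      (fun s hs => (hv.diff s (hsub hs)).hasDerivAt) hi
  refine ⟨hi, hint, ?_⟩
  rw [← hint]
  refine (abs_integral_le_of_bound_Ioo hle hb hbd).trans ?_
  rw [intervalIntegral.integral_const_mul, integral_rpow (Or.inl (by linarith)), sub_add_cancel,
    mul_div_assoc]
  gcongr
  rw [Real.mul_rpow (by positivity) hτ.le, Real.mul_rpow (by positivity) hτ.le, ← sub_mul]
  refine mul_le_of_le_one_left (by positivity) ?_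
  have h := Real.rpow_add_le_add_rpow (Nat.cast_nonneg (k - 1)) zero_le_one hα₀.le hα₁.le
  rw [Real.one_rpow, Nat.cast_sub hk] at h
  rw [Nat.cast_sub hk]
  push_cast at h ⊢
  rw [sub_add_cancel] at h
  linarith

lemma WeakSing.exists_slope (hτ : 0 < τ) (hv : WeakSing α B (N * τ) v) {k : ℕ} (hk : 1 ≤ k)
    (hkN : k ≤ N) : ∃ ξ ∈ Ioo (((k - 1 : ℕ) : ℝ) * τ) (k * τ),
      v (k * τ) - v ((k - 1 : ℕ) * τ) = τ * deriv v ξ := by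
  have hkN' : (k : ℝ) * τ ≤ N * τ := by gcongr
  have h0 : (0 : ℝ) ≤ (k - 1 : ℕ) * τ := by positivity
  have hstep : (k : ℝ) * τ - (k - 1 : ℕ) * τ = τ := by rw [Nat.cast_sub hk]; push_cast; ring
  obtain ⟨ξ, hξ, h⟩ := exists_deriv_eq_slope v (by linarith : ((k - 1 : ℕ) : ℝ) * τ < k * τ)
    (hv.cont.mono fun s hs => ⟨h0.trans hs.1, hs.2.trans hkN'⟩)
    (fun s hs => (hv.diff s ⟨h0.trans_lt hs.1, hs.2.trans_le hkN'⟩).differentiableWithinAt)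
  refine ⟨ξ, hξ, ?_⟩
  rw [h, hstep]; field_simp

lemma abs_combination_le {a b c D x y : ℝ} {p q : Prop} [Decidable p] [Decidable q]
    (ha : |a| ≤ D) (hb : p → |b| ≤ D) (hc : q → |c| ≤ D) (hx : |x| ≤ 1) (hy : |y| ≤ 1) :
    |a - ((if p then b * x else 0) + (if q then c * y else 0))| ≤ 3 * D := by
  have hD := (abs_nonneg a).trans ha
  have h1 : |if p then b * x else 0| ≤ D := by
    split_ifs with h
    · rw [abs_mul]; nlinarith [abs_nonneg b, abs_nonneg x, hb h]
    · simpa using hD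
  have h2 : |if q then c * y else 0| ≤ D := by
    split_ifs with h
    · rw [abs_mul]; nlinarith [abs_nonneg c, abs_nonneg y, hc h]
    · simpa using hD
  have := abs_sub a ((if p then b * x else 0) + (if q then c * y else 0))
  have := abs_add_le (if p then b * x else 0) (if q then c * y else 0)
  linarith

lemma abs_locErr_le {D : ℝ} {k : ℕ} {σ : ℝ} (hσ : σ ∈ Ioo (0 : ℝ) 1)
    (h₁ : |τ * deriv v (k * τ - τ * σ) - (v (k * τ) - v ((k - 1 : ℕ) * τ))| ≤ D)
    (h₂ : 2 ≤ k → |v (k * τ) - v ((k - 1 : ℕ) * τ) - (v ((k - 1 : ℕ) * τ) - v ((k - 2 : ℕ) * τ))|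
      ≤ D)
    (h₃ : 3 ≤ k → |v (k * τ) - v ((k - 1 : ℕ) * τ) - 2 * (v ((k - 1 : ℕ) * τ) - v ((k - 2 : ℕ) * τ))
      + (v ((k - 2 : ℕ) * τ) - v ((k - 3 : ℕ) * τ))| ≤ D) :
    |locErr v τ k σ| ≤ 3 * D := by
  have := abs_combination_le (p := 2 ≤ k) (q := 3 ≤ k) h₁ h₂ h₃ (abs_ker₂_le hσ) (abs_ker₃_le hσ)
  refine le_of_eq_of_le (congrArg _ ?_) this
  unfold locErr ker₁
  split_ifs <;> ring

/-- Bound for the local error, first intervals. -/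
lemma WeakSing.abs_locErr_le_of_small (hα₀ : 0 < α) (hα₁ : α < 1) (hτ : 0 < τ)
    (hv : WeakSing α B (N * τ) v) {k : ℕ} (hk : 1 ≤ k) (hkN : k ≤ N) {σ : ℝ}
    (hσ : σ ∈ Ioo (0 : ℝ) 1) :
    |locErr v τ k σ| ≤ 12 / α * (B * τ ^ α) * (1 - σ) ^ (α - 1) := by
  have hB := hv.nonneg (by have : (1 : ℝ) ≤ N := by exact_mod_cast hk.trans hkN
                           nlinarith)
  have hk1 : (1 : ℝ) ≤ k := by exact_mod_cast hk
  have hkN' : (k : ℝ) * τ ≤ N * τ := by gcongr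
  have h1σ : 0 < 1 - σ := by linarith [hσ.2]
  have hs : 0 < k * τ - τ * σ := by nlinarith
  have hs2 : k * τ - τ * σ < N * τ := by nlinarith [mul_pos hτ hσ.1]
  have hBτ : 0 ≤ B * τ ^ α := by positivity
  have hone : 1 ≤ (1 - σ) ^ (α - 1) := by
    have := Real.rpow_le_rpow_of_nonpos h1σ (by linarith [hσ.1] : 1 - σ ≤ 1)
      (by linarith : α - 1 ≤ 0)
    rwa [Real.one_rpow] at this
  have hαinv : 1 ≤ 1 / α := by rw [le_div_iff₀ hα₀]; linarith
  have hder : |τ * deriv v (k * τ - τ * σ)| ≤ B * τ ^ α / α * (1 - σ) ^ (α - 1) := by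
    rw [abs_mul, abs_of_pos hτ]
    have h1 := hv.bound _ ⟨hs, hs2⟩
    have h2 : (k * τ - τ * σ) ^ (α - 1) ≤ (τ * (1 - σ)) ^ (α - 1) :=
      Real.rpow_le_rpow_of_nonpos (by positivity) (by nlinarith) (by linarith)
    rw [Real.mul_rpow hτ.le h1σ.le] at h2
    calc τ * |deriv v (k * τ - τ * σ)| ≤ τ * (B * (τ ^ (α - 1) * (1 - σ) ^ (α - 1))) := by
          gcongr
          exact h1.trans (by gcongr)
      _ = B * (τ ^ (α - 1) * τ) * (1 - σ) ^ (α - 1) := by ring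
      _ = B * τ ^ α * (1 - σ) ^ (α - 1) := by
          rw [← Real.rpow_add_one hτ.ne', sub_add_cancel]
      _ ≤ B * τ ^ α / α * (1 - σ) ^ (α - 1) := by
          gcongr
          rw [le_div_iff₀ hα₀]; nlinarith
  have hD : ∀ j, 1 ≤ j → j ≤ N → |v (j * τ) - v ((j - 1 : ℕ) * τ)|
      ≤ B * τ ^ α / α * (1 - σ) ^ (α - 1) := fun j hj hjN => by
    refine (hv.abs_diff_le hα₀ hα₁ hτ hj hjN).2.2.trans ?_
    exact le_mul_of_one_le_right (by positivity) hone
  set D := B * τ ^ α / α * (1 - σ) ^ (α - 1) with hDdef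
  have hD0 : 0 ≤ D := by positivity
  have e0 := hD k hk hkN
  -- The largest combination is the third difference, with coefficients $1,2,1$ in first
  -- differences, hence $4D$. The factor $3$ counts the three parts of the local error in
  -- `abs_locErr_le`.
  have hfin : 3 * (4 * D) = 12 / α * (B * τ ^ α) * (1 - σ) ^ (α - 1) := by rw [hDdef]; ring
  rw [← hfin]
  refine abs_locErr_le hσ ?_ (fun h => ?_) (fun h => ?_)
  · have := abs_sub (τ * deriv v (k * τ - τ * σ)) (v (k * τ) - v ((k - 1 : ℕ) * τ))
    linarith
  · have e1 := hD (k - 1) (by omega) (by omega)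
    rw [show k - 1 - 1 = k - 2 by omega] at e1
    rw [abs_le] at *
    constructor <;> linarith
  · have e1 := hD (k - 1) (by omega) (by omega)
    have e2 := hD (k - 2) (by omega) (by omega)
    rw [show k - 1 - 1 = k - 2 by omega] at e1
    rw [show k - 2 - 1 = k - 3 by omega] at e2
    rw [abs_le] at *
    constructor <;> linarith

/-- Bound for the local error away from the singularity. -/
lemma WeakSing.abs_locErr_le_of_large (hα₁ : α < 1) (hτ : 0 < τ)
    (hv : WeakSing α B (N * τ) v) {k : ℕ} (hk : 4 ≤ k) (hkN : k ≤ N) {σ : ℝ}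
    (hσ : σ ∈ Ioo (0 : ℝ) 1) :
    |locErr v τ k σ| ≤ 18 * (B * τ ^ α) * ((k - 3 : ℕ) : ℝ) ^ (α - 2) := by
  have hN : (1 : ℝ) ≤ N := by exact_mod_cast (by omega : 1 ≤ N)
  have hB := hv.nonneg (by nlinarith)
  have hkN' : (k : ℝ) * τ ≤ N * τ := by gcongr
  have hk3 : (0 : ℝ) < (k - 3 : ℕ) := by exact_mod_cast (by omega : 0 < k - 3)
  have c1 : ((k - 1 : ℕ) : ℝ) = k - 1 := by rw [Nat.cast_sub (by omega)]; simp
  have c2 : ((k - 2 : ℕ) : ℝ) = k - 2 := by rw [Nat.cast_sub (by omega)]; simp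
  have c3 : ((k - 3 : ℕ) : ℝ) = k - 3 := by rw [Nat.cast_sub (by omega)]; simp
  set A : ℝ := ((k - 3 : ℕ) : ℝ) * τ with hA
  have hApos : 0 < A := by positivity
  have hlen : k * τ - A = 3 * τ := by rw [hA, c3]; ring
  set S := Ioo A (k * τ) with hS
  have hsub : ∀ s ∈ S, s ∈ Ioo 0 (N * τ) := fun s hs => ⟨hApos.trans hs.1, hs.2.trans_le hkN'⟩
  -- On $(t_{k-3},t_k)$ the second derivative is at most $BA^{\alpha-2}$, so two values of $\tau v'$
  -- differ by at most $3\tau^2$ times this, which scales as $\tau^\alpha(k-3)^{\alpha-2}$.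
  have hlip : ∀ x ∈ S, ∀ y ∈ S, |τ * deriv v x - τ * deriv v y|
      ≤ 3 * ((B * τ ^ α) * ((k - 3 : ℕ) : ℝ) ^ (α - 2)) := by
    intro x hx y hy
    have h := Convex.norm_image_sub_le_of_norm_deriv_le (𝕜 := ℝ) (f := deriv v) (s := S)
      (C := B * A ^ (α - 2)) (x := y) (y := x) (fun s hs => hv.diff₂ s (hsub s hs))
      (fun s hs => (hv.bound₂ s (hsub s hs)).trans (mul_le_mul_of_nonneg_left
        (Real.rpow_le_rpow_of_nonpos hApos hs.1.le (by linarith)) hB)) (convex_Ioo _ _) hy hx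
    rw [Real.norm_eq_abs, Real.norm_eq_abs] at h
    have hd : |x - y| ≤ 3 * τ := by
      rw [← hlen, abs_le]; constructor <;> linarith [hx.1, hx.2, hy.1, hy.2]
    rw [← mul_sub, abs_mul, abs_of_pos hτ]
    calc τ * |deriv v x - deriv v y| ≤ τ * (B * A ^ (α - 2) * (3 * τ)) := by
          gcongr; exact h.trans (by gcongr)
      _ = 3 * (B * (τ ^ (α - 2) * τ ^ (2 : ℝ)) * ((k - 3 : ℕ) : ℝ) ^ (α - 2)) := by
          rw [hA, Real.mul_rpow hk3.le hτ.le, Real.rpow_two]; ring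
      _ = _ := by rw [← Real.rpow_add hτ, sub_add_cancel]
  -- By the mean value theorem first differences are values of $\tau v'$ inside $S$. Every part of
  -- the local error then becomes a sum of at most two differences of such values, which gives
  -- $6=2\cdot3$ and, with the factor $3$ of `abs_locErr_le`, the constant $18$.
  have hslope : ∀ j : ℕ, j ≤ k → k ≤ j + 2 → ∃ ξ ∈ S,
      v (j * τ) - v ((j - 1 : ℕ) * τ) = τ * deriv v ξ := by
    intro j hj hj'
    obtain ⟨ξ, hξ, h⟩ := hv.exists_slope hτ (by omega : 1 ≤ j) (hj.trans hkN)
    refine ⟨ξ, ⟨lt_of_le_of_lt ?_ hξ.1, hξ.2.trans_le ?_⟩, h⟩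
    · rw [hA]; gcongr 1; exact_mod_cast (by omega : k - 3 ≤ j - 1)
    · gcongr
  obtain ⟨ξ₁, hξ₁, e1⟩ := hslope k le_rfl (by omega)
  obtain ⟨ξ₂, hξ₂, e2⟩ := hslope (k - 1) (by omega) (by omega)
  obtain ⟨ξ₃, hξ₃, e3⟩ := hslope (k - 2) (by omega) (by omega)
  rw [show k - 1 - 1 = k - 2 by omega] at e2
  rw [show k - 2 - 1 = k - 3 by omega] at e3
  have hσS : k * τ - τ * σ ∈ S :=
    ⟨by nlinarith [mul_lt_mul_of_pos_left hσ.2 hτ], by nlinarith [mul_pos hτ hσ.1]⟩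
  have l0 := hlip _ hσS _ hξ₁
  have l1 := hlip _ hξ₁ _ hξ₂
  have l2 := hlip _ hξ₂ _ hξ₃
  have hfin : 18 * (B * τ ^ α) * ((k - 3 : ℕ) : ℝ) ^ (α - 2)
      = 3 * (6 * ((B * τ ^ α) * ((k - 3 : ℕ) : ℝ) ^ (α - 2))) := by ring
  rw [hfin]
  have hE : 0 ≤ (B * τ ^ α) * ((k - 3 : ℕ) : ℝ) ^ (α - 2) := by positivity
  refine abs_locErr_le hσ ?_ (fun _ => ?_) (fun _ => ?_)
  · rw [e1]; linarith
  · rw [e1, e2]; linarith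
  · rw [e1, e2, e3, abs_le]
    rw [abs_le] at l1 l2
    constructor <;> linarith

lemma WeakSing.exists_abs_locErr_le (hα₀ : 0 < α) (hα₁ : α < 1) :
    ∃ C, 0 < C ∧ ∀ (B τ : ℝ) (N : ℕ) (v : ℝ → ℝ), 0 < τ → WeakSing α B (N * τ) v →
      ∀ k : ℕ, 1 ≤ k → k ≤ N → ∀ σ ∈ Ioo (0 : ℝ) 1,
        |locErr v τ k σ| ≤ C * (B * τ ^ α) * (k : ℝ) ^ (α - 2) * (1 - σ) ^ (α - 1) := by
  -- For $k\le3$ one has $9k^{\alpha-2}\ge1$, so $12\cdot24$ suffices; for $k\ge4$ one has $k-3\ge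
  -- k/4$, hence $18\cdot16$. Both products are $288$.
  refine ⟨288 / α, by positivity, fun B τ N v hτ hv k hk hkN σ hσ => ?_⟩
  have hk1 : (1 : ℝ) ≤ k := by exact_mod_cast hk
  have hB := hv.nonneg (by have : (1 : ℝ) ≤ N := by exact_mod_cast hk.trans hkN
                           nlinarith)
  have hBτ : 0 ≤ B * τ ^ α := by positivity
  have h1σ : 0 < 1 - σ := by linarith [hσ.2]
  rcases lt_or_ge k 4 with h | h
  · refine (hv.abs_locErr_le_of_small hα₀ hα₁ hτ hk hkN hσ).trans ?_
    have h3 : (k : ℝ) ≤ 3 := by exact_mod_cast (by omega : k ≤ 3)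
    have : (1 : ℝ) ≤ 9 * (k : ℝ) ^ (α - 2) := by
      have h4 : (3 : ℝ) ^ (-2 : ℝ) ≤ (k : ℝ) ^ (α - 2) :=
        (Real.rpow_le_rpow_of_exponent_le (by norm_num) (by linarith)).trans
          (Real.rpow_le_rpow_of_nonpos (by positivity) h3 (by linarith))
      rw [Real.rpow_neg (by norm_num), Real.rpow_two] at h4
      linarith
    refine mul_le_mul_of_nonneg_right ?_ (by positivity)
    calc 12 / α * (B * τ ^ α) ≤ 12 / α * (B * τ ^ α) * (24 * (k : ℝ) ^ (α - 2)) :=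
          le_mul_of_one_le_right (by positivity)
            (by linarith [Real.rpow_pos_of_pos (by linarith : (0:ℝ) < k) (α - 2)])
      _ = 288 / α * (B * τ ^ α) * (k : ℝ) ^ (α - 2) := by ring
  · refine (hv.abs_locErr_le_of_large hα₁ hτ h hkN hσ).trans ?_
    have h4 : (4 : ℝ) ≤ k := by exact_mod_cast h
    have c3 : ((k - 3 : ℕ) : ℝ) = k - 3 := by rw [Nat.cast_sub (by omega)]; simp
    have h5 : ((k - 3 : ℕ) : ℝ) ^ (α - 2) ≤ 16 * (k : ℝ) ^ (α - 2) := by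
      have h6 : ((k - 3 : ℕ) : ℝ) ^ (α - 2) ≤ ((k : ℝ) / 4) ^ (α - 2) :=
        Real.rpow_le_rpow_of_nonpos (by positivity) (by rw [c3]; linarith) (by linarith)
      have h7 : (1 / 4 : ℝ) ^ (α - 2) ≤ 16 := by
        have := Real.rpow_le_rpow_of_exponent_ge (by norm_num : (0 : ℝ) < 1 / 4) (by norm_num)
          (by linarith : (-2 : ℝ) ≤ α - 2)
        rw [Real.rpow_neg (by norm_num), Real.rpow_two] at this
        norm_num at this ⊢
        linarith
      rw [div_eq_mul_one_div, Real.mul_rpow (by positivity) (by norm_num)] at h6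
      nlinarith [Real.rpow_pos_of_pos (by linarith : (0:ℝ) < k) (α - 2)]
    have hone : 1 ≤ (1 - σ) ^ (α - 1) := by
      have := Real.rpow_le_rpow_of_nonpos h1σ (by linarith [hσ.1] : 1 - σ ≤ 1)
        (by linarith : α - 1 ≤ 0)
      rwa [Real.one_rpow] at this
    have hαinv : 288 ≤ 288 / α := by rw [le_div_iff₀ hα₀]; linarith
    have hK : 0 ≤ (k : ℝ) ^ (α - 2) := by positivity
    calc 18 * (B * τ ^ α) * ((k - 3 : ℕ) : ℝ) ^ (α - 2)
        ≤ 18 * (B * τ ^ α) * (16 * (k : ℝ) ^ (α - 2)) := by gcongr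
      _ = 288 * (B * τ ^ α) * (k : ℝ) ^ (α - 2) := by ring
      _ ≤ 288 / α * (B * τ ^ α) * (k : ℝ) ^ (α - 2) := by gcongr
      _ ≤ _ := le_mul_of_one_le_right (by positivity) hone

end Local

/-! ### Truncation error in time. -/

section TimeTruncation

variable {α B τ E : ℝ} {N : ℕ} {v : ℝ → ℝ}

lemma intervalIntegrable_one_sub_rpow (hα₀ : 0 < α) :
    IntervalIntegrable (fun σ : ℝ => (1 - σ) ^ (α - 1)) volume 0 1 :=
  intervalIntegrable_sub_rpow (by linarith)

lemma integral_one_sub_rpow (hα₀ : 0 < α) : ∫ σ in (0 : ℝ)..1, (1 - σ) ^ (α - 1) = 1 / α := by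
  rw [intervalIntegral.integral_comp_sub_left (fun x : ℝ => x ^ (α - 1)) 1,
    integral_rpow (Or.inl (by linarith))]
  simp [Real.zero_rpow hα₀.ne']

/-- An integrable majorant of the beta density `σ ^ (-α) * (1 - σ) ^ (α - 1)`. -/
def betaMajorant (α σ : ℝ) : ℝ :=
  (1 / 2 : ℝ) ^ (-α) * (1 - σ) ^ (α - 1) + (1 / 2 : ℝ) ^ (α - 1) * σ ^ (-α)

lemma intervalIntegrable_betaMajorant (hα₀ : 0 < α) (hα₁ : α < 1) :
    IntervalIntegrable (betaMajorant α) volume 0 1 :=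
  ((intervalIntegrable_one_sub_rpow hα₀).const_mul _).add
    ((intervalIntegral.intervalIntegrable_rpow' (by linarith)).const_mul _)

lemma le_betaMajorant (hα₀ : 0 < α) (hα₁ : α < 1) (m : ℕ) {σ : ℝ} (hσ : σ ∈ Ioo (0 : ℝ) 1) :
    ((m : ℝ) + σ) ^ (-α) * (1 - σ) ^ (α - 1) ≤ betaMajorant α σ := by
  have h := beta_dominated hα₀ hα₁ (s := 1 - σ) (c := 1) ⟨by linarith [hσ.2], by linarith [hσ.1]⟩
  rw [sub_sub_cancel] at h
  refine le_trans ?_ h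
  have h1 : 0 < 1 - σ := by linarith [hσ.2]
  gcongr ?_ * _
  exact Real.rpow_le_rpow_of_nonpos hσ.1 (by linarith [(Nat.cast_nonneg m : (0 : ℝ) ≤ m)])
    (by linarith)

lemma intervalIntegrable_mul_of_locErr_le (hα₀ : 0 < α) (hα₁ : α < 1) (m : ℕ) {k : ℕ}
    (hE : ∀ σ ∈ Ioo (0 : ℝ) 1, |locErr v τ k σ| ≤ E * (1 - σ) ^ (α - 1)) :
    IntervalIntegrable (fun σ => ((m : ℝ) + σ) ^ (-α) * locErr v τ k σ) volume 0 1 := by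
  refine intervalIntegrable_of_bound_Ioo zero_le_one
    ((by fun_prop : Measurable fun σ : ℝ => ((m : ℝ) + σ) ^ (-α)).mul (measurable_locErr v τ k))
    ((intervalIntegrable_betaMajorant hα₀ hα₁).const_mul |E|) (fun σ hσ => ?_)
  have h0 : 0 < (m : ℝ) + σ := by linarith [(Nat.cast_nonneg m : (0 : ℝ) ≤ m), hσ.1]
  have h1 : 0 < 1 - σ := by linarith [hσ.2]
  rw [abs_mul, abs_of_pos (Real.rpow_pos_of_pos h0 _)]
  calc ((m : ℝ) + σ) ^ (-α) * |locErr v τ k σ|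
      ≤ ((m : ℝ) + σ) ^ (-α) * (|E| * (1 - σ) ^ (α - 1)) := by
        gcongr
        exact (hE σ hσ).trans (by gcongr; exact le_abs_self E)
    _ = |E| * (((m : ℝ) + σ) ^ (-α) * (1 - σ) ^ (α - 1)) := by ring
    _ ≤ _ := by gcongr; exact le_betaMajorant hα₀ hα₁ m hσ

lemma intervalIntegrable_locErr (hα₀ : 0 < α) {k : ℕ}
    (hE : ∀ σ ∈ Ioo (0 : ℝ) 1, |locErr v τ k σ| ≤ E * (1 - σ) ^ (α - 1)) :
    IntervalIntegrable (locErr v τ k) volume 0 1 :=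
  intervalIntegrable_of_bound_Ioo zero_le_one (measurable_locErr v τ k)
    ((intervalIntegrable_one_sub_rpow hα₀).const_mul E) hE

/-- The derivative of the local interpolant, times `τ`. -/
def locInterp (v : ℝ → ℝ) (τ : ℝ) (k : ℕ) (σ : ℝ) : ℝ :=
  τ * deriv v (k * τ - τ * σ) - locErr v τ k σ

lemma locInterp_eq (v : ℝ → ℝ) (τ : ℝ) (k : ℕ) : locInterp v τ k = fun σ =>
    (v (k * τ) - v ((k - 1 : ℕ) * τ)) * ker₁ σ
      + (if 2 ≤ k then (v (k * τ) - 2 * v ((k - 1 : ℕ) * τ) + v ((k - 2 : ℕ) * τ)) else 0) * ker₂ σ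
      + (if 3 ≤ k then (v (k * τ) - 3 * v ((k - 1 : ℕ) * τ) + 3 * v ((k - 2 : ℕ) * τ)
          - v ((k - 3 : ℕ) * τ)) else 0) * ker₃ σ := by
  ext σ
  unfold locInterp locErr
  split_ifs <;> ring

lemma continuous_locInterp (v : ℝ → ℝ) (τ : ℝ) (k : ℕ) : Continuous (locInterp v τ k) := by
  rw [locInterp_eq]
  have h2 := continuous_ker₁
  have h3 := continuous_ker₂
  have h4 := continuous_ker₃
  fun_prop

lemma integral_mul_add_mul_add_mul {w p q r : ℝ → ℝ} (a b c : ℝ)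
    (hp : IntervalIntegrable (fun σ => w σ * p σ) volume 0 1)
    (hq : IntervalIntegrable (fun σ => w σ * q σ) volume 0 1)
    (hr : IntervalIntegrable (fun σ => w σ * r σ) volume 0 1) :
    ∫ σ in (0 : ℝ)..1, w σ * (a * p σ + b * q σ + c * r σ)
      = a * (∫ σ in (0 : ℝ)..1, w σ * p σ) + b * (∫ σ in (0 : ℝ)..1, w σ * q σ)
        + c * ∫ σ in (0 : ℝ)..1, w σ * r σ := by
  rw [← intervalIntegral.integral_const_mul, ← intervalIntegral.integral_const_mul,
    ← intervalIntegral.integral_const_mul,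
    ← intervalIntegral.integral_add (hp.const_mul a) (hq.const_mul b),
    ← intervalIntegral.integral_add ((hp.const_mul a).add (hq.const_mul b)) (hr.const_mul c)]
  congr 1; ext σ; ring

lemma integral_mul_locInterp (hα₁ : α < 1) (n k : ℕ) :
    ∫ σ in (0 : ℝ)..1, (((n - k : ℕ) : ℝ) + σ) ^ (-α) * locInterp v τ k σ
      = capTerm α (fun j => v (j * τ)) n k := by
  rw [locInterp_eq]
  rw [integral_mul_add_mul_add_mul _ _ _
    (intervalIntegrable_rpow_add_mul hα₁ _ continuous_ker₁)
    (intervalIntegrable_rpow_add_mul hα₁ _ continuous_ker₂)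
    (intervalIntegrable_rpow_add_mul hα₁ _ continuous_ker₃)]
  unfold capTerm mom
  split_ifs <;> ring

lemma integral_ker₂ : ∫ σ in (0 : ℝ)..1, ker₂ σ = 0 := by
  have : ∀ x ∈ uIcc (0 : ℝ) 1, HasDerivAt (fun x : ℝ => x / 2 - x ^ 2 / 2) (ker₂ x) x := by
    intro x _
    refine (((hasDerivAt_id x).div_const 2).sub ((hasDerivAt_pow 2 x).div_const 2)).congr_deriv ?_
    simp [ker₂]
  rw [intervalIntegral.integral_eq_sub_of_hasDerivAt this (continuous_ker₂.intervalIntegrable _ _)]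
  norm_num

lemma integral_ker₃ : ∫ σ in (0 : ℝ)..1, ker₃ σ = 0 := by
  have : ∀ x ∈ uIcc (0 : ℝ) 1, HasDerivAt (fun x : ℝ => x ^ 3 / 6 - x ^ 2 / 2 + x / 3)
      (ker₃ x) x := by
    intro x _
    refine ((((hasDerivAt_pow 3 x).div_const 6).sub ((hasDerivAt_pow 2 x).div_const 2)).add
      ((hasDerivAt_id x).div_const 3)).congr_deriv ?_
    simp [ker₃]; ring
  rw [intervalIntegral.integral_eq_sub_of_hasDerivAt this (continuous_ker₃.intervalIntegrable _ _)]
  norm_num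

lemma integral_locInterp (k : ℕ) :
    ∫ σ in (0 : ℝ)..1, locInterp v τ k σ = v (k * τ) - v ((k - 1 : ℕ) * τ) := by
  have h := integral_mul_add_mul_add_mul (w := fun _ => 1) (p := ker₁) (q := ker₂) (r := ker₃)
    (v (k * τ) - v ((k - 1 : ℕ) * τ))
    (if 2 ≤ k then (v (k * τ) - 2 * v ((k - 1 : ℕ) * τ) + v ((k - 2 : ℕ) * τ)) else 0)
    (if 3 ≤ k then (v (k * τ) - 3 * v ((k - 1 : ℕ) * τ) + 3 * v ((k - 2 : ℕ) * τ)
          - v ((k - 3 : ℕ) * τ)) else 0)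
    (by simpa using continuous_ker₁.intervalIntegrable _ _)
    (by simpa using continuous_ker₂.intervalIntegrable _ _)
    (by simpa using continuous_ker₃.intervalIntegrable _ _)
  have i1 : ∫ σ in (0 : ℝ)..1, ker₁ σ = 1 := by simp [ker₁]
  rw [locInterp_eq]
  simpa [i1, integral_ker₂, integral_ker₃] using h

/-- The interpolant agrees with $v$ at both ends of the interval, so the error of its derivative
integrates to zero. -/
lemma WeakSing.integral_locErr (hα₀ : 0 < α) (hα₁ : α < 1) (hτ : 0 < τ)
    (hv : WeakSing α B (N * τ) v) {k : ℕ} (hk : 1 ≤ k) (hkN : k ≤ N)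
    (hE : ∀ σ ∈ Ioo (0 : ℝ) 1, |locErr v τ k σ| ≤ E * (1 - σ) ^ (α - 1)) :
    ∫ σ in (0 : ℝ)..1, locErr v τ k σ = 0 := by
  have hi := intervalIntegrable_locErr hα₀ hE
  have hp := (continuous_locInterp v τ k).intervalIntegrable (μ := volume) 0 1
  have h1 : ∫ σ in (0 : ℝ)..1, τ * deriv v (k * τ - τ * σ) = v (k * τ) - v ((k - 1 : ℕ) * τ) := by
    rw [intervalIntegral.integral_const_mul, intervalIntegral.mul_integral_comp_sub_mul,
      ← (hv.abs_diff_le hα₀ hα₁ hτ hk hkN).2.1, Nat.cast_sub hk]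
    congr 1 <;> push_cast <;> ring
  have h2 : ∫ σ in (0 : ℝ)..1, τ * deriv v (k * τ - τ * σ)
      = (∫ σ in (0 : ℝ)..1, locErr v τ k σ) + ∫ σ in (0 : ℝ)..1, locInterp v τ k σ := by
    rw [← intervalIntegral.integral_add hi hp]
    congr 1; ext σ; unfold locInterp; ring
  rw [integral_locInterp] at h2
  linarith

lemma integral_rpow_mul_deriv (hα₀ : 0 < α) (hα₁ : α < 1) (hτ : 0 < τ)
    {n k : ℕ} (hk : 1 ≤ k) (hkn : k ≤ n)
    (hE : ∀ σ ∈ Ioo (0 : ℝ) 1, |locErr v τ k σ| ≤ E * (1 - σ) ^ (α - 1)) :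
    ∫ s in (((k - 1 : ℕ) : ℝ) * τ)..(k * τ), (n * τ - s) ^ (-α) * deriv v s
      = τ ^ (-α) * capTerm α (fun j => v (j * τ)) n k
        + τ ^ (-α) * ∫ σ in (0 : ℝ)..1, (((n - k : ℕ) : ℝ) + σ) ^ (-α) * locErr v τ k σ := by
  have hs := intervalIntegral.mul_integral_comp_sub_mul (a := 0) (b := 1)
    (f := fun s => (n * τ - s) ^ (-α) * deriv v s) τ (k * τ)
  rw [mul_one, mul_zero, sub_zero] at hs
  have hk1 : ((k - 1 : ℕ) : ℝ) * τ = k * τ - τ := by rw [Nat.cast_sub hk]; push_cast; ring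
  rw [hk1, ← hs, ← integral_mul_locInterp hα₁, ← mul_add, ← intervalIntegral.integral_add
    (intervalIntegrable_rpow_add_mul hα₁ _ (continuous_locInterp v τ k))
    (intervalIntegrable_mul_of_locErr_le hα₀ hα₁ _ hE), ← intervalIntegral.integral_const_mul,
    ← intervalIntegral.integral_const_mul]
  refine intervalIntegral.integral_congr fun σ hσ => ?_
  rw [uIcc_of_le zero_le_one] at hσ
  have h1 : n * τ - (k * τ - τ * σ) = τ * (((n - k : ℕ) : ℝ) + σ) := by
    rw [Nat.cast_sub hkn]; ring
  simp only [h1]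
  rw [Real.mul_rpow hτ.le (add_nonneg (Nat.cast_nonneg _) hσ.1)]
  unfold locInterp; ring

/-- The decrements of `m ↦ m ^ (-α)`, with value `1` at `0`. -/
def decr (α : ℝ) (m : ℕ) : ℝ := if m = 0 then 1 else (m : ℝ) ^ (-α) - ((m : ℝ) + 1) ^ (-α)

lemma decr_nonneg (hα₀ : 0 < α) (m : ℕ) : 0 ≤ decr α m := by
  unfold decr
  split_ifs with h
  · exact zero_le_one
  · have : (0 : ℝ) < m := by exact_mod_cast Nat.pos_of_ne_zero h
    exact sub_nonneg.2 (Real.rpow_le_rpow_of_nonpos this (by linarith) (by linarith))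

/-- The sum telescopes to $2-n^{-\alpha}$ for $n\ge1$; one unit is the value assigned at $m=0$. -/
lemma sum_decr_le (n : ℕ) : ∑ m ∈ Finset.range n, decr α m ≤ 2 := by
  have key : ∀ n : ℕ, ∑ m ∈ Finset.range (n + 1), decr α m = 2 - ((n : ℝ) + 1) ^ (-α) := by
    intro n
    induction n with
    | zero => simp [decr]; norm_num
    | succ n ih => rw [Finset.sum_range_succ, ih]; simp [decr]
  rcases n with _ | n
  · simp
  · rw [key]
    linarith [Real.rpow_nonneg (by positivity : (0 : ℝ) ≤ n + 1) (-α)]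

/-- For $m\ge1$ the mean zero property allows $(m+1)^{-\alpha}$ to be subtracted from the kernel,
whose oscillation on the interval is `decr α m`. For $m=0$ the kernel is singular and the beta
integral is bounded directly. -/
lemma WeakSing.abs_integral_locErr_le (hα₀ : 0 < α) (hα₁ : α < 1) (hτ : 0 < τ)
    (hv : WeakSing α B (N * τ) v) {k : ℕ} (hk : 1 ≤ k) (hkN : k ≤ N) (hE₀ : 0 ≤ E)
    (hE : ∀ σ ∈ Ioo (0 : ℝ) 1, |locErr v τ k σ| ≤ E * (1 - σ) ^ (α - 1)) (m : ℕ) :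
    |∫ σ in (0 : ℝ)..1, ((m : ℝ) + σ) ^ (-α) * locErr v τ k σ|
      ≤ E * (1 / α + |∫ σ in (0 : ℝ)..1, betaMajorant α σ|) * decr α m := by
  rcases Nat.eq_zero_or_pos m with rfl | hm
  · have h := abs_integral_le_of_bound_Ioo zero_le_one
      (f := fun σ : ℝ => (((0 : ℕ) : ℝ) + σ) ^ (-α) * locErr v τ k σ)
      ((intervalIntegrable_betaMajorant hα₀ hα₁).const_mul E) (fun σ hσ => ?_)
    · refine h.trans ?_
      rw [intervalIntegral.integral_const_mul]
      simp only [decr, if_true, mul_one]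
      gcongr
      linarith [le_abs_self (∫ σ in (0 : ℝ)..1, betaMajorant α σ), one_div_pos.2 hα₀]
    · have h0 : 0 < ((0 : ℕ) : ℝ) + σ := by simpa using hσ.1
      rw [abs_mul, abs_of_pos (Real.rpow_pos_of_pos h0 _)]
      calc _ ≤ (((0 : ℕ) : ℝ) + σ) ^ (-α) * (E * (1 - σ) ^ (α - 1)) := by
            gcongr; exact hE σ hσ
        _ = E * ((((0 : ℕ) : ℝ) + σ) ^ (-α) * (1 - σ) ^ (α - 1)) := by ring
        _ ≤ _ := by gcongr; exact le_betaMajorant hα₀ hα₁ 0 hσ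
  · have hm0 : (0 : ℝ) < m := by exact_mod_cast hm
    have heq : ∫ σ in (0 : ℝ)..1, ((m : ℝ) + σ) ^ (-α) * locErr v τ k σ
        = ∫ σ in (0 : ℝ)..1, (((m : ℝ) + σ) ^ (-α) - ((m : ℝ) + 1) ^ (-α)) * locErr v τ k σ := by
      simp only [sub_mul]
      rw [intervalIntegral.integral_sub (intervalIntegrable_mul_of_locErr_le hα₀ hα₁ m hE)
        ((intervalIntegrable_locErr hα₀ hE).const_mul _), intervalIntegral.integral_const_mul,
        hv.integral_locErr hα₀ hα₁ hτ hk hkN hE, mul_zero, sub_zero]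
    rw [heq]
    have hd := decr_nonneg hα₀ m
    refine (abs_integral_le_of_bound_Ioo zero_le_one
      ((intervalIntegrable_one_sub_rpow hα₀).const_mul (E * decr α m)) (fun σ hσ => ?_)).trans ?_
    · have h1 := Real.rpow_le_rpow_of_nonpos hm0 (by linarith [hσ.1] : (m : ℝ) ≤ m + σ)
        (by linarith : -α ≤ 0)
      have h2 := Real.rpow_le_rpow_of_nonpos (by linarith [hσ.1])
        (by linarith [hσ.2] : (m : ℝ) + σ ≤ m + 1) (by linarith : -α ≤ 0)
      rw [abs_mul, abs_of_nonneg (sub_nonneg.2 h2)]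
      calc _ ≤ decr α m * (E * (1 - σ) ^ (α - 1)) := by
            refine mul_le_mul ?_ (hE σ hσ) (abs_nonneg _) hd
            simp only [decr, if_neg hm.ne']; linarith
        _ = _ := by ring
    · rw [intervalIntegral.integral_const_mul, integral_one_sub_rpow hα₀]
      calc E * decr α m * (1 / α) = E * (1 / α) * decr α m := by ring
        _ ≤ _ := by
          gcongr
          linarith [abs_nonneg (∫ σ in (0 : ℝ)..1, betaMajorant α σ)]

lemma WeakSing.intervalIntegrable_caputo (hα₀ : 0 < α) (hα₁ : α < 1)
    {T c : ℝ} (hc : 0 ≤ c) (hcT : c ≤ T) (hv : WeakSing α B T v) :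
    IntervalIntegrable (fun s => (c - s) ^ (-α) * deriv v s) volume 0 c := by
  refine intervalIntegrable_of_bound_Ioo hc
    ((by fun_prop : Measurable fun s : ℝ => (c - s) ^ (-α)).mul (measurable_deriv v))
    ((intervalIntegrable_beta hα₀ hα₁).const_mul B) (fun s hs => ?_)
  have hB := hv.nonneg ((hs.1.trans hs.2).trans_le hcT)
  have h0 : 0 < c - s := by linarith [hs.2]
  rw [abs_mul, abs_of_pos (Real.rpow_pos_of_pos h0 _)]
  calc _ ≤ (c - s) ^ (-α) * (B * s ^ (α - 1)) := by
        gcongr; exact hv.bound s ⟨hs.1, hs.2.trans_le hcT⟩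
    _ = B * ((c - s) ^ (-α) * s ^ (α - 1)) := by ring
    _ ≤ _ := by gcongr; exact beta_dominated hα₀ hα₁ hs

/-- Truncation weights in time. -/
def timeErr (α : ℝ) (n : ℕ) : ℝ :=
  ∑ k ∈ Finset.range (n + 1), (k : ℝ) ^ (α - 2) * decr α (n - k)

lemma timeErr_nonneg (hα₀ : 0 < α) (n : ℕ) : 0 ≤ timeErr α n :=
  Finset.sum_nonneg fun k _ => mul_nonneg (by positivity) (decr_nonneg hα₀ _)

/-- `timeErr` is a convolution of two summable sequences, since $\alpha-2<-1$ and `decr` telescopes;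
its sum is at most the product of theirs. -/
lemma exists_sum_timeErr_le (hα₀ : 0 < α) (hα₁ : α < 1) :
    ∃ C, 0 < C ∧ ∀ n, ∑ m ∈ Finset.range n, timeErr α m ≤ C := by
  have hs : Summable fun k : ℕ => (k : ℝ) ^ (α - 2) := Real.summable_nat_rpow.2 (by linarith)
  refine ⟨(∑' k : ℕ, (k : ℝ) ^ (α - 2)) * 2 + 1, ?_, fun n => ?_⟩
  · have : 0 ≤ ∑' k : ℕ, (k : ℝ) ^ (α - 2) := tsum_nonneg fun k => by positivity
    linarith
  unfold timeErr
  rw [Finset.sum_range_diag_flip n (fun k j => (k : ℝ) ^ (α - 2) * decr α j)]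
  calc _ ≤ ∑ m ∈ Finset.range n, (m : ℝ) ^ (α - 2) * 2 := by
        gcongr with m hm
        rw [← Finset.mul_sum]
        gcongr
        exact sum_decr_le _
    _ ≤ (∑' k : ℕ, (k : ℝ) ^ (α - 2)) * 2 := by
        rw [← Finset.sum_mul]
        gcongr
        exact hs.sum_le_tsum _ fun k _ => by positivity
    _ ≤ _ := by linarith

/-- Truncation error of the discrete Caputo derivative on a uniform mesh. -/
theorem WeakSing.exists_caputo_sub_le (hα₀ : 0 < α) (hα₁ : α < 1) :
    ∃ C, 0 < C ∧ ∀ (B τ : ℝ) (N : ℕ) (v : ℝ → ℝ), 0 < τ → WeakSing α B (N * τ) v →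
      ∀ n : ℕ, 1 ≤ n → n ≤ N →
        |caputo α v (n * τ) - τ ^ (-α) / Real.Gamma (1 - α) *
            ∑ k ∈ Finset.range (n + 1), capTerm α (fun j => v (j * τ)) n k|
          ≤ C * B * timeErr α n := by
  obtain ⟨C, hC, hloc⟩ := WeakSing.exists_abs_locErr_le hα₀ hα₁
  have hΓ : 0 < Real.Gamma (1 - α) := Real.Gamma_pos_of_pos (by linarith)
  set G := 1 / α + |∫ σ in (0 : ℝ)..1, betaMajorant α σ| with hG
  have hG0 : 0 < G := by positivity
  refine ⟨1 / Real.Gamma (1 - α) * (C * G), by positivity, fun B τ N v hτ hv n hn hnN => ?_⟩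
  have hN : (1 : ℝ) ≤ N := by exact_mod_cast hn.trans hnN
  have hB := hv.nonneg (by nlinarith)
  have hnN' : (n : ℝ) * τ ≤ N * τ := by gcongr
  have hint := hv.intervalIntegrable_caputo hα₀ hα₁ (by positivity) hnN'
  have hE : ∀ k, k < n → ∀ σ ∈ Ioo (0 : ℝ) 1, |locErr v τ (k + 1) σ|
      ≤ C * (B * τ ^ α) * ((k + 1 : ℕ) : ℝ) ^ (α - 2) * (1 - σ) ^ (α - 1) :=
    fun k hk => hloc B τ N v hτ hv (k + 1) (by omega) (by omega)
  have hsum : ∫ s in (0 : ℝ)..(n * τ), (n * τ - s) ^ (-α) * deriv v s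
      = ∑ k ∈ Finset.range n, (τ ^ (-α) * capTerm α (fun j => v (j * τ)) n (k + 1)
        + τ ^ (-α) * ∫ σ in (0 : ℝ)..1,
            (((n - (k + 1) : ℕ) : ℝ) + σ) ^ (-α) * locErr v τ (k + 1) σ) := by
    have h := intervalIntegral.sum_integral_adjacent_intervals (μ := volume)
      (f := fun s => (n * τ - s) ^ (-α) * deriv v s) (a := fun k : ℕ => (k : ℝ) * τ) (n := n)
      (fun k hk => hint.mono_set ?_)
    · rw [Nat.cast_zero, zero_mul] at h
      rw [← h]
      refine Finset.sum_congr rfl fun k hk => ?_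
      have hk' := Finset.mem_range.1 hk
      exact integral_rpow_mul_deriv hα₀ hα₁ hτ (k := k + 1) (by omega) (by omega) (hE k hk')
    · have h1 : ((k + 1 : ℕ) : ℝ) * τ ≤ n * τ := by
        gcongr; exact hk
      rw [uIcc_of_le (by gcongr; omega), uIcc_of_le (by positivity)]
      exact Icc_subset_Icc (by positivity) h1
  have hcap : ∑ k ∈ Finset.range (n + 1), capTerm α (fun j => v (j * τ)) n k
      = ∑ k ∈ Finset.range n, capTerm α (fun j => v (j * τ)) n (k + 1) := by
    rw [Finset.sum_range_succ', capTerm_zero, add_zero]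
  have hdiff : caputo α v (n * τ) - τ ^ (-α) / Real.Gamma (1 - α) *
        ∑ k ∈ Finset.range (n + 1), capTerm α (fun j => v (j * τ)) n k
      = 1 / Real.Gamma (1 - α) * (τ ^ (-α) * ∑ k ∈ Finset.range n, ∫ σ in (0 : ℝ)..1,
            (((n - (k + 1) : ℕ) : ℝ) + σ) ^ (-α) * locErr v τ (k + 1) σ) := by
    unfold caputo
    rw [hsum, hcap, Finset.sum_add_distrib, ← Finset.mul_sum, ← Finset.mul_sum]
    ring
  rw [hdiff, abs_mul, abs_mul, abs_of_pos (by positivity : 0 < 1 / Real.Gamma (1 - α)),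
    abs_of_pos (by positivity : 0 < τ ^ (-α))]
  have hb : |∑ k ∈ Finset.range n, ∫ σ in (0 : ℝ)..1,
      (((n - (k + 1) : ℕ) : ℝ) + σ) ^ (-α) * locErr v τ (k + 1) σ|
      ≤ C * (B * τ ^ α) * G * timeErr α n := by
    refine (Finset.abs_sum_le_sum_abs _ _).trans ?_
    unfold timeErr
    -- The term $k=0$ of `timeErr` is zero, because $0^{\alpha-2}=0$ by convention.
    rw [Finset.sum_range_succ', Nat.cast_zero, Real.zero_rpow (by linarith), zero_mul, add_zero, Finset.mul_sum]
    refine Finset.sum_le_sum fun k hk => ?_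
    refine (hv.abs_integral_locErr_le hα₀ hα₁ hτ (by omega)
      (by have := Finset.mem_range.1 hk; omega) (by positivity)
      (hE k (Finset.mem_range.1 hk)) _).trans (le_of_eq ?_)
    ring
  -- The powers of $\tau$ cancel: the truncation error at a fixed level need not be small, and only
  -- its summability in $n$ is used.
  calc _ ≤ 1 / Real.Gamma (1 - α) * (τ ^ (-α) * (C * (B * τ ^ α) * G * timeErr α n)) := by gcongr
    _ = 1 / Real.Gamma (1 - α) * (C * G) * B * timeErr α n * (τ ^ (-α) * τ ^ α) := by ring
    _ = _ := by rw [← Real.rpow_add hτ, neg_add_cancel, Real.rpow_zero, mul_one]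

end TimeTruncation

/-! ### Regularity of the solution and consistency in space. -/

lemma hasDerivAt_iteratedDeriv_of_contDiffOn {w : ℝ → ℝ} {S : Set ℝ} (hS : IsOpen S)
    (hw : ContDiffOn ℝ 4 w S) {k : ℕ} (hk : k < 4) {y : ℝ} (hy : y ∈ S) :
    HasDerivAt (iteratedDeriv k w) (iteratedDeriv (k + 1) w y) y := by
  have h := hw.differentiableOn_iteratedDerivWithin (m := k) (by exact_mod_cast hk)
    hS.uniqueDiffOn
  have h2 := h.congr (fun z hz => (iteratedDerivWithin_of_isOpen hS hz).symm)
  rw [iteratedDeriv_succ]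
  exact ((h2 y hy).differentiableAt (hS.mem_nhds hy)).hasDerivAt

/-- Weak singularity at the origin of the solution as a function of time. -/
lemma TimeRegular.weakSing {α L T M : ℝ} (hα₁ : α < 1) {u : ℝ → ℝ → ℝ}
    (hut : TimeRegular α L T M u) {x : ℝ} (hx : x ∈ Ioo 0 L) :
    WeakSing α (|M| * (1 + T ^ (1 - α) + T ^ (2 - α))) T (u x) := by
  obtain ⟨hc, hd, hb⟩ := hut x hx
  have hd' : ContDiffOn ℝ 4 (u x) (Ioo 0 T) := hd.mono Ioo_subset_Ioc_self
  have hder := fun {k : ℕ} (hk : k < 4) {t : ℝ} (ht : t ∈ Ioo 0 T) =>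
    hasDerivAt_iteratedDeriv_of_contDiffOn isOpen_Ioo hd' hk ht
  have hbd : ∀ l : ℕ, l ≤ 4 → ∀ t ∈ Ioo 0 T,
      |iteratedDeriv l (u x) t| ≤ |M| * (1 + t ^ (α - (l : ℝ))) := by
    intro l hl t ht
    have h := hb l hl t (Ioo_subset_Ioc_self ht)
    have hT : 0 < T := ht.1.trans ht.2
    -- The hypothesis bounds derivatives within $(0,T]$; at interior points these are ordinary
    -- derivatives.
    rw [iteratedDerivWithin_eq_iteratedDeriv (uniqueDiffOn_Ioc 0 T)
      ((hd'.contDiffAt (isOpen_Ioo.mem_nhds ht)).of_le (by exact_mod_cast hl))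
      (Ioo_subset_Ioc_self ht)] at h
    refine h.trans ?_
    have := Real.rpow_pos_of_pos ht.1 (α - l)
    gcongr
    exact le_abs_self M
  -- Since $t\le T$, the constant $1$ is at most $T^{p-\alpha}t^{\alpha-p}$ and is absorbed into the
  -- singular term.
  have hone : ∀ t ∈ Ioo 0 T, ∀ p : ℝ, α - p ≤ 0 → 1 + t ^ (α - p) ≤ (1 + T ^ (p - α)) * t ^ (α - p) := by
    intro t ht p hp
    have h1 : t ^ (p - α) * t ^ (α - p) = 1 := by
      rw [← Real.rpow_add ht.1]; simp
    have h2 : t ^ (p - α) ≤ T ^ (p - α) := Real.rpow_le_rpow ht.1.le ht.2.le (by linarith)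
    nlinarith [Real.rpow_pos_of_pos ht.1 (α - p)]
  refine ⟨hc, fun t ht => ?_, fun t ht => ?_, fun t ht => ?_, fun t ht => ?_⟩
  · simpa using (hder (k := 0) (by norm_num) ht).differentiableAt
  · simpa using (hder (k := 1) (by norm_num) ht).differentiableAt
  · have hT : 0 < T := ht.1.trans ht.2
    have h := hbd 1 (by norm_num) t ht
    rw [iteratedDeriv_one, Nat.cast_one] at h
    calc _ ≤ _ := h
      _ ≤ |M| * ((1 + T ^ (1 - α)) * t ^ (α - 1)) := by
        gcongr; exact hone t ht 1 (by linarith)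
      _ ≤ |M| * ((1 + T ^ (1 - α) + T ^ (2 - α)) * t ^ (α - 1)) := by
        have h1 := Real.rpow_pos_of_pos ht.1 (α - 1)
        have h2 := Real.rpow_pos_of_pos hT (2 - α)
        exact mul_le_mul_of_nonneg_left (mul_le_mul_of_nonneg_right (by linarith) h1.le)
          (abs_nonneg M)
      _ = _ := by ring
  · have hT : 0 < T := ht.1.trans ht.2
    have h := hbd 2 (by norm_num) t ht
    rw [iteratedDeriv_succ, iteratedDeriv_one, Nat.cast_ofNat] at h
    calc _ ≤ _ := h
      _ ≤ |M| * ((1 + T ^ (2 - α)) * t ^ (α - 2)) := by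
        gcongr; exact hone t ht 2 (by linarith)
      _ ≤ |M| * ((1 + T ^ (1 - α) + T ^ (2 - α)) * t ^ (α - 2)) := by
        have h1 := Real.rpow_pos_of_pos ht.1 (α - 2)
        have h2 := Real.rpow_pos_of_pos hT (1 - α)
        exact mul_le_mul_of_nonneg_left (mul_le_mul_of_nonneg_right (by linarith) h1.le)
          (abs_nonneg M)
      _ = _ := by ring

lemma abs_le_mul_of_abs_deriv_le {f f' : ℝ → ℝ} {c C : ℝ} (hc : 0 ≤ c) (h0 : f 0 = 0)
    (hcont : ContinuousOn f (Icc 0 c)) (hf : ∀ s ∈ Ico 0 c, HasDerivAt f (f' s) s)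
    (hb : ∀ s ∈ Ico 0 c, |f' s| ≤ C) : |f c| ≤ C * c := by
  have h := norm_image_sub_le_of_norm_deriv_right_le_segment hcont
    (fun s hs => (hf s hs).hasDerivWithinAt) hb c (right_mem_Icc.2 hc)
  simpa [h0] using h

/-- Second order consistency of the central difference quotient. -/
lemma abs_centralDiff_sub_le {w : ℝ → ℝ} {L M x h : ℝ} (hw : ContinuousOn w (Icc 0 L))
    (hd : ContDiffOn ℝ 4 w (Ioo 0 L)) (hM : ∀ y ∈ Ioo 0 L, |iteratedDeriv 4 w y| ≤ M)
    (hh : 0 < h) (hx₀ : h ≤ x) (hx₁ : x + h ≤ L) :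
    |iteratedDeriv 2 w x - (w (x + h) - 2 * w x + w (x - h)) / h ^ 2| ≤ 2 * M * h ^ 2 := by
  have hx : x ∈ Ioo 0 L := ⟨by linarith, by linarith⟩
  have hM0 : 0 ≤ M := (abs_nonneg _).trans (hM x hx)
  have hp : ∀ s ∈ Ico 0 h, x + s ∈ Ioo 0 L := fun s hs => ⟨by linarith [hs.1], by linarith [hs.2]⟩
  have hm : ∀ s ∈ Ico 0 h, x - s ∈ Ioo 0 L := fun s hs => ⟨by linarith [hs.2], by linarith [hs.1]⟩
  have hder := fun {k : ℕ} (hk : k < 4) {y : ℝ} (hy : y ∈ Ioo 0 L) =>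
    hasDerivAt_iteratedDeriv_of_contDiffOn isOpen_Ioo hd hk hy
  have hdp : ∀ k < 4, ∀ s ∈ Ico 0 h, HasDerivAt (fun s => iteratedDeriv k w (x + s))
      (iteratedDeriv (k + 1) w (x + s)) s := fun k hk s hs => by
    simpa using (hder hk (hp s hs)).comp_const_add x s
  have hdm : ∀ k < 4, ∀ s ∈ Ico 0 h, HasDerivAt (fun s => iteratedDeriv k w (x - s))
      (-iteratedDeriv (k + 1) w (x - s)) s := fun k hk s hs => by
    simpa using (hder hk (hm s hs)).comp_const_sub x s
  have hsub : ∀ {s}, s ∈ Ico 0 h → Ico 0 s ⊆ Ico 0 h := fun hs r hr => ⟨hr.1, hr.2.trans hs.2⟩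
  have hsub' : ∀ {s}, s ∈ Ico 0 h → ∀ {r}, r ∈ Icc 0 s → r ∈ Ico 0 h :=
    fun hs _ hr => ⟨hr.1, hr.2.trans_lt hs.2⟩
  -- Combinations of values at $x\pm s$ that vanish at $s=0$ are integrated successively, starting
  -- from $|w^{(4)}|\le M$. Each integration costs a factor $h$, so the fourth gives $2Mh^4$.
  have b3 : ∀ s ∈ Ico 0 h, |iteratedDeriv 3 w (x + s) - iteratedDeriv 3 w (x - s)| ≤ 2 * M * h := by
    intro s hs
    have hd3 : ∀ r ∈ Ico 0 h, HasDerivAt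
        (fun r => iteratedDeriv 3 w (x + r) - iteratedDeriv 3 w (x - r))
        (iteratedDeriv 4 w (x + r) + iteratedDeriv 4 w (x - r)) r := fun r hr =>
      ((hdp 3 (by norm_num) r hr).sub (hdm 3 (by norm_num) r hr)).congr_deriv (by ring)
    have h := abs_le_mul_of_abs_deriv_le (C := 2 * M) hs.1 (by simp)
      (fun r hr => (hd3 r (hsub' hs hr)).continuousAt.continuousWithinAt)
      (fun r hr => hd3 r (hsub hs hr)) (fun r hr => by
        have h1 := hM _ (hp r (hsub hs hr))
        have h2 := hM _ (hm r (hsub hs hr))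
        exact (abs_add_le _ _).trans (by linarith))
    exact h.trans (by gcongr; exact hs.2.le)
  have b2 : ∀ s ∈ Ico 0 h, |iteratedDeriv 2 w (x + s) + iteratedDeriv 2 w (x - s)
      - 2 * iteratedDeriv 2 w x| ≤ 2 * M * h * h := by
    intro s hs
    have hd2 : ∀ r ∈ Ico 0 h, HasDerivAt
        (fun r => iteratedDeriv 2 w (x + r) + iteratedDeriv 2 w (x - r) - 2 * iteratedDeriv 2 w x)
        (iteratedDeriv 3 w (x + r) - iteratedDeriv 3 w (x - r)) r := fun r hr =>
      (((hdp 2 (by norm_num) r hr).add (hdm 2 (by norm_num) r hr)).sub_const _).congr_deriv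
        (by ring)
    have h := abs_le_mul_of_abs_deriv_le (C := 2 * M * h) hs.1 (by simp; ring)
      (fun r hr => (hd2 r (hsub' hs hr)).continuousAt.continuousWithinAt)
      (fun r hr => hd2 r (hsub hs hr)) (fun r hr => b3 r (hsub hs hr))
    exact h.trans (by gcongr; exact hs.2.le)
  have b1 : ∀ s ∈ Ico 0 h, |iteratedDeriv 1 w (x + s) - iteratedDeriv 1 w (x - s)
      - 2 * s * iteratedDeriv 2 w x| ≤ 2 * M * h * h * h := by
    intro s hs
    have hd1 : ∀ r ∈ Ico 0 h, HasDerivAt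
        (fun r => iteratedDeriv 1 w (x + r) - iteratedDeriv 1 w (x - r)
          - 2 * r * iteratedDeriv 2 w x)
        (iteratedDeriv 2 w (x + r) + iteratedDeriv 2 w (x - r) - 2 * iteratedDeriv 2 w x) r :=
      fun r hr => (((hdp 1 (by norm_num) r hr).sub (hdm 1 (by norm_num) r hr)).sub
        (((hasDerivAt_id r).const_mul 2).mul_const _)).congr_deriv (by ring)
    have h := abs_le_mul_of_abs_deriv_le (C := 2 * M * h * h) hs.1 (by simp)
      (fun r hr => (hd1 r (hsub' hs hr)).continuousAt.continuousWithinAt)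
      (fun r hr => hd1 r (hsub hs hr)) (fun r hr => b2 r (hsub hs hr))
    exact h.trans (by gcongr; exact hs.2.le)
  have hd0 : ∀ r ∈ Ico 0 h, HasDerivAt
      (fun r => w (x + r) + w (x - r) - 2 * w x - r ^ 2 * iteratedDeriv 2 w x)
      (iteratedDeriv 1 w (x + r) - iteratedDeriv 1 w (x - r) - 2 * r * iteratedDeriv 2 w x) r := by
    intro r hr
    have h1 := hdp 0 (by norm_num) r hr
    have h2 := hdm 0 (by norm_num) r hr
    simp only [iteratedDeriv_zero, zero_add] at h1 h2
    exact (((h1.add h2).sub_const _).sub ((hasDerivAt_pow 2 r).mul_const _)).congr_deriv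
      (by simp; ring)
  -- At $s=h$ the points $x\pm h$ may be the ends of $[0,L]$, where $w$ is only continuous.
  -- Derivatives are therefore used on $[0,h)$ and continuity on $[0,h]$.
  have hcont : ContinuousOn (fun r => w (x + r) + w (x - r) - 2 * w x
      - r ^ 2 * iteratedDeriv 2 w x) (Icc 0 h) := by
    have h1 : ContinuousOn (fun r => w (x + r)) (Icc 0 h) :=
      hw.comp (by fun_prop) fun r hr => ⟨by linarith [hr.1], by linarith [hr.2]⟩
    have h2 : ContinuousOn (fun r => w (x - r)) (Icc 0 h) :=
      hw.comp (by fun_prop) fun r hr => ⟨by linarith [hr.2], by linarith [hr.1]⟩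
    exact ((h1.add h2).sub continuousOn_const).sub (by fun_prop)
  have b0 := abs_le_mul_of_abs_deriv_le hh.le (by simp; ring) hcont hd0 b1
  have hrw : iteratedDeriv 2 w x - (w (x + h) - 2 * w x + w (x - h)) / h ^ 2
      = -((w (x + h) + w (x - h) - 2 * w x - h ^ 2 * iteratedDeriv 2 w x) / h ^ 2) := by
    field_simp; ring
  rw [hrw, abs_neg, abs_div, abs_of_pos (by positivity : 0 < h ^ 2), div_le_iff₀ (by positivity)]
  exact b0.trans (le_of_eq (by ring))

/-! ### Starting corrections and stability of the actual scheme. -/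

lemma abs_mom_le {α : ℝ} (hα₀ : 0 < α) (hα₁ : α < 1) {k : ℝ → ℝ}
    (hk₁ : ∀ σ ∈ Ioo (0 : ℝ) 1, |k σ| ≤ 1) (m : ℕ) : |mom α k m| ≤ 1 / (1 - α) := by
  have hi : IntervalIntegrable (fun σ : ℝ => σ ^ (-α)) volume 0 1 :=
    intervalIntegral.intervalIntegrable_rpow' (by linarith)
  refine (abs_integral_le_of_bound_Ioo zero_le_one hi fun σ hσ => ?_).trans (le_of_eq ?_)
  · have hm : (0 : ℝ) ≤ m := Nat.cast_nonneg m
    have h0 : 0 < (m : ℝ) + σ := by linarith [hσ.1]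
    rw [abs_mul, abs_of_pos (Real.rpow_pos_of_pos h0 _)]
    calc _ ≤ ((m : ℝ) + σ) ^ (-α) * 1 := by gcongr; exact hk₁ σ hσ
      _ ≤ _ := by
        rw [mul_one]
        exact Real.rpow_le_rpow_of_nonpos hσ.1 (by linarith) (by linarith)
  · rw [integral_rpow (Or.inl (by linarith)), neg_add_eq_sub]
    simp [Real.zero_rpow (by linarith : 1 - α ≠ 0)]

/-- For a kernel of mean zero only the oscillation of $(m+\sigma)^{-\alpha}$ contributes when
$m\ge1$. This makes the corrections from the first two columns summable in $n$. -/
lemma abs_mom_le_decr {α : ℝ} (hα₀ : 0 < α) (hα₁ : α < 1) {k : ℝ → ℝ} (hk : Continuous k)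
    (hk₁ : ∀ σ ∈ Ioo (0 : ℝ) 1, |k σ| ≤ 1) (hk₀ : ∫ σ in (0 : ℝ)..1, k σ = 0) (m : ℕ) :
    |mom α k m| ≤ 1 / (1 - α) * decr α m := by
  rcases Nat.eq_zero_or_pos m with rfl | hm
  · simpa [decr] using abs_mom_le hα₀ hα₁ hk₁ 0
  have hm0 : (0 : ℝ) < m := by exact_mod_cast hm
  have hd := decr_nonneg hα₀ m
  have heq : mom α k m
      = ∫ σ in (0 : ℝ)..1, (((m : ℝ) + σ) ^ (-α) - ((m : ℝ) + 1) ^ (-α)) * k σ := by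
    simp only [sub_mul]
    rw [intervalIntegral.integral_sub (intervalIntegrable_rpow_add_mul hα₁ m hk)
      ((hk.intervalIntegrable _ _).const_mul _), intervalIntegral.integral_const_mul, hk₀,
      mul_zero, sub_zero]
    rfl
  rw [heq]
  refine (abs_integral_le_of_bound_Ioo (g := fun _ => decr α m) zero_le_one (by simp)
    (fun σ hσ => ?_)).trans ?_
  · have h1 := Real.rpow_le_rpow_of_nonpos hm0 (by linarith [hσ.1] : (m : ℝ) ≤ m + σ)
      (by linarith : -α ≤ 0)
    have h2 := Real.rpow_le_rpow_of_nonpos (by linarith [hσ.1])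
      (by linarith [hσ.2] : (m : ℝ) + σ ≤ m + 1) (by linarith : -α ≤ 0)
    rw [abs_mul, abs_of_nonneg (sub_nonneg.2 h2)]
    calc _ ≤ decr α m * 1 := by
          refine mul_le_mul ?_ (hk₁ σ hσ) (abs_nonneg _) hd
          simp only [decr, if_neg hm.ne']; linarith
      _ = _ := mul_one _
  · have : 1 ≤ 1 / (1 - α) := by rw [le_div_iff₀ (by linarith)]; linarith
    simpa using le_mul_of_one_le_left hd this

/-- Discrete maximum principle for a single time level. -/
lemma abs_le_of_diagonal_dominant {K : ℕ} {a c r : ℝ} {e : ℕ → ℝ} (ha : 0 ≤ a) (hc : 1 ≤ c)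
    (hr : 0 ≤ r) (h0 : e 0 = 0) (hK : e K = 0)
    (h : ∀ i, 1 ≤ i → i + 1 ≤ K → |c * e i + a * (2 * e i - e (i + 1) - e (i - 1))| ≤ r) :
    ∀ i ≤ K, |e i| ≤ r := by
  obtain ⟨j, hj, hmax⟩ := Finset.exists_max_image (Finset.range (K + 1)) (fun i => |e i|)
    Finset.nonempty_range_add_one
  have hjK : j ≤ K := Nat.lt_succ_iff.1 (Finset.mem_range.1 hj)
  suffices hs : |e j| ≤ r from fun i hi =>
    (hmax i (Finset.mem_range.2 (Nat.lt_succ_iff.2 hi))).trans hs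
  rcases Nat.eq_zero_or_pos j with rfl | hj0
  · simpa [h0] using hr
  rcases hjK.eq_or_lt with rfl | hjK
  · simpa [hK] using hr
  have h1 := hmax (j + 1) (Finset.mem_range.2 (by omega))
  have h2 := hmax (j - 1) (Finset.mem_range.2 (by omega))
  have h3 := h j hj0 hjK
  rw [abs_le] at h3
  rcases abs_cases (e j) with ⟨he, hs⟩ | ⟨he, hs⟩
  · rw [he] at h1 h2 ⊢
    have := (abs_le.1 h1).2
    have := (abs_le.1 h2).2
    nlinarith [mul_nonneg ha (by linarith : 0 ≤ 2 * e j - e (j + 1) - e (j - 1))]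
  · rw [he] at h1 h2 ⊢
    have := (abs_le.1 h1).1
    have := (abs_le.1 h2).1
    nlinarith [mul_nonneg ha (by linarith : 0 ≤ -(2 * e j - e (j + 1) - e (j - 1)))]

lemma sum_capTerm_one {α : ℝ} (v : ℕ → ℝ) (h0 : v 0 = 0) :
    ∑ k ∈ Finset.range 2, capTerm α v 1 k = mom α ker₁ 0 * v 1 := by
  simp [Finset.sum_range_succ, capTerm, h0]

lemma sum_capTerm_two {α : ℝ} (v : ℕ → ℝ) (h0 : v 0 = 0) :
    ∑ k ∈ Finset.range 3, capTerm α v 2 k = (mom α ker₁ 0 + mom α ker₂ 0) * v 2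
      + (mom α ker₁ 1 - mom α ker₁ 0 - 2 * mom α ker₂ 0) * v 1 := by
  simp [Finset.sum_range_succ, capTerm, h0]; ring

lemma one_le_mom_ker₁_zero {α : ℝ} (hα₀ : 0 < α) (hα₁ : α < 1) : 1 ≤ mom α ker₁ 0 := by
  rw [mom_ker₁_eq hα₁]
  simp only [CharP.cast_eq_zero, zero_add, Real.one_rpow,
    Real.zero_rpow (by linarith : 1 - α ≠ 0), sub_zero]
  rw [le_div_iff₀ (by linarith)]; linarith

/-- The value is $\alpha/(2(1-\alpha)(2-\alpha))$. It keeps the diagonal coefficient of the second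
time level at least $1$, as the maximum principle requires. -/
lemma mom_ker₂_zero_nonneg {α : ℝ} (hα₀ : 0 < α) (hα₁ : α < 1) : 0 ≤ mom α ker₂ 0 := by
  rw [mom_ker₂_eq hα₁]
  simp only [CharP.cast_eq_zero, zero_add, Real.one_rpow,
    Real.zero_rpow (by linarith : 1 - α ≠ 0), sub_zero, add_zero, mul_one, mul_zero]
  have h1 : 0 < 1 - α := by linarith
  have h2 : 0 < 2 - α := by linarith
  rw [sub_nonneg, div_mul_div_comm, div_le_div_iff₀ h2 (by positivity)]
  linarith

/-- Bound for the first two time levels. -/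
lemma abs_first_levels_le {α a : ℝ} (hα₀ : 0 < α) (hα₁ : α < 1) (ha : 0 < a) {K N : ℕ}
    {e : ℕ → ℕ → ℝ} {r : ℕ → ℝ} (hr : ∀ m, 0 ≤ r m) (h0 : ∀ i ≤ K, e 0 i = 0)
    (hbd : ∀ m ≤ N, e m 0 = 0 ∧ e m K = 0)
    (heq : ∀ m, 1 ≤ m → m ≤ N → ∀ i, 1 ≤ i → i + 1 ≤ K →
      |∑ k ∈ Finset.range (m + 1), capTerm α (fun j => e j i) m k
        + a * (2 * e m i - e m (i + 1) - e m (i - 1))| ≤ r m) :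
    (1 ≤ N → ∀ i ≤ K, |e 1 i| ≤ 4 / (1 - α) * r 1 + r 2) ∧
    (2 ≤ N → ∀ i ≤ K, |e 2 i| ≤ 4 / (1 - α) * r 1 + r 2) := by
  have hk₁ : ∀ σ ∈ Ioo (0 : ℝ) 1, |ker₁ σ| ≤ 1 := fun σ _ => by simp [ker₁]
  have hq : 1 ≤ 1 / (1 - α) := by rw [le_div_iff₀ (by linarith)]; linarith
  have hq4 : 4 / (1 - α) = 4 * (1 / (1 - α)) := by ring
  have c1 := one_le_mom_ker₁_zero hα₀ hα₁
  have c2 := mom_ker₂_zero_nonneg hα₀ hα₁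
  have m10 := abs_le.1 (abs_mom_le hα₀ hα₁ hk₁ 0)
  have m11 := abs_le.1 (abs_mom_le hα₀ hα₁ hk₁ 1)
  have m20 := abs_le.1 (abs_mom_le hα₀ hα₁ (fun σ => abs_ker₂_le) 0)
  have r1 := hr 1
  have r2 := hr 2
  have e1 : 1 ≤ N → ∀ i ≤ K, |e 1 i| ≤ r 1 := fun hN =>
    abs_le_of_diagonal_dominant ha.le c1 r1 (hbd 1 hN).1 (hbd 1 hN).2 fun i hi hiK => by
      have h := heq 1 le_rfl hN i hi hiK
      rwa [sum_capTerm_one _ (h0 i (by omega))] at h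
  refine ⟨fun hN i hi => (e1 hN i hi).trans (by rw [hq4]; nlinarith), fun hN => ?_⟩
  refine abs_le_of_diagonal_dominant ha.le (by linarith : 1 ≤ mom α ker₁ 0 + mom α ker₂ 0)
    (by rw [hq4]; nlinarith) (hbd 2 hN).1 (hbd 2 hN).2 fun i hi hiK => ?_
  have h := heq 2 (by norm_num) hN i hi hiK
  rw [sum_capTerm_two _ (h0 i (by omega))] at h
  have h1 := e1 (by omega) i (by omega)
  -- Each moment is at most $1/(1-\alpha)$, and the coefficient is a combination with weights
  -- $1,1,2$, hence the factor $4$.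
  have h2 : |(mom α ker₁ 1 - mom α ker₁ 0 - 2 * mom α ker₂ 0) * e 1 i| ≤ 4 / (1 - α) * r 1 := by
    rw [abs_mul]
    refine mul_le_mul ?_ h1 (abs_nonneg _) (by rw [hq4]; linarith)
    rw [hq4, abs_le]; constructor <;> linarith [m10.1, m10.2, m11.1, m11.2, m20.1, m20.2]
  rw [abs_le] at h h2 ⊢
  constructor <;> linarith [h.1, h.2, h2.1, h2.2]

/-- Induction, with the step $n^\alpha\le(n+1)^\alpha-\alpha(n+1)^{\alpha-1}$, which is Bernoulli's
inequality for an exponent in $(0,1)$. -/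
lemma sum_rpow_le {α : ℝ} (hα₀ : 0 < α) (hα₁ : α < 1) (n : ℕ) :
    ∑ j ∈ Finset.range n, ((j : ℝ) + 1) ^ (α - 1) ≤ (n : ℝ) ^ α / α := by
  induction n with
  | zero => simp [Real.zero_rpow hα₀.ne']
  | succ n ih =>
    rw [Finset.sum_range_succ]
    have hp : (0 : ℝ) < n + 1 := by positivity
    have h := rpow_one_add_le_one_add_mul_self (s := -(1 / ((n : ℝ) + 1))) (p := α)
      (by rw [neg_le_neg_iff, div_le_one hp]; linarith [(Nat.cast_nonneg n : (0 : ℝ) ≤ n)])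
      hα₀.le hα₁.le
    have h1 : (1 + -(1 / ((n : ℝ) + 1))) * (n + 1) = n := by field_simp; ring
    have h2 : (0 : ℝ) ≤ 1 + -(1 / ((n : ℝ) + 1)) := by
      have : 1 / ((n : ℝ) + 1) ≤ 1 := by
        rw [div_le_one hp]; linarith [(Nat.cast_nonneg n : (0 : ℝ) ≤ n)]
      linarith
    have h3 : (n : ℝ) ^ α = (1 + -(1 / ((n : ℝ) + 1))) ^ α * ((n : ℝ) + 1) ^ α := by
      rw [← Real.mul_rpow h2 hp.le, h1]
    have h4 : ((n : ℝ) + 1) ^ α = ((n : ℝ) + 1) ^ (α - 1) * (n + 1) := by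
      rw [← Real.rpow_add_one hp.ne', sub_add_cancel]
    have h5 : (n : ℝ) ^ α ≤ ((n : ℝ) + 1) ^ α - α * ((n : ℝ) + 1) ^ (α - 1) := by
      rw [h3]
      refine (mul_le_mul_of_nonneg_right h (by positivity)).trans (le_of_eq ?_)
      rw [h4]; field_simp; ring
    push_cast
    rw [le_div_iff₀ hα₀] at ih ⊢
    linarith

/-- Stability of the scheme in the maximum norm. -/
theorem exists_scheme_stability {α : ℝ} (hα₀ : 0 < α) (hα₁ : α < 1) :
    ∃ C : ℝ, 0 < C ∧ ∀ (a : ℝ) (K : ℕ), 0 < a → 1 ≤ K → ∀ (e : ℕ → ℕ → ℝ) (r : ℕ → ℝ) (n : ℕ),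
      (∀ m, 0 ≤ r m) → (∀ i ≤ K, e 0 i = 0) → (∀ m ≤ n, e m 0 = 0 ∧ e m K = 0) →
      (∀ m, 1 ≤ m → m ≤ n → ∀ i, 1 ≤ i → i + 1 ≤ K →
        |∑ k ∈ Finset.range (m + 1), capTerm α (fun j => e j i) m k
          + a * (2 * e m i - e m (i + 1) - e m (i - 1))| ≤ r m) →
      ∀ i ≤ K, |e n i| ≤ C * (r 1 + r 2
        + ∑ j ∈ Finset.range n, ((j : ℝ) + 1) ^ (α - 1) * r (n - j)) := by
  obtain ⟨C, hC, hst⟩ := exists_mesh_stability hα₀ hα₁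
  have hq : 1 ≤ 1 / (1 - α) := by rw [le_div_iff₀ (by linarith)]; linarith
  set q := 1 / (1 - α) with hqdef
  -- The corrections add up to at most $6qE\cdot(2+3)=30qE$, and $E=4qr_1+r_2$ gives
  -- $120q^2r_1+30qr_2$ with $q\ge1$.
  refine ⟨C * (1 + 120 * q ^ 2), by positivity, fun a K ha hK e r n hr h0 hbd heq i hi => ?_⟩
  set E := 4 * q * r 1 + r 2 with hE
  have r1 := hr 1
  have r2 := hr 2
  have hE0 : 0 ≤ E := by positivity
  have hfirst := abs_first_levels_le hα₀ hα₁ ha hr h0 hbd heq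
  rw [show 4 / (1 - α) = 4 * q by rw [hqdef]; ring] at hfirst
  -- Residual for the translation invariant scheme: the given one plus the exceptional columns, at
  -- most $2q\,$`decr α (m-1)`$\,E$ for the first and $4q\,$`decr α (m-2)`$\,E$ for the second.
  set ρ : ℕ → ℝ := fun m => if m = 0 then 0 else
    r m + 6 * q * E * (decr α (m - 1) + decr α (m - 2)) with hρ
  have hρ0 : ∀ m, 0 ≤ ρ m := by
    intro m
    have := decr_nonneg hα₀ (m - 1)
    have := decr_nonneg hα₀ (m - 2)
    have := hr m
    simp only [hρ]; split_ifs <;> positivity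
  have hmain := hst a K ha hK e ρ n hbd (fun m _ => hρ0 m) ?_ i hi
  · refine hmain.trans ?_
    have hS : ∑ m ∈ Finset.range (n + 1), C * (((n - m : ℕ) : ℝ) + 1) ^ (α - 1) * ρ m
        = C * ∑ j ∈ Finset.range n, ((j : ℝ) + 1) ^ (α - 1) * ρ (n - j) := by
      rw [← Finset.sum_range_reflect, Finset.sum_range_succ, Finset.mul_sum]
      have : ρ (n + 1 - 1 - n) = 0 := by simp [hρ]
      rw [this, mul_zero, add_zero]
      refine Finset.sum_congr rfl fun j hj => ?_
      have := Finset.mem_range.1 hj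
      rw [show n + 1 - 1 - j = n - j by omega, show n - (n - j) = j by omega]
      ring
    rw [hS, mul_assoc]
    gcongr
    have hterm : ∀ j ∈ Finset.range n, ((j : ℝ) + 1) ^ (α - 1) * ρ (n - j)
        ≤ ((j : ℝ) + 1) ^ (α - 1) * r (n - j)
          + 6 * q * E * (decr α (n - 1 - j) + decr α (n - 1 - j - 1)) := by
      intro j hj
      have hj' := Finset.mem_range.1 hj
      simp only [hρ, if_neg (by omega : ¬ n - j = 0)]
      rw [mul_add, show n - j - 1 = n - 1 - j by omega, show n - j - 2 = n - 1 - j - 1 by omega]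
      have d1 := decr_nonneg hα₀ (n - 1 - j)
      have d2 := decr_nonneg hα₀ (n - 1 - j - 1)
      have hone : ((j : ℝ) + 1) ^ (α - 1) ≤ 1 :=
        Real.rpow_le_one_of_one_le_of_nonpos
          (by linarith [(Nat.cast_nonneg j : (0 : ℝ) ≤ j)]) (by linarith)
      have := mul_le_of_le_one_left (by positivity :
        0 ≤ 6 * q * E * (decr α (n - 1 - j) + decr α (n - 1 - j - 1))) hone
      linarith
    have hsum1 : ∑ j ∈ Finset.range n, decr α (n - 1 - j) ≤ 2 := by
      rw [Finset.sum_range_reflect (fun j => decr α j) n]; exact sum_decr_le n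
    -- By truncated subtraction the value `decr α 0` occurs twice, hence $3$ instead of $2$.
    have hsum2 : ∑ j ∈ Finset.range n, decr α (n - 1 - j - 1) ≤ 3 := by
      rw [Finset.sum_range_reflect (fun j => decr α (j - 1)) n]
      rcases n with _ | n
      · simp
      · rw [Finset.sum_range_succ']
        have := sum_decr_le (α := α) n
        simp only [Nat.add_sub_cancel, Nat.zero_sub]
        have h1 : decr α 0 = 1 := by simp [decr]
        linarith
    have hX : 0 ≤ ∑ j ∈ Finset.range n, ((j : ℝ) + 1) ^ (α - 1) * r (n - j) :=
      Finset.sum_nonneg fun j _ => mul_nonneg (by positivity) (hr _)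
    set X := ∑ j ∈ Finset.range n, ((j : ℝ) + 1) ^ (α - 1) * r (n - j)
    calc ∑ j ∈ Finset.range n, ((j : ℝ) + 1) ^ (α - 1) * ρ (n - j)
        ≤ X + 6 * q * E * (∑ j ∈ Finset.range n, decr α (n - 1 - j)
            + ∑ j ∈ Finset.range n, decr α (n - 1 - j - 1)) := by
          rw [← Finset.sum_add_distrib, Finset.mul_sum, ← Finset.sum_add_distrib]
          exact Finset.sum_le_sum hterm
      _ ≤ X + 6 * q * E * (2 + 3) := by gcongr
      _ ≤ (1 + 120 * q ^ 2) * (r 1 + r 2 + X) := by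
          rw [hE]
          nlinarith [mul_nonneg (sq_nonneg q) hX, mul_nonneg (sq_nonneg q) r2,
            mul_nonneg (mul_nonneg (by linarith : 0 ≤ q) (by linarith : 0 ≤ q - 1)) r2]
  · intro m hm i hi hiK
    rcases Nat.eq_zero_or_pos m with rfl | hm0
    · simp [hρ, h0 i (by omega), h0 (i + 1) hiK, h0 (i - 1) (by omega)]
    have h := heq m hm0 hm i hi hiK
    rw [sum_symbSeries_eq α (fun j => e j i) (h0 i (by omega)) hm0]
    have hm2 := abs_mom_le_decr hα₀ hα₁ continuous_ker₂ (fun σ => abs_ker₂_le) integral_ker₂ (m - 1)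
    have hm3 := abs_mom_le_decr hα₀ hα₁ continuous_ker₃ (fun σ => abs_ker₃_le) integral_ker₃ (m - 1)
    have hm3' := abs_mom_le_decr hα₀ hα₁ continuous_ker₃ (fun σ => abs_ker₃_le) integral_ker₃
      (m - 2)
    rw [← hqdef] at hm2 hm3 hm3'
    have d1 := decr_nonneg hα₀ (m - 1)
    have d2 := decr_nonneg hα₀ (m - 2)
    have he1 := hfirst.1 (by omega) i (by omega)
    have t1 : |(mom α ker₂ (m - 1) + mom α ker₃ (m - 1)) * e 1 i| ≤ 2 * (q * decr α (m - 1)) * E := by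
      rw [abs_mul]
      refine mul_le_mul ?_ he1 (abs_nonneg _) (by positivity)
      exact (abs_add_le _ _).trans (by linarith)
    have t2 : |if 2 ≤ m then mom α ker₃ (m - 2) * (e 2 i - 3 * e 1 i) else 0|
        ≤ q * decr α (m - 2) * (4 * E) := by
      split_ifs with h2
      · have he2 := hfirst.2 (by omega) i (by omega)
        rw [abs_mul]
        refine mul_le_mul hm3' ?_ (abs_nonneg _) (by positivity)
        rw [abs_le] at he1 he2 ⊢
        constructor <;> linarith [he1.1, he1.2, he2.1, he2.2]
      · rw [abs_zero]; positivity
    simp only [hρ, if_neg hm0.ne']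
    have p1 : 0 ≤ q * decr α (m - 1) * E := by positivity
    have p2 : 0 ≤ q * decr α (m - 2) * E := by positivity
    rw [abs_le] at h t1 t2 ⊢
    constructor <;> nlinarith [h.1, h.2, t1.1, t1.2, t2.1, t2.2]

/-! ### The equation satisfied by the error. -/

lemma capTerm_sub (α : ℝ) (v w : ℕ → ℝ) (n k : ℕ) :
    capTerm α (fun j => v j - w j) n k = capTerm α v n k - capTerm α w n k := by
  unfold capTerm; split_ifs <;> ring

lemma timeMesh_one (T : ℝ) (K n : ℕ) : timeMesh T 1 K n = n * (T / K) := by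
  unfold timeMesh; rw [Real.rpow_one]; ring

/-- Consistency of the scheme: the equation satisfied by the error. -/
lemma exists_error_equation {α : ℝ} (hα₀ : 0 < α) (hα₁ : α < 1) :
    ∃ C : ℝ, 0 < C ∧ ∀ (ϱ L T M : ℝ), 0 < ϱ → 0 < L → 0 < T →
      ∀ (f : ℝ → ℝ → ℝ) (φ : ℝ → ℝ) (u : ℝ → ℝ → ℝ), IsSolution α ϱ L T f φ u →
      TimeRegular α L T M u → SpaceRegular L T M u →
      ∀ Kx Kt : ℕ, 1 ≤ Kx → 1 ≤ Kt → ∀ v : ℕ → ℕ → ℝ, IsSchemeSolution α ϱ L T 1 Kx Kt f φ v →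
      ∀ n, 1 ≤ n → n ≤ Kt → ∀ i, 1 ≤ i → i + 1 ≤ Kx →
        |∑ k ∈ Finset.range (n + 1),
            capTerm α (fun j => u (spaceMesh L Kx i) (j * (T / Kt)) - v i j) n k
          + ϱ * Real.Gamma (1 - α) * (T / Kt) ^ α / (L / Kx) ^ 2 *
            (2 * (u (spaceMesh L Kx i) (n * (T / Kt)) - v i n)
              - (u (spaceMesh L Kx (i + 1)) (n * (T / Kt)) - v (i + 1) n)
              - (u (spaceMesh L Kx (i - 1)) (n * (T / Kt)) - v (i - 1) n))|
        ≤ (T / Kt) ^ α * (C * (|M| * (1 + T ^ (1 - α) + T ^ (2 - α))) * timeErr α n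
          + 2 * ϱ * Real.Gamma (1 - α) * |M| * (L / Kx) ^ 2) := by
  obtain ⟨C, hC, htr⟩ := WeakSing.exists_caputo_sub_le hα₀ hα₁
  have hΓ : 0 < Real.Gamma (1 - α) := Real.Gamma_pos_of_pos (by linarith)
  refine ⟨Real.Gamma (1 - α) * C, by positivity, ?_⟩
  intro ϱ L T M hϱ hL hT f φ u hu hut hux Kx Kt hKx hKt v hv n hn hnK i hi hiK
  have hKx0 : (0 : ℝ) < Kx := by exact_mod_cast hKx
  have hKt0 : (0 : ℝ) < Kt := by exact_mod_cast hKt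
  have hsch := hv.equation n hn hnK i hi hiK
  rw [timeMesh_one] at hsch
  rw [discreteCaputo_eq (timeMesh_one T Kt) (by positivity) hα₁ _ hn] at hsch
  simp_rw [capTerm_sub]
  rw [Finset.sum_sub_distrib]
  have hTK : (Kt : ℝ) * (T / Kt) = T := by field_simp
  have hLK : (Kx : ℝ) * (L / Kx) = L := by field_simp
  have hτ : 0 < T / Kt := by positivity
  have hh : 0 < L / Kx := by positivity
  set τ := T / Kt
  set h := L / Kx with hhdef
  set B := |M| * (1 + T ^ (1 - α) + T ^ (2 - α))
  have ht : n * τ ∈ Ioc 0 T := ⟨by positivity, by rw [← hTK]; gcongr⟩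
  have hx₀ : h ≤ spaceMesh L Kx i := by
    have : (1 : ℝ) ≤ i := by exact_mod_cast hi
    unfold spaceMesh; exact le_mul_of_one_le_left hh.le this
  have hxp : spaceMesh L Kx (i + 1) = spaceMesh L Kx i + h := by
    simp only [spaceMesh, h]; push_cast; ring
  have hxm : spaceMesh L Kx (i - 1) = spaceMesh L Kx i - h := by
    simp only [spaceMesh, h]; rw [Nat.cast_sub hi]; push_cast; ring
  have hx₁ : spaceMesh L Kx i + h ≤ L := by
    have : ((i + 1 : ℕ) : ℝ) ≤ Kx := by exact_mod_cast hiK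
    rw [← hxp, spaceMesh, ← hhdef]
    exact (mul_le_mul_of_nonneg_right this hh.le).trans_eq hLK
  rw [hxp, hxm]
  set x := spaceMesh L Kx i
  have hx : x ∈ Ioo 0 L := ⟨by linarith, by linarith⟩
  obtain ⟨hw, hd, hM⟩ := hux _ ht
  have e1 := abs_centralDiff_sub_le hw hd (fun y hy => (hM y hy).trans (le_abs_self M)) hh hx₀ hx₁
  have e2 := htr B τ Kt (u x) hτ (by rw [hTK]; exact hut.weakSing hα₁ hx) n hn hnK
  have e3 := hu.equation x hx _ ht
  set Su := ∑ k ∈ Finset.range (n + 1), capTerm α (fun j => u x (j * τ)) n k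
  set Sv := ∑ k ∈ Finset.range (n + 1), capTerm α (v i) n k
  set W := iteratedDeriv 2 (fun y => u y (n * τ)) x
  set c := caputo α (u x) (n * τ)
  have hτα : τ ^ (-α) * τ ^ α = 1 := by rw [← Real.rpow_add hτ]; simp
  have hτp : 0 < τ ^ α := Real.rpow_pos_of_pos hτ α
  -- The scheme times $\tau^\alpha\Gamma(1-\alpha)$ is subtracted from the differential equation
  -- scaled in the same way. The source terms cancel and only the truncation errors in time and
  -- space remain.
  have key : Su - Sv + ϱ * Real.Gamma (1 - α) * τ ^ α / h ^ 2 *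
      (2 * (u x (n * τ) - v i n) - (u (x + h) (n * τ) - v (i + 1) n)
        - (u (x - h) (n * τ) - v (i - 1) n))
      = τ ^ α * (Real.Gamma (1 - α) * (-(c - τ ^ (-α) / Real.Gamma (1 - α) * Su)
        + ϱ * (W - (u (x + h) (n * τ) - 2 * u x (n * τ) + u (x - h) (n * τ)) / h ^ 2))) := by
    have hSu : τ ^ α * (Real.Gamma (1 - α) * (τ ^ (-α) / Real.Gamma (1 - α) * Su)) = Su := by
      rw [show τ ^ α * (Real.Gamma (1 - α) * (τ ^ (-α) / Real.Gamma (1 - α) * Su))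
        = τ ^ (-α) * τ ^ α * (Real.Gamma (1 - α) / Real.Gamma (1 - α)) * Su by ring, hτα,
        div_self hΓ.ne']; ring
    have hSv : τ ^ α * (Real.Gamma (1 - α) * (τ ^ (-α) / Real.Gamma (1 - α) * Sv)) = Sv := by
      rw [show τ ^ α * (Real.Gamma (1 - α) * (τ ^ (-α) / Real.Gamma (1 - α) * Sv))
        = τ ^ (-α) * τ ^ α * (Real.Gamma (1 - α) / Real.Gamma (1 - α)) * Sv by ring, hτα,
        div_self hΓ.ne']; ring
    rw [hsch] at hSv
    have hc : c = ϱ * W + f x (n * τ) := by linarith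
    rw [hc]
    linear_combination (-1 : ℝ) * hSu + hSv
  rw [key, abs_mul, abs_of_pos hτp]
  refine mul_le_mul_of_nonneg_left ?_ hτp.le
  rw [abs_mul, abs_of_pos hΓ]
  calc _ ≤ Real.Gamma (1 - α) * (C * B * timeErr α n + ϱ * (2 * |M| * h ^ 2)) := by
        gcongr
        refine (abs_add_le _ _).trans ?_
        rw [abs_neg, abs_mul, abs_of_pos hϱ]
        gcongr
    _ = _ := by ring

end TFDE
end

/-! ### Convergence. -/

theorem mainTheorem5 (α ϱ L T M : ℝ) (hα₀ : 0 < α) (hα₁ : α < 1) (hϱ : 0 < ϱ)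
    (hL : 0 < L) (hT : 0 < T)
    (f : ℝ → ℝ → ℝ) (φ : ℝ → ℝ) (u : ℝ → ℝ → ℝ)
    (hu : TFDE.IsSolution α ϱ L T f φ u)
    (hut : TFDE.TimeRegular α L T M u) (hux : TFDE.SpaceRegular L T M u) :
    ∃ C h₀ τ₀ : ℝ, 0 < C ∧ 0 < h₀ ∧ 0 < τ₀ ∧
      ∀ Kx Kt : ℕ, 1 ≤ Kx → 1 ≤ Kt → L / (Kx : ℝ) ≤ h₀ → T / (Kt : ℝ) ≤ τ₀ →
        ∀ v : ℕ → ℕ → ℝ, TFDE.IsSchemeSolution α ϱ L T 1 Kx Kt f φ v →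
          ∀ n : ℕ, 1 ≤ n → n ≤ Kt →
            TFDE.maxNorm Kx (fun i => u (TFDE.spaceMesh L Kx i) (TFDE.timeMesh T 1 Kt n) - v i n)
              ≤ C * ((L / (Kx : ℝ)) ^ 2 + (T / (Kt : ℝ)) ^ α) := by
  obtain ⟨C₁, hC₁, herr⟩ := TFDE.exists_error_equation hα₀ hα₁
  obtain ⟨C₂, hC₂, hstab⟩ := TFDE.exists_scheme_stability hα₀ hα₁
  obtain ⟨C₃, hC₃, hsum⟩ := TFDE.exists_sum_timeErr_le hα₀ hα₁
  have hΓ : 0 < Real.Gamma (1 - α) := Real.Gamma_pos_of_pos (by linarith)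
  set P : ℝ := C₁ * (|M| * (1 + T ^ (1 - α) + T ^ (2 - α))) with hPdef
  set Q : ℝ := 2 * ϱ * Real.Gamma (1 - α) * |M| with hQdef
  have hP : 0 ≤ P := by positivity
  have hQ : 0 ≤ Q := by positivity
  -- Three terms, $r_1$, $r_2$ and the convolution, each contribute $PC_3\tau^\alpha$; the $h^2$
  -- parts contribute $1,1,1/\alpha$ times $QT^\alpha$. The added $1$ makes the constant positive.
  -- No smallness of the meshes is needed, so both thresholds are $1$.
  refine ⟨C₂ * (3 * (P * C₃) + (2 + 1 / α) * (Q * T ^ α)) + 1, 1, 1, by positivity, one_pos,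
    one_pos, ?_⟩
  intro Kx Kt hKx hKt _ _ v hv n hn hnK
  have hKx0 : (0 : ℝ) < Kx := by exact_mod_cast hKx
  have hKt0 : (0 : ℝ) < Kt := by exact_mod_cast hKt
  have heq := herr ϱ L T M hϱ hL hT f φ u hu hut hux Kx Kt hKx hKt v hv
  have hTK : (Kt : ℝ) * (T / Kt) = T := by field_simp
  have hτ : 0 < T / Kt := by positivity
  have hh : 0 < L / Kx := by positivity
  have hτT : T / Kt ≤ T := div_le_self hT.le (by exact_mod_cast hKt)
  have hend : TFDE.spaceMesh L Kx Kx = L := by unfold TFDE.spaceMesh; field_simp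
  have hzero : TFDE.spaceMesh L Kx 0 = 0 := by simp [TFDE.spaceMesh]
  set τ := T / Kt with hτdef
  set h := L / Kx with hhdef
  set r : ℕ → ℝ := fun m => τ ^ α * (P * TFDE.timeErr α m + Q * h ^ 2) with hr
  have hτp : 0 < τ ^ α := Real.rpow_pos_of_pos hτ α
  have hτTp : τ ^ α ≤ T ^ α := Real.rpow_le_rpow hτ.le hτT hα₀.le
  have hr0 : ∀ m, 0 ≤ r m := fun m => by
    have := TFDE.timeErr_nonneg hα₀ m
    simp only [hr]; positivity
  have hmesh : ∀ i ≤ Kx, TFDE.spaceMesh L Kx i ∈ Set.Icc 0 L := fun i hi => by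
    refine ⟨by unfold TFDE.spaceMesh; positivity, ?_⟩
    refine le_of_le_of_eq ?_ hend
    exact mul_le_mul_of_nonneg_right (Nat.cast_le.2 hi) hh.le
  have hbound := hstab (ϱ * Real.Gamma (1 - α) * τ ^ α / h ^ 2) Kx (by positivity) hKx
    (fun m i => u (TFDE.spaceMesh L Kx i) (m * τ) - v i m) r n hr0
    (fun i hi => by
      simp only [Nat.cast_zero, zero_mul]
      rw [hv.initial i hi, hu.initial _ (hmesh i hi), sub_self])
    (fun m hm => by
      rcases Nat.eq_zero_or_pos m with rfl | hm0
      · simp only [Nat.cast_zero, zero_mul]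
        rw [hv.initial 0 (Nat.zero_le _), hu.initial _ (hmesh 0 (Nat.zero_le _)), hv.initial Kx le_rfl,
          hu.initial _ (hmesh Kx le_rfl)]
        simp
      · have ht : (m : ℝ) * τ ∈ Set.Ioc 0 T :=
          ⟨by positivity, by rw [← hTK]; gcongr; exact hm.trans hnK⟩
        rw [hzero, hend, (hv.boundary m hm0 (hm.trans hnK)).1, (hv.boundary m hm0 (hm.trans hnK)).2,
          (hu.boundary _ ht).1, (hu.boundary _ ht).2]
        simp)
    (fun m hm hmn i hi hiK => heq m hm (hmn.trans hnK) i hi hiK)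
  have hterr : ∀ m, TFDE.timeErr α m ≤ C₃ := fun m =>
    (Finset.single_le_sum (f := TFDE.timeErr α) (fun j _ => TFDE.timeErr_nonneg hα₀ j)
      (Finset.self_mem_range_succ m)).trans (hsum _)
  have hrle : ∀ m, r m ≤ P * C₃ * τ ^ α + Q * T ^ α * h ^ 2 := fun m => by
    calc r m = P * TFDE.timeErr α m * τ ^ α + Q * τ ^ α * h ^ 2 := by simp only [hr]; ring
      _ ≤ _ := by gcongr; exact hterr m
  -- The two parts of the residual are treated differently: for the summable `timeErr` the weights
  -- are bounded by $1$, while for the constant $h^2$ their sum is at most $n^\alpha/\alpha$ and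
  -- $(n\tau)^\alpha\le T^\alpha$.
  have hconv : ∑ j ∈ Finset.range n, ((j : ℝ) + 1) ^ (α - 1) * r (n - j)
      ≤ P * C₃ * τ ^ α + 1 / α * (Q * T ^ α) * h ^ 2 := by
    have h1 : ∀ j ∈ Finset.range n, ((j : ℝ) + 1) ^ (α - 1) * r (n - j)
        ≤ P * τ ^ α * TFDE.timeErr α (n - j) + Q * τ ^ α * h ^ 2 * ((j : ℝ) + 1) ^ (α - 1) := by
      intro j _
      have hone : ((j : ℝ) + 1) ^ (α - 1) ≤ 1 :=
        Real.rpow_le_one_of_one_le_of_nonpos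
          (by linarith [(Nat.cast_nonneg j : (0 : ℝ) ≤ j)]) (by linarith)
      have hte := TFDE.timeErr_nonneg hα₀ (n - j)
      have := mul_le_of_le_one_left
        (by positivity : 0 ≤ P * τ ^ α * TFDE.timeErr α (n - j)) hone
      simp only [hr]
      linarith
    have h2 : ∑ j ∈ Finset.range n, TFDE.timeErr α (n - j) ≤ C₃ := by
      refine le_trans ?_ (hsum (n + 1))
      rw [Finset.sum_range_succ', ← Finset.sum_range_reflect (fun j => TFDE.timeErr α (j + 1))]
      have : ∑ j ∈ Finset.range n, TFDE.timeErr α (n - j)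
          = ∑ j ∈ Finset.range n, TFDE.timeErr α (n - 1 - j + 1) :=
        Finset.sum_congr rfl fun j hj => by
          have := Finset.mem_range.1 hj
          rw [show n - 1 - j + 1 = n - j by omega]
      rw [this]
      linarith [TFDE.timeErr_nonneg hα₀ 0]
    have h3 : τ ^ α * (n : ℝ) ^ α ≤ T ^ α := by
      rw [← Real.mul_rpow hτ.le (Nat.cast_nonneg n)]
      refine Real.rpow_le_rpow (by positivity) ?_ hα₀.le
      rw [← hTK, mul_comm]; gcongr
    calc _ ≤ _ := Finset.sum_le_sum h1
      _ = P * τ ^ α * ∑ j ∈ Finset.range n, TFDE.timeErr α (n - j)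
          + Q * τ ^ α * h ^ 2 * ∑ j ∈ Finset.range n, ((j : ℝ) + 1) ^ (α - 1) := by
        rw [Finset.sum_add_distrib, Finset.mul_sum, Finset.mul_sum]
      _ ≤ P * τ ^ α * C₃ + Q * τ ^ α * h ^ 2 * ((n : ℝ) ^ α / α) := by
        gcongr; exact TFDE.sum_rpow_le hα₀ hα₁ n
      _ = P * C₃ * τ ^ α + Q * h ^ 2 / α * (τ ^ α * (n : ℝ) ^ α) := by ring
      _ ≤ P * C₃ * τ ^ α + Q * h ^ 2 / α * T ^ α := by gcongr
      _ = _ := by ring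
  unfold TFDE.maxNorm
  refine Finset.sup'_le _ _ fun i hi => ?_
  rw [TFDE.timeMesh_one]
  refine (hbound i (Nat.lt_succ_iff.1 (Finset.mem_range.1 hi))).trans ?_
  have hX : 0 ≤ P * C₃ := by positivity
  have hY : 0 ≤ Q * T ^ α := by positivity
  calc _ ≤ C₂ * ((P * C₃ * τ ^ α + Q * T ^ α * h ^ 2) + (P * C₃ * τ ^ α + Q * T ^ α * h ^ 2)
          + (P * C₃ * τ ^ α + 1 / α * (Q * T ^ α) * h ^ 2)) := by
        gcongr
        · exact hrle 1
        · exact hrle 2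
    _ = C₂ * (3 * (P * C₃)) * τ ^ α + C₂ * ((2 + 1 / α) * (Q * T ^ α)) * h ^ 2 := by ring
    _ ≤ _ := by
        have p1 : 0 ≤ C₂ * (3 * (P * C₃)) := by positivity
        have p2 : 0 ≤ C₂ * ((2 + 1 / α) * (Q * T ^ α)) := by positivity
        nlinarith [mul_nonneg p1 (sq_nonneg h), mul_nonneg p2 hτp.le, sq_nonneg h]
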